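/- For a group $G$, a tuple $(c_1,\dots,c_k)\in G^k$ ($k\in\mathbb N$) belongs to $\mathrm{SphEq}(G)$ if the spherical equation $\prod_{i=1}^k z_i^{-1}c_iz_i=1$ has a solution $(z_1,\dots,z_k)\in G^k$. For a prime $p$ let $\mathrm{GL}_2(p)$ be the group of invertible $2\times 2$ matrices over $\mathbb Z_p=\mathbb Z/p\mathbb Z$. 1. There is a deterministic polynomial-time algorithm (on a multi-stack Turing machine) that, given a prime $p$ and matrices $C_1,\dots,C_k\in\mathrm{GL}_2(p)$, with $p$ and all matrix entries written in binary, decides whether $(C_1,\dots,C_k)\in\mathrm{SphEq}(\mathrm{GL}_2(p))$. 2. A solution, if one exists, can be found in randomized polynomial time: there is a polynomial-time algorithm that, given the same input together with polynomially many independent uniformly random bits, outputs either a solution $(Z_1,\dots,Z_k)\in\mathrm{GL}_2(p)^k$ of $\prod_{i=1}^k Z_i^{-1}C_iZ_i=1$ or "none"; every tuple that it outputs is a correct solution, and if a solution exists, then it outputs one with probability at least $2/3$. 3. If $p\ge 5$ is prime, $k\ge 4$, and $C_1,\dots,C_k\in\mathrm{GL}_2(p)$ are all non-scalar, then $(C_1,\dots,C_k)\in\mathrm{SphEq}(\mathrm{GL}_2(p))$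 if and only if $\det(C_1)\cdots\det(C_k)=1$. -/

import Mathlib

open Computability Turing

/-! ### Spherical equations -/

/-- `z = (z₁, …, z_k)` solves the spherical equation `∏ᵢ zᵢ⁻¹ cᵢ zᵢ = 1` with constants
`c = (c₁, …, c_k)`. -/
def IsSphericalSolution {G : Type*} [Group G] (c z : List G) : Prop :=
  z.length = c.length ∧ (List.zipWith (fun ci zi => zi⁻¹ * ci * zi) c z).prod = 1

/-- The set of all tuples `(c₁, …, c_k)` over `G`, with `k ∈ ℕ` arbitrary, whose spherical equation
has a solution in `G`. -/
def SphEq (G : Type*) [Group G] : Set (List G) :=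
  {c | ∃ z : List G, IsSphericalSolution c z}

/-! ### Complexity notions

Deterministic polynomial time is Mathlib's `Turing.TM2ComputableInPolyTime`: a Turing machine with
finitely many stacks, labels and states which, started on the encoding of any `a`, halts with the
encoding of the value within `q(|encoding of a|)` steps for a fixed polynomial `q`. -/

/-- The decision problem "given `a`, does `P a` hold?" is decidable in deterministic polynomial
time, instances being encoded by `ea` over a finite alphabet. -/
def DecidableInPolyTime {α Γ : Type} [Fintype Γ] (ea : Encoding α Γ) (P : α → Prop) : Prop :=
  open Classical in
  Nonempty (TM2ComputableInPolyTime ea.encode encodingBoolBool.encode (fun a => decide (P a)))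

/-- The encoding of `Option β` in which `none` is the empty word and `some b` is a start marker
followed by the encoding of `b`. -/
def encodingOption {β Γ : Type} (eb : Encoding β Γ) : Encoding (Option β) (Option Γ) where
  encode
    | none => []
    | some b => none :: (eb.encode b).map some
  decode
    | [] => some none
    | _ :: l => (eb.decode (l.filterMap id)).map some
  decode_encode x := by cases x <;> simp

/-- The search problem "given `a`, find some `b` with `R a b`, if there is one" is solvable in
randomized polynomial time.

The function `f` is computed by a deterministic polynomial-time machine from the instance `a`
and a word of random bits; on `a` it is given `m(|a|)` independent uniformly distributed bits, for a
fixed polynomial `m` in the length `|a|` of the encoding of `a`. It outputs either a value `b`, which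
is then always correct, or `none`; and whenever a correct value exists, one is output with
probability at least `2/3`. -/
def SearchableInRandPolyTime {α β Γ Δ : Type} [Fintype Γ] [Fintype Δ]
    (ea : Encoding α Γ) (eb : Encoding β Δ) (R : α → β → Prop) : Prop :=
  ∃ (m : Polynomial ℕ) (f : α × List Bool → Option β),
    Nonempty (TM2ComputableInPolyTime
      (encodingProd ea (encodingList Bool)).encode (encodingOption eb).encode f) ∧
    (∀ (a : α) (r : List Bool) (b : β), f (a, r) = some b → R a b) ∧
    ∀ a : α, (∃ b : β, R a b) →
      (2 / 3 : ℝ) ≤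
        (Nat.card {r : Fin (m.eval (ea.encode a).length) → Bool //
            (f (a, List.ofFn r)).isSome} : ℝ) / 2 ^ m.eval (ea.encode a).length

/-! ### Tuples of invertible two-by-two matrices as inputs -/

/-- A prime `p` together with a tuple of matrices in `GL₂(ℤ/p)`. -/
structure MatrixTuple : Type where
  /-- the modulus -/
  p : ℕ
  /-- the modulus is prime -/
  prime : p.Prime
  /-- the matrices -/
  mats : List (Matrix.GeneralLinearGroup (Fin 2) (ZMod p))

/-- A list of natural numbers as a word over `{0, 1, #}`: every number is written in binary (least
significant bit first) and followed by the separator `# = none`. -/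
def encodeNatList (l : List ℕ) : List (Option Bool) :=
  l.flatMap fun n => (encodeNat n).map some ++ [none]

/-- The entries of a matrix, row by row, as natural numbers below `p`. -/
def matrixEntries {p : ℕ} (M : Matrix.GeneralLinearGroup (Fin 2) (ZMod p)) : List ℕ :=
  [(M.val 0 0).val, (M.val 0 1).val, (M.val 1 0).val, (M.val 1 1).val]

/-- The modulus followed by all the entries of the matrices, everything in binary. -/
def encodeMatrixTuple (I : MatrixTuple) : List (Option Bool) :=
  encodeNatList (I.p :: I.mats.flatMap matrixEntries)

theorem map_some_append_none_inj {a b : List Bool} {x y : List (Option Bool)}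
    (h : a.map some ++ none :: x = b.map some ++ none :: y) : a = b ∧ x = y := by
  induction a generalizing b with
  | nil => cases b <;> simp_all
  | cons u a ih =>
    cases b with
    | nil => simp at h
    | cons v b =>
      simp only [List.map_cons, List.cons_append, List.cons.injEq, Option.some.injEq] at h
      obtain ⟨h1, h2⟩ := ih h.2
      exact ⟨by rw [h.1, h1], h2⟩

theorem encodeNatList_injective : Function.Injective encodeNatList := by
  intro l
  induction l with
  | nil => intro l' h; cases l' <;> simp_all [encodeNatList]
  | cons n l ih =>
    intro l' h
    cases l' with
    | nil => simp [encodeNatList] at h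
    | cons n' l' =>
      simp only [encodeNatList, List.flatMap_cons, List.append_assoc, List.cons_append,
        List.nil_append] at h
      obtain ⟨h1, h2⟩ := map_some_append_none_inj h
      rw [encodingNatBool.encode_injective h1, ih h2]

theorem flatMap_matrixEntries_injective {p : ℕ} (hp : p.Prime) :
    Function.Injective
      (fun l : List (Matrix.GeneralLinearGroup (Fin 2) (ZMod p)) => l.flatMap matrixEntries) := by
  have : NeZero p := ⟨hp.ne_zero⟩
  intro l
  induction l with
  | nil => intro l' h; cases l' <;> simp_all [matrixEntries]
  | cons M l ih =>
    intro l' h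
    cases l' with
    | nil => simp [matrixEntries] at h
    | cons M' l' =>
      simp only [matrixEntries, List.flatMap_cons, List.cons_append, List.nil_append,
        List.cons.injEq, (ZMod.val_injective p).eq_iff] at h
      obtain ⟨h00, h01, h10, h11, h⟩ := h
      have hM : M = M' := by
        apply Units.ext
        ext i j
        fin_cases i <;> fin_cases j <;> assumption
      rw [hM, ih h]

theorem encodeMatrixTuple_injective : Function.Injective encodeMatrixTuple := by
  rintro ⟨p, hp, l⟩ ⟨p', hp', l'⟩ h
  have h := encodeNatList_injective h
  simp only [List.cons.injEq] at h
  obtain ⟨rfl, h⟩ := h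
  rw [flatMap_matrixEntries_injective hp h]

open Classical in
/-- The encoding of a prime `p` and a tuple of matrices over `ℤ/p`, all numbers in binary. -/
noncomputable def encodingMatrixTuple : Encoding MatrixTuple (Option Bool) where
  encode := encodeMatrixTuple
  decode w := if h : ∃ I, encodeMatrixTuple I = w then some h.choose else none
  decode_encode I := by
    have h : ∃ J, encodeMatrixTuple J = encodeMatrixTuple I := ⟨I, rfl⟩
    simp only [dif_pos h]
    exact congrArg some (encodeMatrixTuple_injective h.choose_spec)

/-- The spherical equation with constants `I` has a solution in `GL₂(ℤ/p)`. -/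
def MatrixTuple.Satisfiable (I : MatrixTuple) : Prop :=
  I.mats ∈ SphEq (Matrix.GeneralLinearGroup (Fin 2) (ZMod I.p))

/-- `J` consists of the modulus of `I` and of a solution, in `GL₂(ℤ/p)`, of the spherical equation
with constants `I`. -/
def MatrixTuple.IsSolvedBy (I J : MatrixTuple) : Prop :=
  ∃ z : List (Matrix.GeneralLinearGroup (Fin 2) (ZMod I.p)),
    J = ⟨I.p, I.prime, z⟩ ∧ IsSphericalSolution I.mats z

/-!
Solving a spherical equation over `GL₂(p)` comes down to a quadratic equation in one unknown, and
the algorithms are programs that set up this equation and solve it.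

**The equation.** Scalar matrices are central, so they can be moved to the right-hand side, which
becomes a scalar matrix `T`, and only the non-scalar constants are left (`solvesTo_spread`,
`solvesTo_nonscalars`). Two non-scalar two-by-two matrices are conjugate if and only if they have the
same trace and determinant, since both are conjugate to the same companion matrix (`conjOf_spec`).
This settles equations with at most two constants.

Let `A`, `B`, `X` be non-scalar with `det A * det B * det X = det T`. A conjugate `B'` of `B` extends
to a solution of `A' B' X = T` with `A'` conjugate to `A` if and only if `B' X` is non-scalar with
the trace of `A⁻¹ T`. In a basis in which `X` is a companion matrix, the matrices `B'` with the two
prescribed traces and the prescribed determinant form a conic `r² = q(c)`, where `c` is the lower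
left entry and `q` is the quadratic polynomial `conicDisc`. If `q` has nonzero discriminant then all
points of the conic give non-scalar matrices, and a character sum shows that `q` takes square values
at about half of all `c` (`card_isSquare_quadratic`). Otherwise `q` is a multiple of a square or
constant, and the solvable cases can be read off (`ConicCriterion`, `card_good_of_conicCriterion`).

With more than three constants and `p ≥ 5`, all but two of them are merged: the conjugates can be
chosen such that their product `X` has two distinct eigenvalues in the field (`splitter_spec`,
`chain_spec`). Then the leading coefficient `disc X` of `q` is a nonzero square, so that `q` takes
many square values even if it is degenerate, and the equation can be solved. Only the determinants
have to fit (`isSolvable_of_four_le`), and in particular the choice of `X` loses no solutions.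

**The algorithms.** For `p ≥ 5` the decision checks the determinants and the criterion. The search
draws `30` pairs `(c, a)`, takes a square root of `q(c)` by Cipolla's method with the parameter `a`
(`cipolla_sq`), and checks the result; a pair is good with probability at least `1 / 25`
(`exists_good_pairs`, `bitCount_drawPairs_le`). For `p ≤ 3` the group is small, and the set of all
products of conjugates is computed step by step (`reach`).

**Polynomial time.** A small language of structured programs on stacks is compiled to multi-stack
Turing machines (`StackProg.nonempty_outputsInTime`). Over binary words, the functions computed by
such programs in polynomial time are closed under composition, pairing, definition by cases and
folds over lists whose intermediate states stay short (`PolyW.foldl`, `PTime.foldl_of_invariant`).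
All steps of the algorithms are expressed by these means: arithmetic in binary, arithmetic modulo
`p`, matrices, lists. `PolyW.nonempty_computable` returns to machines with the required input and
output alphabets.
-/

/-! ### A structured language for stack machines -/

/-- Structured programs acting on stacks indexed by `K`, the stack `k` having alphabet `Γ k`. -/
inductive StackProg {K : Type} (Γ : K → Type) : Type
  /-- do nothing -/
  | skip : StackProg Γ
  /-- push a symbol -/
  | push (k : K) (a : Γ k) : StackProg Γ
  /-- run two programs one after the other -/
  | seq (c d : StackProg Γ) : StackProg Γ
  /-- pop a stack and branch on the result, which is `none` if the stack is empty -/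
  | pop (k : K) (f : Option (Γ k) → StackProg Γ) : StackProg Γ
  /-- as long as a stack is nonempty, pop it and run a program that depends on the symbol -/
  | loop (k : K) (f : Γ k → StackProg Γ) : StackProg Γ

namespace StackProg

variable {K : Type} {Γ : K → Type}

/-- `Exec c s n t`: started with the stacks `s`, the program `c` ends after `n` elementary steps
with the stacks `t`. -/
inductive Exec [DecidableEq K] :
    StackProg Γ → (∀ k, List (Γ k)) → ℕ → (∀ k, List (Γ k)) → Prop
  | skip (s) : Exec skip s 1 s
  | push (k a s) : Exec (push k a) s 1 (Function.update s k (a :: s k))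
  | seq {c d s m t n u} : Exec c s m t → Exec d t n u → Exec (seq c d) s (m + n) u
  | pop {k f s n t} : Exec (f (s k).head?) (Function.update s k (s k).tail) n t →
      Exec (pop k f) s (n + 1) t
  | loop_nil {k f s} : s k = [] → Exec (loop k f) s 1 s
  | loop_cons {k f s a l m t n u} : s k = a :: l → Exec (f a) (Function.update s k l) m t →
      Exec (loop k f) t n u → Exec (loop k f) s (m + n + 1) u

/-- The program points of a structured program: one for every command other
than `seq`. At the point `none` of a
`pop` or `loop` the stack is popped, and the other points are those of the branches. -/
def Pos : StackProg Γ → Type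
  | skip => Unit
  | push _ _ => Unit
  | seq c d => Pos c ⊕ Pos d
  | pop _ f => Option (Σ o, Pos (f o))
  | loop _ f => Option (Σ a, Pos (f a))

/-- The program point at which the execution starts. -/
def entry : (c : StackProg Γ) → Pos c
  | skip => ()
  | push _ _ => ()
  | seq c _ => Sum.inl (entry c)
  | pop _ _ => (none : Option _)
  | loop _ _ => (none : Option _)

theorem finite_pos [∀ k, Finite (Γ k)] (c : StackProg Γ) : Finite (Pos c) := by
  induction c with
  | skip => exact inferInstanceAs (Finite Unit)
  | push => exact inferInstanceAs (Finite Unit)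
  | seq c d hc hd => exact inferInstanceAs (Finite (Pos c ⊕ Pos d))
  | pop k f h => exact inferInstanceAs (Finite (Option (Σ o, Pos (f o))))
  | loop k f h => exact inferInstanceAs (Finite (Option (Σ o, Pos (f o))))

/-- The internal states of the compiled machine: the symbol popped last. -/
abbrev Reg (Γ : K → Type) : Type := Option (Σ k, Γ k)

/-- The content of the internal state, read as the result of a pop of the stack `k`. -/
def readReg [DecidableEq K] (k : K) (v : Reg Γ) : Option (Γ k) :=
  v.bind fun x => if h : x.1 = k then some (h ▸ x.2) else none

/-- The statements of the compiled machine at the points of `c`: these points are placed among the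
labels by `emb`, and the execution continues at the label `nxt` when `c` is done. -/
def code [DecidableEq K] {Λ : Type} :
    (c : StackProg Γ) → (Pos c → Λ) → Λ → Pos c → TM2.Stmt Γ Λ (Reg Γ)
  | skip, _, nxt => fun _ => .goto fun _ => nxt
  | push k a, _, nxt => fun _ => .push k (fun _ => a) (.goto fun _ => nxt)
  | seq c d, emb, nxt =>
    Sum.elim (code c (fun x => emb (Sum.inl x)) (emb (Sum.inr d.entry)))
      (code d (fun x => emb (Sum.inr x)) nxt)
  | pop k f, emb, nxt => fun x : Option (Σ o, Pos (f o)) =>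
    match x with
    | none => .pop k (fun _ o => o.map (Sigma.mk k))
        (.goto fun v => emb (some ⟨readReg k v, entry _⟩ : Option (Σ o, Pos (f o))))
    | some ⟨o, x⟩ => code (f o) (fun y => emb (some ⟨o, y⟩ : Option (Σ o, Pos (f o)))) nxt x
  | loop k f, emb, nxt => fun x : Option (Σ a, Pos (f a)) =>
    match x with
    | none => .pop k (fun _ o => o.map (Sigma.mk k))
        (.goto fun v => match readReg k v with
          | none => nxt
          | some a => emb (some ⟨a, entry _⟩ : Option (Σ o, Pos (f o))))
    | some ⟨a, x⟩ =>
      code (f a) (fun y => emb (some ⟨a, y⟩ : Option (Σ o, Pos (f o))))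
        (emb (none : Option (Σ a, Pos (f a)))) x

theorem readReg_map [DecidableEq K] (k : K) (o : Option (Γ k)) :
    readReg k (o.map (Sigma.mk k)) = o := by
  cases o <;> simp [readReg]

theorem code_pop_some [DecidableEq K] {Λ : Type} (k : K) (f : Option (Γ k) → StackProg Γ)
    (emb : Pos (pop k f) → Λ) (nxt : Λ) (o) (x : Pos (f o)) :
    code (pop k f) emb nxt (some ⟨o, x⟩ : Option (Σ o, Pos (f o))) =
      code (f o) (fun y => emb (some ⟨o, y⟩ : Option (Σ o, Pos (f o)))) nxt x := by
  rw [code]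

theorem code_loop_some [DecidableEq K] {Λ : Type} (k : K) (f : Γ k → StackProg Γ)
    (emb : Pos (loop k f) → Λ) (nxt : Λ) (o) (x : Pos (f o)) :
    code (loop k f) emb nxt (some ⟨o, x⟩ : Option (Σ o, Pos (f o))) =
      code (f o) (fun y => emb (some ⟨o, y⟩ : Option (Σ o, Pos (f o))))
        (emb (none : Option (Σ a, Pos (f a)))) x := by
  rw [code]

/-- The compiled machine simulates the execution of a program step by step. -/
theorem Exec.iterate_step [DecidableEq K] {c : StackProg Γ} {s t : ∀ k, List (Γ k)} {n : ℕ}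
    (h : Exec c s n t) {Λ : Type} (M : Λ → TM2.Stmt Γ Λ (Reg Γ)) (emb : Pos c → Λ) (nxt : Λ)
    (hM : ∀ x, M (emb x) = code c emb nxt x) (v : Reg Γ) :
    ∃ v', (flip bind (TM2.step M))^[n] (some ⟨some (emb c.entry), v, s⟩) =
      some ⟨some nxt, v', t⟩ := by
  induction h generalizing nxt v with
  | skip s =>
    refine ⟨v, ?_⟩
    simp [flip, TM2.step, hM, code]
  | push k a s =>
    refine ⟨v, ?_⟩
    simp [flip, TM2.step, hM, code]
  | seq h1 h2 ih1 ih2 =>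
    rename_i c d s m t n u
    obtain ⟨v1, e1⟩ := ih1 (fun x => emb (Sum.inl x)) (emb (Sum.inr d.entry))
      (fun x => hM (Sum.inl x)) v
    obtain ⟨v2, e2⟩ := ih2 (fun x => emb (Sum.inr x)) nxt (fun x => hM (Sum.inr x)) v1
    refine ⟨v2, ?_⟩
    rw [Nat.add_comm, Function.iterate_add_apply, ← e2, ← e1]
    rfl
  | pop h ih =>
    rename_i k f s n t
    obtain ⟨v1, e1⟩ := ih (fun y => emb (some ⟨(s k).head?, y⟩ : Option (Σ o, Pos (f o)))) nxt
      (fun x => (hM (some ⟨_, x⟩ : Option (Σ o, Pos (f o)))).trans (code_pop_some ..))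
      ((s k).head?.map (Sigma.mk k))
    refine ⟨v1, ?_⟩
    rw [Function.iterate_succ_apply, ← e1]
    congr 1
    have := hM (none : Option (Σ o, Pos (f o)))
    simp only [flip, Option.bind_eq_bind, Option.bind_some, TM2.step, entry, this, code,
      TM2.stepAux]
    rw [readReg_map]
  | loop_nil h0 =>
    rename_i k f s
    refine ⟨none, ?_⟩
    have := hM (none : Option (Σ o, Pos (f o)))
    simp only [Function.iterate_one, flip, Option.bind_eq_bind, Option.bind_some, TM2.step, entry,
      this, code, TM2.stepAux, h0, List.head?_nil, Option.map_none, List.tail_nil]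
    rw [← h0, Function.update_eq_self]
    simp [readReg]
  | loop_cons h0 h1 h2 ih1 ih2 =>
    rename_i k f s a l m t n u
    obtain ⟨v1, e1⟩ := ih1 (fun y => emb (some ⟨a, y⟩ : Option (Σ o, Pos (f o))))
      (emb (none : Option (Σ a, Pos (f a))))
      (fun x => (hM (some ⟨a, x⟩ : Option (Σ o, Pos (f o)))).trans (code_loop_some ..))
      (some ⟨k, a⟩)
    obtain ⟨v2, e2⟩ := ih2 emb nxt hM v1
    refine ⟨v2, ?_⟩
    rw [show m + n + 1 = n + (m + 1) by omega, Function.iterate_add_apply, ← e2,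
      Function.iterate_succ_apply]
    congr 1
    have := hM (none : Option (Σ o, Pos (f o)))
    refine Eq.trans ?_ e1
    congr 1
    simp only [flip, Option.bind_eq_bind, Option.bind_some, TM2.step, entry,
      this, code, TM2.stepAux, h0, List.head?_cons, List.tail_cons]
    rw [readReg_map]
    rfl

open Classical in
/-- The machine that runs `c`, with input on the stack `k₀` and output on the stack `k₁`. At the end
it resets its internal state, as a halting configuration has the initial one. -/
noncomputable def toFinTM2 [Fintype K] [∀ k, Finite (Γ k)] (c : StackProg Γ) (k₀ k₁ : K) :
    FinTM2 :=
  letI := Fintype.ofFinite (Γ k₀)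
  haveI := finite_pos c
  letI := Fintype.ofFinite (Pos c)
  letI := Fintype.ofFinite (Reg Γ)
  { k₀ := k₀, k₁ := k₁, Γ := Γ, Λ := Option (Pos c), main := some c.entry
    σ := Reg Γ, initialState := none
    m := fun l => match l with
      | none => .load (fun _ => none) .halt
      | some x => code c some none x }

/-- An execution that starts with all stacks empty except for the input, and ends with all stacks
empty except for the output, is a computation of the compiled machine; the additional step is the
halting one. -/
theorem nonempty_outputsInTime [Fintype K] [∀ k, Finite (Γ k)] [hK : DecidableEq K]
    {c : StackProg Γ} {s t : ∀ k, List (Γ k)} {n T : ℕ} (h : Exec c s n t) (hT : n + 1 ≤ T)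
    (k₀ k₁ : K) (hs : ∀ k, k ≠ k₀ → s k = []) (ht : ∀ k, k ≠ k₁ → t k = []) :
    Nonempty (TM2OutputsInTime (c.toFinTM2 k₀ k₁) (s k₀) (some (t k₁)) T) := by
  have hi : initList (c.toFinTM2 k₀ k₁) (s k₀) = ⟨some (some c.entry), none, s⟩ := by
    refine congrArg (TM2.Cfg.mk _ _) (funext fun (k : K) => ?_)
    by_cases hk : k = k₀
    · subst hk
      exact dif_pos rfl
    · exact (dif_neg hk).trans (hs k hk).symm
  have ho : haltList (c.toFinTM2 k₀ k₁) (t k₁) = ⟨none, none, t⟩ := by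
    refine congrArg (TM2.Cfg.mk _ _) (funext fun (k : K) => ?_)
    by_cases hk : k = k₁
    · subst hk
      exact dif_pos rfl
    · exact (dif_neg hk).trans (ht k hk).symm
  -- the machine is defined with the classical decidability instance
  have hd : hK = fun a b => Classical.propDecidable (a = b) := Subsingleton.elim _ _
  subst hd
  obtain ⟨v, e⟩ := @Exec.iterate_step K Γ (fun a b => Classical.propDecidable (a = b)) c s t n h
    _ (c.toFinTM2 k₀ k₁).m some none (fun x => rfl) none
  have key : (flip bind (TM2.step (c.toFinTM2 k₀ k₁).m))^[n + 1]
      (some ⟨some (some c.entry), none, s⟩) = some ⟨none, none, t⟩ := by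
    rw [Function.iterate_succ_apply']
    exact (congrArg _ e).trans rfl
  exact ⟨⟨⟨n + 1,
    (congrArg (fun x => (flip bind (c.toFinTM2 k₀ k₁).step)^[n + 1] (some x)) hi).trans
      (key.trans (congrArg some ho.symm))⟩, hT⟩⟩

/-! ### Renaming the stacks of a program -/

/-- The program touches only stacks in the set `P`. -/
def Uses (P : K → Prop) : StackProg Γ → Prop
  | skip => True
  | push k _ => P k
  | seq c d => Uses P c ∧ Uses P d
  | pop k f => P k ∧ ∀ o, Uses P (f o)
  | loop k f => P k ∧ ∀ a, Uses P (f a)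

theorem Uses.mono {P Q : K → Prop} (hPQ : ∀ k, P k → Q k) {c : StackProg Γ} (h : Uses P c) :
    Uses Q c := by
  induction c with
  | skip => trivial
  | push => exact hPQ _ h
  | seq c d hc hd => exact ⟨hc h.1, hd h.2⟩
  | pop k f ih => exact ⟨hPQ _ h.1, fun o => ih o (h.2 o)⟩
  | loop k f ih => exact ⟨hPQ _ h.1, fun o => ih o (h.2 o)⟩

theorem uses_true (c : StackProg Γ) : Uses (fun _ => True) c := by
  induction c with
  | skip => trivial
  | push => trivial
  | seq c d hc hd => exact ⟨hc, hd⟩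
  | pop k f ih => exact ⟨trivial, ih⟩
  | loop k f ih => exact ⟨trivial, ih⟩

/-- A program over stacks numbered by `ℕ` uses only finitely many of them. -/
theorem exists_uses_lt {Γ : ℕ → Type} [∀ k, Finite (Γ k)] (c : StackProg Γ) :
    ∃ N, Uses (· < N) c := by
  induction c with
  | skip => exact ⟨0, trivial⟩
  | push k a => exact ⟨k + 1, Nat.lt_succ_self k⟩
  | seq c d hc hd =>
    obtain ⟨M, hM⟩ := hc
    obtain ⟨N, hN⟩ := hd
    exact ⟨max M N, hM.mono fun k hk => lt_max_of_lt_left hk,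
      hN.mono fun k hk => lt_max_of_lt_right hk⟩
  | pop k f ih | loop k f ih =>
    choose N hN using ih
    obtain ⟨M, hM⟩ := (Set.finite_range N).bddAbove
    refine ⟨max (k + 1) (M + 1), lt_max_of_lt_left (Nat.lt_succ_self k), fun o =>
      (hN o).mono fun i hi => lt_max_of_lt_right ?_⟩
    exact hi.trans_le ((hM ⟨o, rfl⟩).trans (Nat.le_succ M))

variable {K' : Type} {Γ' : K' → Type}

/-- Rename the stacks of a program. -/
def map (e : K → K') : StackProg (fun k => Γ' (e k)) → StackProg Γ'
  | skip => skip
  | push k a => push (e k) a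
  | seq c d => seq (map e c) (map e d)
  | pop k f => pop (e k) fun o => map e (f o)
  | loop k f => loop (e k) fun o => map e (f o)

/-- A renamed program acts on the renamed stacks as the original one does, and leaves the others
alone. -/
theorem Exec.map [DecidableEq K] [DecidableEq K'] {e : K → K'} {P : K → Prop}
    {c : StackProg (fun k => Γ' (e k))} {s t : ∀ k, List (Γ' (e k))} {n : ℕ} (h : Exec c s n t)
    (hP : Uses P c) (he : ∀ i j, P i → P j → e i = e j → i = j) (S : ∀ k, List (Γ' k))
    (hS : ∀ k, P k → S (e k) = s k) :
    ∃ T, Exec (c.map e) S n T ∧ (∀ k, P k → T (e k) = t k) ∧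
      ∀ k', (∀ k, P k → e k ≠ k') → T k' = S k' := by
  have upd : ∀ (S : ∀ k, List (Γ' k)) (s : ∀ k, List (Γ' (e k))), (∀ k, P k → S (e k) = s k) →
      ∀ (k) (_ : P k) (w : List (Γ' (e k))) (i), P i →
        Function.update S (e k) w (e i) = Function.update s k w i := by
    intro S s hS k hk w i hi
    by_cases h : i = k
    · subst h; simp
    · rw [Function.update_of_ne h, Function.update_of_ne, hS i hi]
      exact fun h' => h (he _ _ hi hk h')
  have out : ∀ (S : ∀ k, List (Γ' k)) (k) (_ : P k) (w : List (Γ' (e k))) (k'),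
      (∀ k, P k → e k ≠ k') → Function.update S (e k) w k' = S k' := by
    intro S k hk w k' h
    rw [Function.update_of_ne]
    exact (h k hk).symm
  induction h generalizing S with
  | skip s => exact ⟨S, .skip S, hS, fun _ _ => rfl⟩
  | push k a s =>
    refine ⟨_, .push _ _ _, ?_, out S k hP _⟩
    rw [hS k hP]
    exact upd S s hS k hP _
  | seq h1 h2 ih1 ih2 =>
    obtain ⟨T, hT, hTt, hTo⟩ := ih1 hP.1 S hS
    obtain ⟨U, hU, hUt, hUo⟩ := ih2 hP.2 T hTt
    exact ⟨U, .seq hT hU, hUt, fun k' hk' => (hUo k' hk').trans (hTo k' hk')⟩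
  | pop h ih =>
    rename_i k f s n t
    obtain ⟨T, hT, hTt, hTo⟩ := ih (hP.2 _) (Function.update S (e k) (s k).tail)
      (upd S s hS k hP.1 _)
    refine ⟨T, .pop ?_, hTt, fun k' hk' => (hTo k' hk').trans (out S k hP.1 _ k' hk')⟩
    rw [hS k hP.1]
    exact hT
  | loop_nil h0 => exact ⟨S, .loop_nil ((hS _ hP.1).trans h0), hS, fun _ _ => rfl⟩
  | loop_cons h0 h1 h2 ih1 ih2 =>
    rename_i k f s a l m t n u
    obtain ⟨T, hT, hTt, hTo⟩ := ih1 (hP.2 _) (Function.update S (e k) l)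
      (upd S s hS k hP.1 _)
    obtain ⟨U, hU, hUt, hUo⟩ := ih2 hP T hTt
    exact ⟨U, .loop_cons ((hS _ hP.1).trans h0) hT hU, hUt, fun k' hk' =>
      (hUo k' hk').trans ((hTo k' hk').trans (out S k hP.1 _ k' hk'))⟩

theorem Exec.length_le [DecidableEq K] {c : StackProg Γ} {s t : ∀ k, List (Γ k)} {n : ℕ}
    (h : Exec c s n t) (k : K) : (t k).length ≤ (s k).length + n := by
  have upd : ∀ (s : ∀ k, List (Γ k)) (i) (w : List (Γ i)) (m : ℕ), w.length ≤ (s i).length + m →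
      (Function.update s i w k).length ≤ (s k).length + m := by
    intro s i w m hw
    by_cases h : k = i
    · subst h; simpa using hw
    · rw [Function.update_of_ne h]; omega
  induction h with
  | skip s => omega
  | push i a s => exact upd s i _ 1 (by simp)
  | seq h1 h2 ih1 ih2 => omega
  | pop h ih =>
    rename_i i f s n t
    have := upd s i (s i).tail 0 (by simp)
    omega
  | loop_nil => omega
  | loop_cons h0 h1 h2 ih1 ih2 =>
    rename_i i f s a l m t n u
    have := upd s i l 0 (by simp [h0])
    omega

end StackProg

/-! ### Word functions computable in polynomial time -/

/-- Binary words. -/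
abbrev Word : Type := List Bool

/-- Structured programs acting on binary words. -/
abbrev WordProg : Type := StackProg (fun _ : ℕ => Bool)

/-- The stacks with contents `l₀, l₁, …`, all further ones being empty. -/
def stks (l : List Word) : ℕ → Word := fun i => l.getD i []

theorem update_stks {l : List Word} {i : ℕ} (h : i < l.length) (w : Word) :
    Function.update (stks l) i w = stks (l.set i w) := by
  funext j
  by_cases hj : j = i
  · subst hj; simp [stks, h]
  · rw [Function.update_of_ne hj]
    simp [stks, Ne.symm hj]

theorem stks_concat_nil (l : List Word) : stks (l ++ [[]]) = stks l := by
  funext i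
  simp only [stks, List.getD_eq_getElem?_getD, List.getElem?_append]
  split_ifs with h
  · rfl
  · rw [List.getElem?_eq_none (by omega : l.length ≤ i)]
    cases i - l.length <;> simp

theorem stks_pad1 (a : Word) : stks [a] = stks [a, []] := (stks_concat_nil [a]).symm
theorem stks_pad2 (a b : Word) : stks [a, b] = stks [a, b, []] :=
  (stks_concat_nil [a, b]).symm
theorem stks_pad3 (a b c : Word) : stks [a, b, c] = stks [a, b, c, []] :=
  (stks_concat_nil [a, b, c]).symm

namespace StackProg

/-- `Runs c s n t`: started with the stacks `s`, the program `c` ends after at most `n` steps with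
the stacks `t`. -/
def Runs (c : WordProg) (s : ℕ → Word) (n : ℕ) (t : ℕ → Word) : Prop := ∃ m ≤ n, Exec c s m t

variable {c d : WordProg} {s t u : ℕ → Word} {m n : ℕ}

theorem Runs.mono (h : Runs c s m t) (hmn : m ≤ n) : Runs c s n t :=
  let ⟨k, hk, h⟩ := h; ⟨k, hk.trans hmn, h⟩

theorem Runs.seq (h : Runs c s m t) (h' : Runs d t n u) : Runs (.seq c d) s (m + n) u :=
  let ⟨_, hk, h⟩ := h; let ⟨_, hk', h'⟩ := h'; ⟨_, Nat.add_le_add hk hk', .seq h h'⟩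

theorem Runs.skip (s) : Runs .skip s 1 s := ⟨1, le_rfl, .skip s⟩

theorem Runs.push {l : List Word} {i : ℕ} (h : i < l.length) (a : Bool) :
    Runs (.push i a) (stks l) 1 (stks (l.set i (a :: l[i]))) := by
  refine ⟨1, le_rfl, ?_⟩
  rw [← update_stks h]
  have : l[i] = stks l i := by simp [stks, h]
  rw [this]
  exact .push (Γ := fun _ : ℕ => Bool) i a _

theorem Runs.pop_cons {l : List Word} {i : ℕ} (h : i < l.length) {f : Option Bool → WordProg}
    {a : Bool} {w : Word} (hw : l[i] = a :: w) (hr : Runs (f (some a)) (stks (l.set i w)) n t) :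
    Runs (.pop i f) (stks l) (n + 1) t := by
  obtain ⟨m, hm, hr⟩ := hr
  have : stks l i = a :: w := by simp [stks, h, hw]
  refine ⟨m + 1, by omega, .pop ?_⟩
  rw [this, update_stks h]
  exact hr

theorem Runs.pop_nil {l : List Word} {i : ℕ} (h : i < l.length) {f : Option Bool → WordProg}
    (hw : l[i] = []) (hr : Runs (f none) (stks l) n t) :
    Runs (.pop i f) (stks l) (n + 1) t := by
  obtain ⟨m, hm, hr⟩ := hr
  have : stks l i = [] := by simp [stks, h, hw]
  refine ⟨m + 1, by omega, .pop ?_⟩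
  rw [this, List.tail_nil, ← this, Function.update_eq_self, this]
  exact hr

theorem Runs.loop_nil {l : List Word} {i : ℕ} (h : i < l.length) {f : Bool → WordProg}
    (hw : l[i] = []) : Runs (.loop i f) (stks l) 1 (stks l) :=
  ⟨1, le_rfl, .loop_nil (by simp [stks, h, hw])⟩

theorem Runs.loop_cons {l : List Word} {i : ℕ} (h : i < l.length) {f : Bool → WordProg}
    {a : Bool} {w : Word} (hw : l[i] = a :: w) (hr : Runs (f a) (stks (l.set i w)) m t)
    (hl : Runs (.loop i f) t n u) : Runs (.loop i f) (stks l) (m + n + 1) u := by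
  obtain ⟨m', hm, hr⟩ := hr
  obtain ⟨n', hn, hl⟩ := hl
  refine ⟨m' + n' + 1, by omega, .loop_cons (a := a) (l := w) (by simp [stks, h, hw]) ?_ hl⟩
  rw [update_stks h]
  exact hr

/-- Shift the stacks of a program by one. -/
def shift (c : WordProg) : WordProg :=
  StackProg.map (K' := ℕ) (Γ' := fun _ => Bool) (fun i : ℕ => i + 1) c

theorem Runs.shift {l l' : List Word} (h : Runs c (stks l) n (stks l')) (a : Word) :
    Runs c.shift (stks (a :: l)) n (stks (a :: l')) := by
  obtain ⟨m, hm, h⟩ := h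
  obtain ⟨T, hT, h1, h2⟩ := Exec.map (K' := ℕ) (Γ' := fun _ => Bool) (e := fun i : ℕ => i + 1) h
    (uses_true c) (fun i j _ _ hij => by simpa using hij) (stks (a :: l)) (fun k _ => rfl)
  refine ⟨m, hm, ?_⟩
  have hT' : T = stks (a :: l') := by
    funext i
    cases i with
    | zero => exact h2 0 fun k _ => Nat.succ_ne_zero k
    | succ i => exact h1 i trivial
  rw [← hT']
  exact hT

/-- Pour the stack `i` onto the stack `j`. -/
def pour (i j : ℕ) : WordProg := .loop i fun b => .push j b

theorem Runs.pour {i j : ℕ} (hij : i ≠ j) {l : List Word} (hi : i < l.length) (hj : j < l.length) :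
    Runs (pour i j) (stks l) (2 * l[i].length + 1)
      (stks ((l.set i []).set j (l[i].reverse ++ l[j]))) := by
  generalize hw : l[i] = w
  induction w generalizing l with
  | nil =>
    have h1 : l.set i [] = l := by rw [← hw]; simp
    have h2 : (l.set i []).set j ([].reverse ++ l[j]) = l := by rw [h1]; simp
    rw [h2]
    exact (Runs.loop_nil hi hw).mono (by simp)
  | cons b w ih =>
    have := ih (l := (l.set i w).set j (b :: l[j])) (by simpa) (by simpa)
      (by simp [hij.symm])
    have hp := Runs.push (l := l.set i w) (i := j) (by simpa) b
    have e : (l.set i w)[j]'(by simpa) = l[j] := by simp [hij]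
    rw [e] at hp
    have e2 : (((l.set i w).set j (b :: l[j])).set i []).set j
        (w.reverse ++ ((l.set i w).set j (b :: l[j]))[j]'(by simpa)) =
        (l.set i []).set j ((b :: w).reverse ++ l[j]) := by
      rw [List.set_comm _ _ hij.symm]
      simp
    rw [e2] at this
    exact (Runs.loop_cons hi hw hp this).mono (by simp; omega)

/-- Empty the stack `i`. -/
def clear (i : ℕ) : WordProg := .loop i fun _ => .skip

theorem Runs.clear {i : ℕ} {l : List Word} (hi : i < l.length) :
    Runs (clear i) (stks l) (2 * l[i].length + 1) (stks (l.set i [])) := by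
  generalize hw : l[i] = w
  induction w generalizing l with
  | nil =>
    have h1 : l.set i [] = l := by rw [← hw]; simp
    rw [h1]
    exact (Runs.loop_nil hi hw).mono (by simp)
  | cons b w ih =>
    have := ih (l := l.set i w) (by simpa) (by simp)
    rw [StackProg.clear]
    have h := (Runs.loop_cons hi hw (f := fun _ => .skip) (Runs.skip _) this).mono
      (by simp; omega : _ ≤ 2 * (b :: w).length + 1)
    simpa using h

end StackProg

open StackProg

/-- A pair of words as one word: every letter of the first one is preceded by `true`, and `false`
marks its end. Only the first word gets longer, so nesting pairs to the right is cheap. -/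
def pairW : Word → Word → Word
  | [], y => false :: y
  | b :: x, y => true :: b :: pairW x y

theorem length_pairW (x y : Word) : (pairW x y).length = 2 * x.length + 1 + y.length := by
  induction x with
  | nil => simp [pairW]; omega
  | cons b x ih => simp [pairW, ih]; omega

/-- A list of words as one word. -/
def listW : List Word → Word
  | [] => []
  | w :: l => pairW w (listW l)

namespace StackProg

/-- Join the words on the stacks `0` and `1` to a pair. -/
def mkPair : WordProg :=
  .seq (.push 1 false) (.seq (pour 0 2) (.seq
    (.loop 2 fun b => .seq (.push 1 b) (.push 1 true)) (.seq (pour 1 2) (pour 2 0))))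

theorem Runs.mkPair (x y : Word) :
    Runs mkPair (stks [x, y]) (20 * (x.length + y.length) + 20) (stks [pairW x y]) := by
  have hloop : ∀ x y : Word, Runs (.loop 2 fun b => .seq (.push 1 b) (.push 1 true))
      (stks [[], y, x]) (3 * x.length + 1)
      (stks [[], x.foldl (fun y b => true :: b :: y) y, []]) := by
    intro x
    induction x with
    | nil => exact fun y => .loop_nil (by simp) (by simp)
    | cons b x ih =>
      intro y
      refine (Runs.loop_cons (by simp) rfl ((Runs.push (by simp) b).seq
        (Runs.push (by simp) true)) (by simpa using ih (true :: b :: y))).mono ?_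
      simp; omega
  have hrev : ∀ x y : Word,
      x.reverse.foldl (fun y b => true :: b :: y) (false :: y) = pairW x y := by
    intro x y
    rw [List.foldl_reverse]
    induction x with
    | nil => rfl
    | cons b x ih => simp [pairW, ih]
  have h1 := Runs.push (l := [x, y, []]) (i := 1) (by simp) false
  have h2 := Runs.pour (l := [x, false :: y, []]) (i := 0) (j := 2) (by simp) (by simp) (by simp)
  have h3 := hloop x.reverse (false :: y)
  rw [hrev] at h3
  have h4 := Runs.pour (l := [[], pairW x y, []]) (i := 1) (j := 2) (by simp) (by simp) (by simp)
  have h5 := Runs.pour (l := [[], [], (pairW x y).reverse]) (i := 2) (j := 0) (by simp) (by simp)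
    (by simp)
  simp at h1 h2 h3 h4 h5
  have := h1.seq (h2.seq (h3.seq (h4.seq h5)))
  rw [← stks_pad2, ← stks_pad2, ← stks_pad1] at this
  refine this.mono ?_
  simp [length_pairW]
  omega

/-- Split the pair on the stack `0`: the second word stays there, the first one goes to the
stack `1`. The loop runs as long as the flag on the stack `1` is renewed. -/
def unpair : WordProg :=
  .seq (.push 1 true) (.seq
    (.loop 1 fun _ => .pop 0 fun o => match o with
      | some true => .pop 0 fun o => match o with
        | some b => .seq (.push 2 b) (.push 1 true)
        | none => .skip
      | _ => .skip)
    (pour 2 1))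

theorem Runs.unpair (x y : Word) :
    Runs unpair (stks [pairW x y]) (20 * x.length + 20) (stks [y, x]) := by
  have hloop : ∀ x z : Word, Runs
      (.loop 1 fun _ => .pop 0 fun o => match o with
        | some true => .pop 0 fun o => match o with
          | some b => .seq (.push 2 b) (.push 1 true)
          | none => .skip
        | _ => .skip)
      (stks [pairW x y, [true], z]) (5 * x.length + 10) (stks [y, [], x.reverse ++ z]) := by
    intro x
    induction x with
    | nil =>
      intro z
      refine (Runs.loop_cons (t := stks [y, [], z]) (m := 2) (n := 1) (by simp) rfl ?_ ?_).mono ?_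
      · exact Runs.pop_cons (by simp) rfl (Runs.skip _)
      · exact .loop_nil (by simp) (by simp)
      · simp
    | cons b x ih =>
      intro z
      have h : Runs _ _ (5 * (b :: x).length + 10) _ :=
        (Runs.loop_cons (l := [pairW (b :: x) y, [true], z]) (i := 1)
          (t := stks [pairW x y, [true], b :: z]) (m := 4) (by simp)
          rfl (f := fun _ => .pop 0 fun o => match o with
            | some true => .pop 0 fun o => match o with
              | some b => .seq (.push 2 b) (.push 1 true)
              | none => .skip
            | _ => .skip) ?_ (ih (b :: z))).mono (by simp; omega)
      · simpa using h
      · refine Runs.pop_cons (by simp) rfl ?_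
        refine Runs.pop_cons (by simp) rfl ?_
        have h := (Runs.push (l := [pairW x y, [], z]) (i := 2) (by simp) b).seq
          (Runs.push (l := [pairW x y, [], b :: z]) (i := 1) (by simp) true)
        exact h
  have h1 := Runs.push (l := [pairW x y, [], []]) (i := 1) (by simp) true
  have h2 := hloop x []
  have h3 := Runs.pour (l := [y, [], x.reverse]) (i := 2) (j := 1) (by simp) (by simp) (by simp)
  simp at h1 h2 h3
  have := h1.seq (h2.seq h3)
  rw [← stks_pad2, ← stks_pad2, ← stks_pad1] at this
  refine this.mono ?_
  omega

/-- Move the word on the stack `1` to the empty stack `0`. -/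
def moveDown : WordProg := .seq (pour 1 2) (pour 2 0)

theorem Runs.moveDown (x : Word) :
    Runs moveDown (stks [[], x]) (4 * x.length + 2) (stks [x]) := by
  have h1 := Runs.pour (l := [[], x, []]) (i := 1) (j := 2) (by simp) (by simp) (by simp)
  have h2 := Runs.pour (l := [[], [], x.reverse]) (i := 2) (j := 0) (by simp) (by simp) (by simp)
  simp at h1 h2
  have := h1.seq h2
  rw [← stks_pad2, ← stks_pad2, ← stks_pad1] at this
  exact this.mono (by omega)

/-- Copy the word on the stack `0` to the stack `1`. -/
def dup : WordProg :=
  .seq (.loop 0 fun b => .seq (.push 1 b) (.push 2 b)) (.seq (pour 1 0) (pour 2 1))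

theorem Runs.dup (x : Word) : Runs dup (stks [x]) (10 * x.length + 10) (stks [x, x]) := by
  have hloop : ∀ x y z : Word, Runs (.loop 0 fun b => .seq (.push 1 b) (.push 2 b))
      (stks [x, y, z]) (3 * x.length + 1) (stks [[], x.reverse ++ y, x.reverse ++ z]) := by
    intro x
    induction x with
    | nil => exact fun y z => .loop_nil (by simp) (by simp)
    | cons b x ih =>
      intro y z
      have hp := (Runs.push (l := [x, y, z]) (i := 1) (by simp) b).seq
        (Runs.push (i := 2) (by simp) b)
      refine (Runs.loop_cons (l := [b :: x, y, z]) (i := 0) (by simp) rfl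
        (f := fun b => .seq (.push 1 b) (.push 2 b)) hp
        (by simpa using ih (b :: y) (b :: z))).mono
        (by simp; omega : _ ≤ 3 * (b :: x).length + 1) |> fun h => ?_
      simpa using h
  have h1 := hloop x [] []
  have h2 := Runs.pour (l := [[], x.reverse, x.reverse]) (i := 1) (j := 0) (by simp) (by simp)
    (by simp)
  have h3 := Runs.pour (l := [x, [], x.reverse]) (i := 2) (j := 1) (by simp) (by simp) (by simp)
  simp at h1 h2 h3
  have := h1.seq (h2.seq h3)
  rw [← stks_pad2, ← stks_pad2, ← stks_pad1] at this
  exact this.mono (by omega)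

/-- Exchange the words on the stacks `0` and `1`. -/
def swap : WordProg := .seq (pour 0 2) (.seq (pour 1 3) (.seq (pour 3 0) (pour 2 1)))

theorem Runs.swap (x y : Word) :
    Runs swap (stks [x, y]) (4 * (x.length + y.length) + 4) (stks [y, x]) := by
  have h1 := Runs.pour (l := [x, y, [], []]) (i := 0) (j := 2) (by simp) (by simp) (by simp)
  have h2 := Runs.pour (l := [[], y, x.reverse, []]) (i := 1) (j := 3) (by simp) (by simp) (by simp)
  have h3 := Runs.pour (l := [[], [], x.reverse, y.reverse]) (i := 3) (j := 0) (by simp) (by simp)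
    (by simp)
  have h4 := Runs.pour (l := [y, [], x.reverse, []]) (i := 2) (j := 1) (by simp) (by simp)
    (by simp)
  simp at h1 h2 h3 h4
  have := h1.seq (h2.seq (h3.seq h4))
  rw [← stks_pad3, ← stks_pad3, ← stks_pad2, ← stks_pad2] at this
  exact this.mono (by omega)

/-- Fold a program over a list: the stack `0` holds a pair of the initial state and a list, the
program `c` turns a pair of a state and an element into the next state. -/
def fold (c : WordProg) : WordProg :=
  .seq unpair (.seq
    (.loop 0 fun b => match b with
      | true => .pop 0 fun o => match o with
        | some b => .push 3 b
        | none => .skip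
      | false => .seq (pour 3 2) (.seq mkPair.shift c.shift))
    moveDown)

/-- The running time of `fold`, if `c` needs time `q`, all states have length at most `M` and all
elements of the list have length at most `N`. -/
theorem Runs.fold {σ β : Type} (c : WordProg) (es : σ → Word) (eb : β → Word) (step : σ → β → σ)
    (q : ℕ → ℕ) (hq : Monotone q)
    (hc : ∀ s b, Runs c (stks [pairW (es s) (eb b)]) (q (pairW (es s) (eb b)).length)
      (stks [es (step s b)])) (i : σ) (l : List β) (M N : ℕ)
    (hM : ∀ l', l' <+: l → (es (l'.foldl step i)).length ≤ M)
    (hN : ∀ b ∈ l, (eb b).length ≤ N) :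
    Runs (fold c) (stks [pairW (es i) (listW (l.map eb))])
      (l.length * (q (2 * M + 1 + N) + 20 * M + 50 * N + 30) + 30 * M + 30)
      (stks [es (l.foldl step i)]) := by
  set F : Bool → WordProg := fun b => match b with
      | true => .pop 0 fun o => match o with
        | some b => .push 3 b
        | none => .skip
      | false => .seq (StackProg.pour 3 2) (.seq StackProg.mkPair.shift c.shift) with hF
  -- the letters of the next element `w` go to the stack `3`, then its end marker starts the step
  have read : ∀ (w r rest s s' : Word) (m n : ℕ) (t : ℕ → Word),
      Runs (F false) (stks [rest, s, [], w.reverse ++ r]) m (stks [rest, s']) →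
      Runs (.loop 0 F) (stks [rest, s']) n t →
      Runs (.loop 0 F) (stks [pairW w rest, s, [], r]) (3 * w.length + m + n + 1) t := by
    intro w
    induction w with
    | nil =>
      intro r rest s s' m n t h h'
      exact (Runs.loop_cons (by simp) rfl (by simpa using h) h').mono (by simp)
    | cons b w ih =>
      intro r rest s s' m n t h h'
      have := ih (b :: r) rest s s' m n t (by simpa using h) h'
      refine (Runs.loop_cons (m := 2) (by simp) rfl ?_ this).mono ?_
      · refine Runs.pop_cons (by simp) rfl ?_
        simpa using Runs.push (l := [pairW w rest, s, [], r]) (i := 3) (by simp) b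
      · simp; omega
  have main : ∀ (l : List β) (i : σ), (∀ l', l' <+: l → (es (l'.foldl step i)).length ≤ M) →
      (∀ b ∈ l, (eb b).length ≤ N) →
      Runs (.loop 0 F) (stks [listW (l.map eb), es i])
        (l.length * (q (2 * M + 1 + N) + 20 * M + 50 * N + 30) + 1)
        (stks [[], es (l.foldl step i)]) := by
    intro l
    induction l with
    | nil =>
      intro i _ _
      exact (Runs.loop_nil (by simp) (by simp [listW])).mono (by simp)
    | cons b l ih =>
      intro i hM hN
      have ih' := ih (step i b)
        (fun l' hl' => by simpa using hM (b :: l') (by simpa using hl'))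
        (fun b' hb' => hN b' (List.mem_cons_of_mem _ hb'))
      have h0 : (es i).length ≤ M := by simpa using hM [] (by simp)
      have h1 : (eb b).length ≤ N := hN b (by simp)
      have hbody : Runs (F false)
          (stks [listW (l.map eb), es i, [], (eb b).reverse ++ []])
          ((2 * (eb b).length + 1) + ((20 * ((es i).length + (eb b).length) + 20) +
            q (pairW (es i) (eb b)).length))
          (stks [listW (l.map eb), es (step i b)]) := by
        have e1 := Runs.pour (l := [listW (l.map eb), es i, [], (eb b).reverse]) (i := 3) (j := 2)
          (by simp) (by simp) (by simp)
        have e2 := (Runs.mkPair (es i) (eb b)).shift (listW (l.map eb))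
        have e3 := (hc i b).shift (listW (l.map eb))
        simp at e1
        rw [← stks_pad3] at e1
        simpa using e1.seq (e2.seq e3)
      have := read (eb b) [] (listW (l.map eb)) (es i) (es (step i b)) _ _ _ hbody ih'
      rw [← stks_pad3, ← stks_pad2] at this
      refine this.mono ?_
      have hq' : q (pairW (es i) (eb b)).length ≤ q (2 * M + 1 + N) :=
        hq (by rw [length_pairW]; omega)
      rw [List.length_cons, Nat.add_mul]
      omega
  have hM0 : (es i).length ≤ M := by simpa using hM [] (by simp)
  have hM1 := hM l (List.prefix_refl l)
  refine ((Runs.unpair _ _).seq ((main l i hM hN).seq (Runs.moveDown _))).mono ?_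
  omega

end StackProg

/-! ### Closure properties of polynomial time -/

theorem Polynomial.eval_mono_nat (q : Polynomial ℕ) : Monotone fun n => q.eval n := by
  intro m n h
  simp only [Polynomial.eval_eq_sum, Polynomial.sum]
  gcongr

/-- The words `f a` are computable from the words `e a` in polynomial time: one program turns `e a`
into `f a`, for all `a`, leaving no other stack occupied. Neither `e` nor `f` need be injective. -/
def PolyW {α : Type} (e f : α → Word) : Prop :=
  ∃ (c : WordProg) (q : Polynomial ℕ), ∀ a,
    Runs c (stks [e a]) (q.eval (e a).length) (stks [f a])

namespace PolyW

variable {α γ : Type} {e f g h : α → Word}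

theorem refl (e : α → Word) : PolyW e e :=
  ⟨.skip, 1, fun _ => by simpa using Runs.skip _⟩

theorem congr (h : PolyW e f) (hfg : ∀ a, f a = g a) : PolyW e g := funext hfg ▸ h

theorem exists_length_le (h : PolyW e f) :
    ∃ q : Polynomial ℕ, ∀ a, (f a).length ≤ q.eval (e a).length := by
  obtain ⟨c, q, h⟩ := h
  refine ⟨Polynomial.X + q, fun a => ?_⟩
  obtain ⟨m, hm, h⟩ := h a
  have := h.length_le 0
  simp only [stks, List.getD_cons_zero] at this
  simp
  omega

theorem trans (hf : PolyW e f) (hg : PolyW f g) : PolyW e g := by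
  obtain ⟨p, hp⟩ := hf.exists_length_le
  obtain ⟨c, q, hc⟩ := hf
  obtain ⟨d, r, hd⟩ := hg
  refine ⟨.seq c d, q + r.comp p, fun a => ?_⟩
  refine ((hc a).seq (hd a)).mono ?_
  have := r.eval_mono_nat (hp a)
  simp only [Polynomial.eval_add, Polynomial.eval_comp]
  simp only at this
  omega

theorem reindex (h : PolyW e f) (i : γ → α) : PolyW (fun c => e (i c)) (fun c => f (i c)) :=
  let ⟨c, q, h⟩ := h; ⟨c, q, fun a => h (i a)⟩

theorem const (e : α → Word) (w : Word) : PolyW e (fun _ => w) := by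
  have : ∀ w, ∃ c, Runs c (stks [[]]) (w.length + 1) (stks [w]) := by
    intro w
    induction w with
    | nil => exact ⟨.skip, Runs.skip _⟩
    | cons b w ih =>
      obtain ⟨c, hc⟩ := ih
      have hp := Runs.push (l := [w]) (i := 0) (by simp) b
      exact ⟨.seq c (.push 0 b), (hc.seq hp).mono (by simp)⟩
  obtain ⟨c, hc⟩ := this w
  refine ⟨.seq (clear 0) c, 2 * Polynomial.X + 1 + Polynomial.C (w.length + 1), fun a => ?_⟩
  have h1 := Runs.clear (l := [e a]) (i := 0) (by simp)
  refine (h1.seq hc).mono ?_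
  simp

/-- The input is copied, and one copy is kept below while the first program runs. -/
theorem pair (hf : PolyW e f) (hg : PolyW e g) : PolyW e (fun a => pairW (f a) (g a)) := by
  obtain ⟨p, hp⟩ := hf.exists_length_le
  obtain ⟨p', hp'⟩ := hg.exists_length_le
  obtain ⟨c, q, hc⟩ := hf
  obtain ⟨d, r, hd⟩ := hg
  refine ⟨.seq dup (.seq c.shift (.seq swap (.seq d.shift mkPair))),
    q + r + 14 * Polynomial.X + 24 * p + 20 * p' + 34, fun a => ?_⟩
  have h1 := Runs.dup (e a)
  have h2 := (hc a).shift (e a)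
  have h3 := Runs.swap (e a) (f a)
  have h4 := (hd a).shift (f a)
  have h5 := Runs.mkPair (f a) (g a)
  refine (h1.seq (h2.seq (h3.seq (h4.seq h5)))).mono ?_
  have := hp a
  have := hp' a
  simp
  omega

theorem fst (f g : α → Word) : PolyW (fun a => pairW (f a) (g a)) f := by
  refine ⟨.seq unpair (.seq (clear 0) moveDown), 100 * Polynomial.X + 100, fun a => ?_⟩
  have h1 := Runs.unpair (f a) (g a)
  have h2 := Runs.clear (l := [g a, f a]) (i := 0) (by simp)
  have h3 := Runs.moveDown (f a)
  refine (h1.seq (h2.seq h3)).mono ?_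
  simp [length_pairW]
  omega

theorem snd (f g : α → Word) : PolyW (fun a => pairW (f a) (g a)) g := by
  refine ⟨.seq unpair (clear 1), 100 * Polynomial.X + 100, fun a => ?_⟩
  have h1 := Runs.unpair (f a) (g a)
  have h2 := Runs.clear (l := [g a, f a]) (i := 1) (by simp)
  have : stks [g a] = stks [g a, []] := stks_pad1 _
  rw [this]
  refine (h1.seq h2).mono ?_
  simp [length_pairW]
  omega

theorem fst' (h : PolyW e (fun a => pairW (f a) (g a))) : PolyW e f := h.trans (fst f g)
theorem snd' (h : PolyW e (fun a => pairW (f a) (g a))) : PolyW e g := h.trans (snd f g)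

/-- Definition by cases. Each branch has to be computable only where it applies. -/
theorem cond {c : α → Bool} (hc : PolyW e (fun a => [c a]))
    (hf : PolyW (fun a : {a // c a = true} => e a) (fun a => f a))
    (hg : PolyW (fun a : {a // c a = false} => e a) (fun a => g a)) :
    PolyW e (fun a => if c a then f a else g a) := by
  refine (hc.pair (refl e)).trans ?_
  obtain ⟨d, q, hd⟩ := hf
  obtain ⟨d', r, hd'⟩ := hg
  refine ⟨.pop 0 fun _ => .pop 0 fun o => .pop 0 fun _ => match o with
    | some true => d
    | _ => d', q + r + 3, fun a => ?_⟩
  have hle : (e a).length ≤ (pairW [c a] (e a)).length := by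
    rw [length_pairW]
    omega
  have h1 := q.eval_mono_nat hle
  have h2 := r.eval_mono_nat hle
  simp only at h1 h2
  cases hca : c a with
  | true =>
    have h := hd ⟨a, hca⟩
    rw [hca] at h1 h2
    simp only [hca, if_true]
    refine (Runs.pop_cons (by simp) rfl (Runs.pop_cons (by simp) rfl
      (Runs.pop_cons (by simp) rfl h))).mono ?_
    simp only [Polynomial.eval_add, Polynomial.eval_ofNat]
    omega
  | false =>
    have h := hd' ⟨a, hca⟩
    rw [hca] at h1 h2
    simp only [hca, reduceCtorEq, if_false]
    refine (Runs.pop_cons (by simp) rfl (Runs.pop_cons (by simp) rfl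
      (Runs.pop_cons (by simp) rfl h))).mono ?_
    simp only [Polynomial.eval_add, Polynomial.eval_ofNat]
    omega

theorem ite {c : α → Bool} (hc : PolyW e (fun a => [c a])) (hf : PolyW e f) (hg : PolyW e g) :
    PolyW e (fun a => if c a then f a else g a) :=
  cond hc (hf.reindex Subtype.val) (hg.reindex Subtype.val)

/-- Programs of linear running time. -/
theorem of_runs_const (c : WordProg) (C : ℕ)
    (h : ∀ a, Runs c (stks [e a]) (C * (e a).length + C) (stks [f a])) : PolyW e f :=
  ⟨c, Polynomial.C C * Polynomial.X + Polynomial.C C, fun a => by simpa using h a⟩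

theorem isEmpty (e : α → Word) : PolyW e (fun a => [(e a).isEmpty]) := by
  refine of_runs_const (.pop 0 fun o => match o with
    | none => .push 0 true
    | some _ => .seq (clear 0) (.push 0 false)) 10 fun a => ?_
  cases he : e a with
  | nil => exact (Runs.pop_nil (by simp) rfl (Runs.push (by simp) true)).mono (by simp)
  | cons b w =>
    have h1 := Runs.clear (l := [w]) (i := 0) (by simp)
    have h2 := Runs.push (l := [[]]) (i := 0) (by simp) false
    exact (Runs.pop_cons (by simp) rfl (h1.seq h2)).mono (by simp; omega)

theorem headBit (e : α → Word) : PolyW e (fun a => [(e a).headD false]) := by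
  refine of_runs_const (.pop 0 fun o => match o with
    | none => .push 0 false
    | some b => .seq (clear 0) (.push 0 b)) 10 fun a => ?_
  cases he : e a with
  | nil => exact (Runs.pop_nil (by simp) rfl (Runs.push (by simp) false)).mono (by simp)
  | cons b w =>
    have h1 := Runs.clear (l := [w]) (i := 0) (by simp)
    have h2 := Runs.push (l := [[]]) (i := 0) (by simp) b
    exact (Runs.pop_cons (by simp) rfl (h1.seq h2)).mono (by simp; omega)

theorem tailBits (e : α → Word) : PolyW e (fun a => (e a).tail) := by
  refine of_runs_const (.pop 0 fun _ => .skip) 10 fun a => ?_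
  cases he : e a with
  | nil => exact (Runs.pop_nil (by simp) rfl (Runs.skip _)).mono (by simp)
  | cons b w => exact (Runs.pop_cons (by simp) rfl (Runs.skip _)).mono (by simp)

theorem consBit (b : Bool) (e : α → Word) : PolyW e (fun a => b :: e a) := by
  refine of_runs_const (.push 0 b) 10 fun a => ?_
  exact (Runs.push (l := [e a]) (i := 0) (by simp) b).mono (by simp)

/-- A unary counter as long as the input. -/
theorem clock (e : α → Word) : PolyW e (fun a => List.replicate (e a).length false) := by
  refine of_runs_const (.seq (.loop 0 fun _ => .push 1 false) (pour 1 0)) 10 fun a => ?_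
  have hloop : ∀ x y : Word, Runs (.loop 0 fun _ => .push 1 false)
      (stks [x, y]) (2 * x.length + 1) (stks [[], List.replicate x.length false ++ y]) := by
    intro x
    induction x with
    | nil => exact fun y => .loop_nil (by simp) (by simp)
    | cons b x ih =>
      intro y
      have hp := Runs.push (l := [x, y]) (i := 1) (by simp) false
      have h : Runs _ _ (2 * (b :: x).length + 1) _ :=
        (Runs.loop_cons (l := [b :: x, y]) (i := 0) (by simp) rfl
        (f := fun _ => .push 1 false) hp (ih (false :: y))).mono (by simp; omega)
      convert h using 4
      simp [List.replicate_succ']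
  have h1 := hloop (e a) []
  have h2 := Runs.pour (l := [[], List.replicate (e a).length false]) (i := 1) (j := 0) (by simp)
    (by simp) (by simp)
  simp at h1 h2
  have := h1.seq h2
  rw [← stks_pad1, ← stks_pad1] at this
  exact this.mono (by omega)

theorem length_le_listW {β : Type} (eb : β → Word) (l : List β) :
    l.length ≤ (listW (l.map eb)).length ∧
      ∀ b ∈ l, (eb b).length ≤ (listW (l.map eb)).length := by
  induction l with
  | nil => simp
  | cons b l ih =>
    simp only [List.length_cons, List.map_cons, listW, length_pairW, List.mem_cons, forall_eq_or_imp]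
    refine ⟨by omega, by omega, fun b hb => ?_⟩
    have := ih.2 b hb
    omega

/-- Folding over a list, without a context: the initial state and the list are the input. -/
theorem foldl_aux {β σ : α → Type} (eb : ∀ a, β a → Word) (es : ∀ a, σ a → Word)
    (step : ∀ a, σ a → β a → σ a)
    (hstep : PolyW (fun x : Σ a, σ a × β a => pairW (es x.1 x.2.1) (eb x.1 x.2.2))
      (fun x => es x.1 (step x.1 x.2.1 x.2.2)))
    (i : ∀ a, σ a) (l : ∀ a, List (β a)) (Q : Polynomial ℕ)
    (hQ : ∀ a l', l' <+: l a → (es a (l'.foldl (step a) (i a))).length ≤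
      Q.eval (pairW (es a (i a)) (listW ((l a).map (eb a)))).length) :
    PolyW (fun a => pairW (es a (i a)) (listW ((l a).map (eb a))))
      (fun a => es a ((l a).foldl (step a) (i a))) := by
  obtain ⟨c, q, hc⟩ := hstep
  refine ⟨fold c, Polynomial.X * (q.comp (2 * Q + 1 + Polynomial.X) + 20 * Q + 50 * Polynomial.X
    + 30) + 30 * Q + 30, fun a => ?_⟩
  set n := (pairW (es a (i a)) (listW ((l a).map (eb a)))).length with hn
  have hn' : (listW ((l a).map (eb a))).length ≤ n := by
    rw [hn, length_pairW]
    omega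
  refine (Runs.fold c (es a) (eb a) (step a) (fun n => q.eval n) q.eval_mono_nat
    (fun s b => hc ⟨a, s, b⟩) (i a) (l a) (Q.eval n) n (hQ a)
    (fun b hb => ((length_le_listW (eb a) (l a)).2 b hb).trans hn')).mono ?_
  have h1 := (length_le_listW (eb a) (l a)).1.trans hn'
  simp
  gcongr

/-- Folding over a list. The step may depend on the context `e`, and the intermediate states have
to be of polynomial length. -/
theorem foldl {β σ : α → Type} {eb : ∀ a, β a → Word} {es : ∀ a, σ a → Word}
    {step : ∀ a, σ a → β a → σ a} {i : ∀ a, σ a} {l : ∀ a, List (β a)}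
    (hstep : PolyW (fun x : Σ a, σ a × β a => pairW (e x.1) (pairW (es x.1 x.2.1) (eb x.1 x.2.2)))
      (fun x => es x.1 (step x.1 x.2.1 x.2.2)))
    (hi : PolyW e (fun a => es a (i a))) (hl : PolyW e (fun a => listW ((l a).map (eb a))))
    (hQ : ∃ Q : Polynomial ℕ, ∀ a l', l' <+: l a →
      (es a (l'.foldl (step a) (i a))).length ≤ Q.eval (e a).length) :
    PolyW e (fun a => es a ((l a).foldl (step a) (i a))) := by
  obtain ⟨Q, hQ⟩ := hQ
  refine (((refl e).pair hi).pair hl).trans ?_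
  refine (foldl_aux (σ := σ) eb (fun a s => pairW (e a) (es a s)) step ?_ i l
    (2 * Polynomial.X + 1 + Q) ?_).trans (snd _ _)
  · have h0 := refl fun x : Σ a, σ a × β a =>
      pairW (pairW (e x.1) (es x.1 x.2.1)) (eb x.1 x.2.2)
    exact h0.fst'.fst'.pair ((h0.fst'.fst'.pair (h0.fst'.snd'.pair h0.snd')).trans hstep)
  · intro a l' hl'
    have h1 := hQ a l' hl'
    have h2 : (e a).length ≤
        (pairW (pairW (e a) (es a (i a))) (listW ((l a).map (eb a)))).length := by
      simp only [length_pairW]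
      omega
    have h3 := Q.eval_mono_nat h2
    simp only at h3
    rw [length_pairW (e a) (es a _)]
    simp
    omega

end PolyW

/-! ### From word functions to machines with given alphabets -/

namespace WordMachine

/-- The alphabets of a machine with `N + 1` binary stacks, an input stack and an output stack. -/
def Alph (Γ₀ Γ₁ : Type) (N : ℕ) : Fin (N + 1) ⊕ Bool → Type
  | .inl _ => Bool
  | .inr false => Γ₀
  | .inr true => Γ₁

variable {Γ₀ Γ₁ : Type} {N : ℕ}

instance [Finite Γ₀] [Finite Γ₁] (k : Fin (N + 1) ⊕ Bool) : Finite (Alph Γ₀ Γ₁ N k) :=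
  match k with
  | .inl _ => inferInstanceAs (Finite Bool)
  | .inr false => inferInstanceAs (Finite Γ₀)
  | .inr true => inferInstanceAs (Finite Γ₁)

/-- The first binary stack. -/
def work : Fin (N + 1) ⊕ Bool := .inl ⟨0, Nat.succ_pos N⟩

/-- Input `x`, output `y`, and the word `w` on the first binary stack. -/
def conf (w : Word) (x : List Γ₀) (y : List Γ₁) : ∀ k, List (Alph Γ₀ Γ₁ N k)
  | .inl i => stks [w] i
  | .inr false => x
  | .inr true => y

section Steps

variable {w w' : Word} {x : List Γ₀} {y : List Γ₁} {m n : ℕ} {t u : ∀ k, List (Alph Γ₀ Γ₁ N k)}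

theorem update_conf_work :
    Function.update (conf (N := N) w x y) work w' = conf w' x y := by
  funext k
  rcases k with ⟨_ | i, hi⟩ | _ | _
  · exact Function.update_self ..
  · exact Function.update_of_ne (by simp [work]) ..
  · rfl
  · rfl

theorem update_conf_input (x' : List Γ₀) :
    Function.update (conf (N := N) w x y) (.inr false) x' = conf w x' y := by
  funext k
  rcases k with i | _ | _ <;> rfl

theorem update_conf_output (y' : List Γ₁) :
    Function.update (conf (N := N) w x y) (.inr true) y' = conf w x y' := by
  funext k
  rcases k with i | _ | _ <;> rfl

theorem exec_push_work (b : Bool) :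
    Exec (.push work b) (conf (N := N) w x y) 1 (conf (b :: w) x y) :=
  (congrArg (Exec _ _ 1) update_conf_work).mp (.push (Γ := Alph Γ₀ Γ₁ N) work b (conf w x y))

theorem exec_push_output (b : Γ₁) :
    Exec (.push (.inr true) b) (conf (N := N) w x y) 1 (conf w x (b :: y)) :=
  (congrArg (Exec _ _ 1) (update_conf_output _)).mp
    (.push (Γ := Alph Γ₀ Γ₁ N) (.inr true) b (conf w x y))

theorem exec_pop_work {f : Option Bool → StackProg (Alph Γ₀ Γ₁ N)} {b : Bool}
    (h : Exec (f (some b)) (conf w x y) n t) :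
    Exec (.pop work f) (conf (b :: w) x y) (n + 1) t :=
  Exec.pop (k := work) (f := f) (s := conf (b :: w) x y)
    ((congrArg (fun s => Exec (f (some b)) s n t) update_conf_work.symm).mp h)

theorem exec_loop_work {f : Bool → StackProg (Alph Γ₀ Γ₁ N)} {b : Bool}
    (h : Exec (f b) (conf w x y) m t) (h' : Exec (.loop work f) t n u) :
    Exec (.loop work f) (conf (b :: w) x y) (m + n + 1) u :=
  Exec.loop_cons (k := work) (f := f) (s := conf (b :: w) x y) (a := b) (l := w) rfl
    ((congrArg (fun s => Exec (f b) s m t) update_conf_work.symm).mp h) h'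

theorem exec_loop_input {f : Γ₀ → StackProg (Alph Γ₀ Γ₁ N)} {a : Γ₀}
    (h : Exec (f a) (conf w x y) m t) (h' : Exec (.loop (.inr false) f) t n u) :
    Exec (.loop (.inr false) f) (conf w (a :: x) y) (m + n + 1) u :=
  Exec.loop_cons (Γ := Alph Γ₀ Γ₁ N) (k := .inr false) (f := f) (s := conf w (a :: x) y) (a := a)
    (l := x) rfl
    ((congrArg (fun s => Exec (f a) s m t) (update_conf_input _).symm).mp h) h'

theorem conf_input_eq_nil (x : List Γ₀) (k : Fin (N + 1) ⊕ Bool) (hk : k ≠ .inr false) :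
    conf (N := N) [] x ([] : List Γ₁) k = [] := by
  rcases k with ⟨_ | k, _⟩ | _ | _ <;> first | rfl | exact absurd rfl hk

theorem conf_output_eq_nil (y : List Γ₁) (k : Fin (N + 1) ⊕ Bool) (hk : k ≠ .inr true) :
    conf (N := N) [] ([] : List Γ₀) y k = [] := by
  rcases k with ⟨_ | k, _⟩ | _ | _ <;> first | rfl | exact absurd rfl hk

end Steps

/-- Push a word onto the first binary stack. -/
def pushWord : Word → StackProg (Alph Γ₀ Γ₁ N)
  | [] => .skip
  | b :: w => .seq (pushWord w) (.push work b)

theorem exec_pushWord (v w : Word) (x : List Γ₀) (y : List Γ₁) :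
    Exec (pushWord (N := N) v) (conf w x y) (v.length + 1) (conf (v ++ w) x y) := by
  induction v with
  | nil => exact .skip _
  | cons b v ih => exact .seq ih (exec_push_work b)

theorem pairW_append (x y : Word) : pairW x [] ++ y = pairW x y := by
  induction x with
  | nil => rfl
  | cons b x ih => simp [pairW, ih]

/-- Translate the input, reversed, to a binary word. -/
def reader (κ : Γ₀ → Word) : StackProg (Alph Γ₀ Γ₁ N) :=
  .loop (.inr false) fun a => pushWord (pairW (κ a) [])

theorem exec_reader (κ : Γ₀ → Word) (C : ℕ) (hC : ∀ a, (κ a).length ≤ C) (x : List Γ₀) (w : Word) :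
    ∃ n ≤ x.length * (2 * C + 3) + 1,
      Exec (reader (Γ₁ := Γ₁) (N := N) κ) (conf w x []) n
        (conf (x.foldl (fun w a => pairW (κ a) w) w) [] []) := by
  induction x generalizing w with
  | nil => exact ⟨1, by simp, .loop_nil rfl⟩
  | cons a x ih =>
    obtain ⟨n, hn, h⟩ := ih (pairW (κ a) w)
    have h1 := exec_pushWord (N := N) (pairW (κ a) []) w x ([] : List Γ₁)
    rw [pairW_append] at h1
    refine ⟨_, ?_, exec_loop_input h1 h⟩
    have := hC a
    simp [length_pairW]
    rw [Nat.add_mul]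
    omega

/-- Read the rest of a code word of length at most `d`, after the letters `acc` and the marker `b`,
and output the symbol. -/
def readSymbol (δ : Word → Γ₁) : ℕ → Word → Bool → StackProg (Alph Γ₀ Γ₁ N)
  | _, acc, false => .push (.inr true) (δ acc)
  | 0, _, true => .skip
  | d + 1, acc, true => .pop work fun o : Option Bool => match o with
    | some b => .pop work fun o : Option Bool => match o with
      | some b' => readSymbol δ d (acc ++ [b]) b'
      | none => .skip
    | none => .skip

/-- Translate a binary word to the output, reversed. -/
def writer (δ : Word → Γ₁) (d : ℕ) : StackProg (Alph Γ₀ Γ₁ N) :=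
  .loop work fun b : Bool => readSymbol δ d [] b

theorem exec_readSymbol (δ : Word → Γ₁) (v acc w : Word) (y : List Γ₁) (d : ℕ) (hd : v.length ≤ d) :
    ∃ (b : Bool) (v' : Word) (n : ℕ), n ≤ 2 * v.length + 1 ∧ pairW v w = b :: v' ∧
      Exec (readSymbol (Γ₀ := Γ₀) (N := N) δ d acc b) (conf v' [] y) n
        (conf w [] (δ (acc ++ v) :: y)) := by
  induction v generalizing acc d with
  | nil =>
    refine ⟨false, w, 1, by simp, rfl, ?_⟩
    rw [readSymbol, List.append_nil]
    exact exec_push_output _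
  | cons c v ih =>
    obtain ⟨d, rfl⟩ : ∃ d', d = d' + 1 := ⟨d - 1, by simp at hd; omega⟩
    obtain ⟨b, v', n, hn, hv, h⟩ := ih (acc ++ [c]) d (by simpa using hd)
    refine ⟨true, c :: b :: v', n + 1 + 1, by simp; omega, by rw [pairW, hv], ?_⟩
    rw [readSymbol]
    refine exec_pop_work (exec_pop_work ?_)
    simpa using h

theorem exec_writer (κ : Γ₁ → Word) (δ : Word → Γ₁) (hδ : ∀ a, δ (κ a) = a) (C : ℕ)
    (hC : ∀ a, (κ a).length ≤ C) (z y : List Γ₁) :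
    ∃ n ≤ z.length * (2 * C + 2) + 1,
      Exec (writer (Γ₀ := Γ₀) (N := N) δ C) (conf (listW (z.map κ)) [] y) n
        (conf [] [] (z.reverse ++ y)) := by
  induction z generalizing y with
  | nil => exact ⟨1, by simp, .loop_nil rfl⟩
  | cons a z ih =>
    obtain ⟨n, hn, h⟩ := ih (a :: y)
    obtain ⟨b, v', m, hm, hv, h'⟩ := exec_readSymbol (Γ₀ := Γ₀) (N := N) δ (κ a) []
      (listW (z.map κ)) y C (hC a)
    rw [List.nil_append, hδ] at h'
    rw [List.map_cons, listW, hv]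
    refine ⟨m + n + 1, ?_, exec_loop_work h' (by simpa [writer] using h)⟩
    have := hC a
    simp
    rw [Nat.add_mul]
    omega

theorem nonempty_outputsInTime_conf [Finite Γ₀] [Finite Γ₁] {c : StackProg (Alph Γ₀ Γ₁ N)}
    {x : List Γ₀} {y : List Γ₁} {n T : ℕ} (h : Exec c (conf [] x []) n (conf [] [] y))
    (hT : n + 1 ≤ T) :
    Nonempty (TM2OutputsInTime (c.toFinTM2 (.inr false) (.inr true))
      (List.map (Equiv.refl Γ₀).invFun x) (some (List.map (Equiv.refl Γ₁).invFun y)) T) := by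
  have hx : List.map (Equiv.refl Γ₀).invFun x = x := List.map_id x
  have hy : List.map (Equiv.refl Γ₁).invFun y = y := List.map_id y
  exact (congrArg₂ (fun (x : List Γ₀) (y : List Γ₁) =>
    Nonempty (TM2OutputsInTime (c.toFinTM2 (.inr false) (.inr true)) x (some y) T)) hx hy).mpr
    (nonempty_outputsInTime h hT _ _ (conf_input_eq_nil _) (conf_output_eq_nil _))

end WordMachine

open WordMachine in
/-- A word function that translates code words letter by letter between input and output yields a
polynomial-time machine. -/
theorem PolyW.nonempty_computable {α β Γ₀ Γ₁ : Type} [Finite Γ₀] [Finite Γ₁] [Nonempty Γ₁]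
    (ea : α → List Γ₀) (eb : β → List Γ₁) (f : α → β) (κ₀ : Γ₀ → Word) (κ₁ : Γ₁ → Word)
    (hκ : Function.Injective κ₁)
    (h : PolyW (fun a => listW ((ea a).map κ₀)) (fun a => listW ((eb (f a)).map κ₁))) :
    Nonempty (TM2ComputableInPolyTime ea eb f) := by
  -- the reader and the writer both reverse the order of the symbols
  have hrev : ∀ {Δ : Type} (κ : Δ → Word) {ι : Type} (l : ι → List Δ),
      PolyW (fun a => listW ((l a).map κ)) (fun a => listW ((l a).reverse.map κ)) := by
    intro Δ κ ι l
    have := PolyW.foldl (e := fun a => listW ((l a).map κ)) (β := fun _ => Δ)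
      (σ := fun _ => List Δ) (eb := fun _ => κ) (es := fun _ l => listW (l.map κ))
      (step := fun _ s b => b :: s) (i := fun _ => []) (l := l) ?_ (.const _ _) (.refl _)
      ⟨Polynomial.X, ?_⟩
    · simpa using this
    · have h0 := PolyW.refl fun x : Σ _ : ι, List Δ × Δ =>
        pairW (listW ((l x.1).map κ)) (pairW (listW (x.2.1.map κ)) (κ x.2.2))
      exact h0.snd'.snd'.pair h0.snd'.fst'
    · intro a l' hl'
      have hlen : ∀ l : List Δ, (listW (l.map κ)).length =
          (l.map fun b => 2 * (κ b).length + 1).sum := by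
        intro l
        induction l with
        | nil => rfl
        | cons b l ih => simp [listW, length_pairW, ih]
      obtain ⟨l'', hl''⟩ := hl'
      simp only [← hl'', hlen, List.foldl_flip_cons_eq_append, List.append_nil]
      simp [List.sum_reverse]
  have h' := (hrev κ₀ fun a => (ea a).reverse).trans
    (((by simpa using h : PolyW _ _)).trans (hrev κ₁ fun a => eb (f a)))
  obtain ⟨p, hp⟩ := h'.exists_length_le
  obtain ⟨c, q, hc⟩ := h'
  obtain ⟨N, hN⟩ := c.exists_uses_lt
  obtain ⟨C₀, hC₀⟩ := (Set.finite_range fun a => (κ₀ a).length).bddAbove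
  obtain ⟨C₁, hC₁⟩ := (Set.finite_range fun a => (κ₁ a).length).bddAbove
  have hC₀ : ∀ a, (κ₀ a).length ≤ C₀ := fun a => hC₀ ⟨a, rfl⟩
  have hC₁ : ∀ a, (κ₁ a).length ≤ C₁ := fun a => hC₁ ⟨a, rfl⟩
  let δ := Function.invFun κ₁
  have hδ : ∀ a, δ (κ₁ a) = a := Function.leftInverse_invFun hκ
  let c' : StackProg (Alph Γ₀ Γ₁ N) := StackProg.map (Γ' := Alph Γ₀ Γ₁ N)
    (fun i : ℕ => Sum.inl (Fin.ofNat (N + 1) i)) c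
  let prog : StackProg (Alph Γ₀ Γ₁ N) := .seq (reader κ₀) (.seq c' (writer δ C₁))
  let T : Polynomial ℕ := Polynomial.X * Polynomial.C (2 * C₀ + 3) + 1 +
    (q.comp (Polynomial.C (2 * C₀ + 1) * Polynomial.X) +
      (p.comp (Polynomial.C (2 * C₀ + 1) * Polynomial.X) * Polynomial.C (2 * C₁ + 2) + 1)) + 1
  have key : ∀ a, ∃ n, n + 1 ≤ T.eval (ea a).length ∧
      Exec prog (conf [] (ea a) []) n (conf [] [] (eb (f a))) := by
    intro a
    set w := listW ((ea a).reverse.map κ₀) with hw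
    set v := listW ((eb (f a)).reverse.map κ₁) with hv
    have hwl : w.length ≤ (2 * C₀ + 1) * (ea a).length := by
      rw [hw]
      have : ∀ l : List Γ₀, (listW (l.map κ₀)).length ≤ (2 * C₀ + 1) * l.length := by
        intro l
        induction l with
        | nil => simp [listW]
        | cons b l ih =>
          have := hC₀ b
          simp [listW, length_pairW, Nat.mul_add]
          omega
      simpa using this (ea a).reverse
    obtain ⟨n₁, hn₁, h₁⟩ := exec_reader (Γ₁ := Γ₁) (N := N) κ₀ C₀ hC₀ (ea a) []
    have hfold : (ea a).foldl (fun w a => pairW (κ₀ a) w) [] = w := by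
      rw [hw]
      have : ∀ (l l' : List Γ₀), l.foldl (fun w a => pairW (κ₀ a) w) (listW (l'.map κ₀)) =
          listW ((l.reverse ++ l').map κ₀) := by
        intro l
        induction l with
        | nil => simp
        | cons b l ih =>
          intro l'
          have := ih (b :: l')
          simp only [List.map_cons, listW] at this
          simp only [List.foldl_cons, this, List.reverse_cons, List.append_assoc,
            List.singleton_append]
      simpa [listW] using this (ea a) []
    rw [hfold] at h₁
    obtain ⟨n₂, hn₂, h₂⟩ := hc a
    obtain ⟨S, hS, hS1, hS2⟩ := Exec.map (K' := Fin (N + 1) ⊕ Bool) (Γ' := Alph Γ₀ Γ₁ N)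
      (e := fun i : ℕ => Sum.inl (Fin.ofNat (N + 1) i)) (P := fun i => i < N + 1) h₂
      (hN.mono fun k hk => Nat.lt_succ_of_lt hk)
      (fun i j hi hj hij => by
        simpa [Fin.ext_iff, Nat.mod_eq_of_lt hi, Nat.mod_eq_of_lt hj] using hij)
      (conf w [] [])
      (fun k hk => congrArg (stks [w]) (Nat.mod_eq_of_lt hk))
    have hSv : S = conf v [] [] := by
      funext k
      rcases k with i | _ | _
      · have h1 := hS1 i i.2
        have h2 : Fin.ofNat (N + 1) i = i := by simp
        rw [h2] at h1
        exact h1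
      · exact hS2 _ (fun _ _ => by simp)
      · exact hS2 _ (fun _ _ => by simp)
    rw [hSv] at hS
    obtain ⟨n₃, hn₃, h₃⟩ := exec_writer (Γ₀ := Γ₀) (N := N) κ₁ δ hδ C₁ hC₁ (eb (f a)).reverse []
    rw [List.reverse_reverse, List.append_nil] at h₃
    refine ⟨_, ?_, .seq h₁ (.seq hS h₃)⟩
    have e1 : n₂ ≤ q.eval ((2 * C₀ + 1) * (ea a).length) := by
      exact hn₂.trans (q.eval_mono_nat hwl)
    have e2 : (eb (f a)).length ≤ p.eval ((2 * C₀ + 1) * (ea a).length) := by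
      have h1 := (length_le_listW κ₁ (eb (f a)).reverse).1
      rw [List.length_reverse] at h1
      exact h1.trans ((hp a).trans (p.eval_mono_nat hwl))
    have e3 := Nat.mul_le_mul_right (2 * C₁ + 2) e2
    simp only [List.length_reverse] at hn₃
    simp only [T, Polynomial.eval_add, Polynomial.eval_mul, Polynomial.eval_X, Polynomial.eval_C,
      Polynomial.eval_comp, Polynomial.eval_one]
    omega
  refine ⟨⟨⟨prog.toFinTM2 (.inr false) (.inr true), Equiv.refl _, Equiv.refl _⟩, T,
    fun a => Classical.choice ?_⟩⟩
  obtain ⟨n, hn, h⟩ := key a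
  exact nonempty_outputsInTime_conf h hn

/-! ### Data types as words -/

/-- A standard way to write the elements of a type as binary words. It need not be injective:
functions are computed from words that are known to stand for given elements. -/
class Enc (α : Type) where
  /-- the word that stands for an element -/
  enc : α → Word

open Enc (enc)

instance : Enc Unit := ⟨fun _ => []⟩
instance : Enc Bool := ⟨fun b => [b]⟩
/-- Numbers are written in binary, the least significant bit first. -/
instance : Enc ℕ := ⟨Nat.bits⟩
instance {α β : Type} [Enc α] [Enc β] : Enc (α × β) := ⟨fun x => pairW (enc x.1) (enc x.2)⟩
instance {α : Type} [Enc α] : Enc (List α) := ⟨fun l => listW (l.map enc)⟩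
instance {α : Type} [Enc α] : Enc (Option α) := ⟨fun o => o.elim [] fun a => true :: enc a⟩
instance {α β : Type} [Enc α] [Enc β] : Enc (α ⊕ β) :=
  ⟨fun x => x.elim (fun a => false :: enc a) (fun b => true :: enc b)⟩
/-- Residues modulo `p ≠ 0` are represented by the numbers `0, …, p - 1`. -/
instance (p : ℕ) : Enc (ZMod p) := ⟨fun x => enc x.val⟩

theorem length_enc_prod {α β : Type} [Enc α] [Enc β] (x : α × β) :
    (enc x).length = 2 * (enc x.1).length + 1 + (enc x.2).length := length_pairW _ _

theorem length_enc_cons {α : Type} [Enc α] (x : α) (l : List α) :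
    (enc (x :: l)).length = 2 * (enc x).length + 1 + (enc l).length := length_pairW _ _

/-- The values `f a` are computable from the words `e a` in polynomial time. The type of `f a` may
depend on `a`. -/
def PTime {α : Type} (e : α → Word) {β : α → Type} [∀ a, Enc (β a)] (f : ∀ a, β a) : Prop :=
  PolyW e fun a => enc (f a)

namespace PTime

variable {α γ : Type} {e : α → Word} {β σ : α → Type} [∀ a, Enc (β a)] [∀ a, Enc (σ a)]

theorem const {β : Type} [Enc β] (b : β) : PTime e (fun _ => b) := PolyW.const e _

/-- Change of context along a map that is itself computable. -/
theorem comap {e' : γ → Word} {i : γ → α} {f : ∀ a, β a} (hf : PTime e f)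
    (hi : PolyW e' fun c => e (i c)) : PTime e' (fun c => f (i c)) :=
  hi.trans (hf.reindex i)

theorem pair {f : ∀ a, β a} {g : ∀ a, σ a} (hf : PTime e f) (hg : PTime e g) :
    PTime e (fun a => (f a, g a)) := PolyW.pair hf hg

theorem fst {f : ∀ a, β a × σ a} (hf : PTime e f) : PTime e (fun a => (f a).1) := PolyW.fst' hf

theorem snd {f : ∀ a, β a × σ a} (hf : PTime e f) : PTime e (fun a => (f a).2) := PolyW.snd' hf

theorem ite {c : α → Bool} {f g : ∀ a, β a} (hc : PTime e c) (hf : PTime e f) (hg : PTime e g) :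
    PTime e (fun a => if c a then f a else g a) := by
  have := PolyW.ite (c := c) hc hf hg
  refine PolyW.congr this fun a => ?_
  beta_reduce
  split_ifs <;> rfl

theorem ite' {c : α → Prop} [∀ a, Decidable (c a)] {f g : ∀ a, β a}
    (hc : PTime e fun a => decide (c a)) (hf : PTime e f) (hg : PTime e g) :
    PTime e (fun a => if c a then f a else g a) := by
  simpa using hc.ite hf hg

theorem bool {β : Type} [Enc β] (F : Bool → β) {c : α → Bool} (hc : PTime e c) :
    PTime e (fun a => F (c a)) := by
  have := hc.ite (const (F true)) (const (F false))
  refine PolyW.congr this fun a => ?_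
  beta_reduce
  cases c a <;> rfl

theorem bool₂ {β : Type} [Enc β] (F : Bool → Bool → β) {c d : α → Bool} (hc : PTime e c)
    (hd : PTime e d) : PTime e (fun a => F (c a) (d a)) := by
  have := hc.ite (hd.bool (F true)) (hd.bool (F false))
  refine PolyW.congr this fun a => ?_
  beta_reduce
  cases c a <;> rfl

theorem bool₃ {β : Type} [Enc β] (F : Bool → Bool → Bool → β) {c d d' : α → Bool} (hc : PTime e c)
    (hd : PTime e d) (hd' : PTime e d') : PTime e (fun a => F (c a) (d a) (d' a)) := by
  have := hc.ite (hd.bool₂ (F true) hd') (hd.bool₂ (F false) hd')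
  refine PolyW.congr this fun a => ?_
  beta_reduce
  cases c a <;> rfl

theorem not {c : α → Prop} [∀ a, Decidable (c a)] (hc : PTime e fun a => decide (c a)) :
    PTime e (fun a => decide (¬ c a)) := by
  simpa using hc.bool (fun b => !b)

theorem and {c d : α → Prop} [∀ a, Decidable (c a)] [∀ a, Decidable (d a)]
    (hc : PTime e fun a => decide (c a)) (hd : PTime e fun a => decide (d a)) :
    PTime e (fun a => decide (c a ∧ d a)) := by
  simpa using hc.bool₂ (fun b b' => b && b') hd

theorem or {c d : α → Prop} [∀ a, Decidable (c a)] [∀ a, Decidable (d a)]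
    (hc : PTime e fun a => decide (c a)) (hd : PTime e fun a => decide (d a)) :
    PTime e (fun a => decide (c a ∨ d a)) := by
  simpa using hc.bool₂ (fun b b' => b || b') hd

/-! ### Lists and options -/

theorem cons {f : ∀ a, β a} {l : ∀ a, List (β a)} (hf : PTime e f) (hl : PTime e l) :
    PTime e (fun a => f a :: l a) := PolyW.pair hf hl

theorem nil : PTime e (fun a => ([] : List (β a))) := PolyW.const e _

theorem isEmpty {l : ∀ a, List (β a)} (hl : PTime e l) : PTime e (fun a => (l a).isEmpty) := by
  have := PolyW.trans hl (PolyW.isEmpty fun a => enc (l a))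
  refine PolyW.congr this fun a => ?_
  beta_reduce
  cases l a with
  | nil => rfl
  | cons b l => cases h : enc b <;> simp [enc, listW, h, pairW]

theorem headD {l : ∀ a, List (β a)} {d : ∀ a, β a} (hl : PTime e l) (hd : PTime e d) :
    PTime e (fun a => (l a).headD (d a)) := by
  have h0 : PTime (fun a : {a // (l a).isEmpty = false} => e a) (fun a => (l a).headD (d a)) := by
    have h1 := hl.reindex (Subtype.val : {a // (l a).isEmpty = false} → α)
    have h2 : ∀ a : {a // (l a).isEmpty = false},
        enc (l a) = pairW (enc ((l a).headD (d a))) (enc (l a).tail) := by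
      rintro ⟨a, ha⟩
      cases hla : l a with
      | nil => simp [hla] at ha
      | cons b l => rfl
    simp only [h2] at h1
    exact h1.fst'
  have := PolyW.cond (c := fun a => (l a).isEmpty) (f := fun a => enc (d a))
    (g := fun a => enc ((l a).headD (d a))) hl.isEmpty (hd.reindex Subtype.val) h0
  refine PolyW.congr this fun a => ?_
  beta_reduce
  cases l a <;> rfl

theorem tail {l : ∀ a, List (β a)} (hl : PTime e l) : PTime e (fun a => (l a).tail) := by
  have h0 : PTime (fun a : {a // (l a).isEmpty = false} => e a) (fun a => (l a).tail) := by
    have h1 := hl.reindex (Subtype.val : {a // (l a).isEmpty = false} → α)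
    have h2 : ∀ a : {a // (l a).isEmpty = false}, ∃ w,
        enc (l a) = pairW w (enc (l a).tail) := by
      rintro ⟨a, ha⟩
      cases hla : l a with
      | nil => simp [hla] at ha
      | cons b l => exact ⟨_, rfl⟩
    choose w hw using h2
    simp only [hw] at h1
    exact h1.snd'
  have := PolyW.cond (c := fun a => (l a).isEmpty) (f := fun a => enc ([] : List (β a)))
    (g := fun a => enc (l a).tail) hl.isEmpty
    ((nil (e := e) (β := β)).reindex Subtype.val) h0
  refine PolyW.congr this fun a => ?_
  beta_reduce
  cases l a <;> rfl

theorem none' : PTime e (fun a => (none : Option (β a))) := PolyW.const e _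

theorem some' {f : ∀ a, β a} (hf : PTime e f) : PTime e (fun a => some (f a)) :=
  PolyW.trans hf (PolyW.consBit true _)

theorem isSome {o : ∀ a, Option (β a)} (ho : PTime e o) : PTime e (fun a => (o a).isSome) := by
  have := PolyW.trans ho (PolyW.headBit _)
  refine PolyW.congr this fun a => ?_
  beta_reduce
  cases o a <;> rfl

theorem getD {o : ∀ a, Option (β a)} {d : ∀ a, β a} (ho : PTime e o) (hd : PTime e d) :
    PTime e (fun a => (o a).getD (d a)) := by
  have := PolyW.ite (c := fun a => (o a).isSome) ho.isSome (PolyW.trans ho (PolyW.tailBits _)) hd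
  refine PolyW.congr this fun a => ?_
  beta_reduce
  cases o a <;> rfl

theorem isRight {f : ∀ a, β a ⊕ σ a} (hf : PTime e f) : PTime e (fun a => (f a).isRight) := by
  have := PolyW.trans hf (PolyW.headBit _)
  refine PolyW.congr this fun a => ?_
  beta_reduce
  cases f a <;> rfl

theorem getLeftD {f : ∀ a, β a ⊕ σ a} {d : ∀ a, β a} (hf : PTime e f) (hd : PTime e d) :
    PTime e (fun a => (f a).elim id fun _ => d a) := by
  have := PolyW.ite (c := fun a => (f a).isRight) hf.isRight hd (PolyW.trans hf (PolyW.tailBits _))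
  refine PolyW.congr this fun a => ?_
  beta_reduce
  cases f a <;> rfl

theorem getRightD {f : ∀ a, β a ⊕ σ a} {d : ∀ a, σ a} (hf : PTime e f) (hd : PTime e d) :
    PTime e (fun a => (f a).elim (fun _ => d a) id) := by
  have := PolyW.ite (c := fun a => (f a).isRight) hf.isRight (PolyW.trans hf (PolyW.tailBits _)) hd
  refine PolyW.congr this fun a => ?_
  beta_reduce
  cases f a <;> rfl

/-- The context in which the step of a fold is computed: the outer context, the state and the
element. -/
abbrev stepCtx (e : α → Word) (σ β : α → Type) [∀ a, Enc (β a)] [∀ a, Enc (σ a)] :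
    (Σ a, σ a × β a) → Word :=
  fun x => pairW (e x.1) (enc x.2)

/-- Values that depend on the context only can be used in a step. -/
theorem ctx {f : α → γ} [Enc γ] (hf : PTime e f) :
    PTime (stepCtx e σ β) (fun x => f x.1) :=
  hf.comap (PolyW.fst _ _)

theorem ctxD {τ : α → Type} [∀ a, Enc (τ a)] {f : ∀ a, τ a} (hf : PTime e f) :
    PTime (stepCtx e σ β) (β := fun x => τ x.1) (fun x => f x.1) :=
  PolyW.trans (PolyW.fst _ _) (hf.reindex Sigma.fst)

theorem state : PTime (stepCtx e σ β) (β := fun x => σ x.1) (fun x => x.2.1) :=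
  (PolyW.snd _ _).trans (PolyW.fst (fun x : Σ a, σ a × β a => enc x.2.1) _)

theorem elem : PTime (stepCtx e σ β) (β := fun x => β x.1) (fun x => x.2.2) :=
  (PolyW.snd _ _).trans (PolyW.snd (fun x : Σ a, σ a × β a => enc x.2.1) _)

/-- Folds whose states satisfy an invariant under which every step adds a polynomially bounded
amount to the length of the state. -/
theorem foldl_of_invariant {step : ∀ a, σ a → β a → σ a} {i : ∀ a, σ a} {l : ∀ a, List (β a)}
    (hstep : PTime (stepCtx e σ β) (fun x => step x.1 x.2.1 x.2.2))
    (hi : PTime e i) (hl : PTime e l) (I : ∀ a, σ a → Prop) (hI : ∀ a, I a (i a))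
    (hIs : ∀ a s, I a s → ∀ b ∈ l a, I a (step a s b))
    (hK : ∃ K : Polynomial ℕ, ∀ a s, I a s → ∀ b ∈ l a,
      (enc (step a s b)).length ≤ (enc s).length + K.eval (e a).length) :
    PTime e (fun a => (l a).foldl (step a) (i a)) := by
  obtain ⟨K, hK⟩ := hK
  obtain ⟨p, hp⟩ := PolyW.exists_length_le hi
  obtain ⟨q, hq⟩ := PolyW.exists_length_le hl
  refine PolyW.foldl (σ := σ) (eb := fun _ => enc) (es := fun _ => enc) hstep hi hl
    ⟨p + q * K, fun a l' hl' => ?_⟩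
  have h1 : ∀ (l' : List (β a)) s, I a s → (∀ b ∈ l', b ∈ l a) →
      (enc (l'.foldl (step a) s)).length ≤ (enc s).length + l'.length * K.eval (e a).length := by
    intro l'
    induction l' with
    | nil => simp
    | cons b l' ih =>
      intro s hs h
      have h0 := h b (by simp)
      have h2 := ih (step a s b) (hIs a s hs b h0) (fun b hb => h b (List.mem_cons_of_mem _ hb))
      have h3 := hK a s hs b h0
      simp only [List.foldl_cons, List.length_cons, Nat.add_mul]
      omega
  have h2 := h1 l' (i a) (hI a) (fun b hb => hl'.subset hb)
  have h3 := hp a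
  have h4 : l'.length ≤ q.eval (e a).length :=
    hl'.length_le.trans ((PolyW.length_le_listW enc (l a)).1.trans (hq a))
  have h5 := Nat.mul_le_mul_right (K.eval (e a).length) h4
  simp only [Polynomial.eval_add, Polynomial.eval_mul]
  omega

theorem foldl {step : ∀ a, σ a → β a → σ a} {i : ∀ a, σ a} {l : ∀ a, List (β a)}
    (hstep : PTime (stepCtx e σ β) (fun x => step x.1 x.2.1 x.2.2))
    (hi : PTime e i) (hl : PTime e l)
    (hK : ∃ K : Polynomial ℕ, ∀ a s, ∀ b ∈ l a,
      (enc (step a s b)).length ≤ (enc s).length + K.eval (e a).length) :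
    PTime e (fun a => (l a).foldl (step a) (i a)) :=
  foldl_of_invariant hstep hi hl (fun _ _ => True) (fun _ => trivial) (fun _ _ _ _ _ => trivial)
    (let ⟨K, hK⟩ := hK; ⟨K, fun a s _ b hb => hK a s b hb⟩)

/-- Folds all of whose states are of polynomial length. -/
theorem foldl_bdd {step : ∀ a, σ a → β a → σ a} {i : ∀ a, σ a} {l : ∀ a, List (β a)}
    (hstep : PTime (stepCtx e σ β) (fun x => step x.1 x.2.1 x.2.2))
    (hi : PTime e i) (hl : PTime e l)
    (hK : ∃ K : Polynomial ℕ, ∀ a (s : σ a), (enc s).length ≤ K.eval (e a).length) :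
    PTime e (fun a => (l a).foldl (step a) (i a)) :=
  foldl hstep hi hl (let ⟨K, hK⟩ := hK; ⟨K, fun a _ _ _ => (hK a _).trans (Nat.le_add_left _ _)⟩)

theorem reverse {l : ∀ a, List (β a)} (hl : PTime e l) : PTime e (fun a => (l a).reverse) := by
  have := foldl (e := e) (σ := fun a => List (β a)) (step := fun _ s b => b :: s) (l := l)
    (elem.cons state) nil hl ?_
  · simpa using this
  · obtain ⟨q, hq⟩ := PolyW.exists_length_le hl
    refine ⟨2 * q + 1, fun a _ _ hb => ?_⟩
    have := ((PolyW.length_le_listW enc (l a)).2 _ hb).trans (hq a)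
    simp [enc, listW, length_pairW] at this ⊢
    omega

theorem foldr_of_invariant {step : ∀ a, β a → σ a → σ a} {i : ∀ a, σ a} {l : ∀ a, List (β a)}
    (hstep : PTime (stepCtx e σ β) (fun x => step x.1 x.2.2 x.2.1))
    (hi : PTime e i) (hl : PTime e l) (I : ∀ a, σ a → Prop) (hI : ∀ a, I a (i a))
    (hIs : ∀ a s, I a s → ∀ b ∈ l a, I a (step a b s))
    (hK : ∃ K : Polynomial ℕ, ∀ a s, I a s → ∀ b ∈ l a,
      (enc (step a b s)).length ≤ (enc s).length + K.eval (e a).length) :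
    PTime e (fun a => (l a).foldr (step a) (i a)) := by
  have := foldl_of_invariant (e := e) (σ := σ) (step := fun a s b => step a b s) hstep hi
    hl.reverse I hI (by simpa using hIs) (by simpa using hK)
  simpa using this

theorem foldr {step : ∀ a, β a → σ a → σ a} {i : ∀ a, σ a} {l : ∀ a, List (β a)}
    (hstep : PTime (stepCtx e σ β) (fun x => step x.1 x.2.2 x.2.1))
    (hi : PTime e i) (hl : PTime e l)
    (hK : ∃ K : Polynomial ℕ, ∀ a s, ∀ b ∈ l a,
      (enc (step a b s)).length ≤ (enc s).length + K.eval (e a).length) :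
    PTime e (fun a => (l a).foldr (step a) (i a)) := by
  have := foldl (e := e) (σ := σ) (step := fun a s b => step a b s) hstep hi hl.reverse
    (by simpa using hK)
  simpa using this

theorem map {τ : α → Type} [∀ a, Enc (τ a)] {g : ∀ a, β a → τ a} {l : ∀ a, List (β a)}
    (hg : PTime (stepCtx e (fun a => List (τ a)) β) (β := fun x => τ x.1) (fun x => g x.1 x.2.2))
    (hl : PTime e l) (hK : ∃ K : Polynomial ℕ, ∀ a, ∀ b ∈ l a,
      (enc (g a b)).length ≤ K.eval (e a).length) :
    PTime e (fun a => (l a).map (g a)) := by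
  have hK' : ∃ K : Polynomial ℕ, ∀ a (s : List (τ a)), ∀ b ∈ l a,
      (enc (g a b :: s)).length ≤ (enc s).length + K.eval (e a).length := by
    obtain ⟨K, hK⟩ := hK
    refine ⟨2 * K + 1, fun a s b hb => ?_⟩
    have := hK a b hb
    simp [enc, listW, length_pairW] at this ⊢
    omega
  have := foldr (e := e) (σ := fun a => List (τ a)) (step := fun a b s => g a b :: s) (l := l)
    (hg.cons state) nil hl hK'
  simpa using this

theorem append {l l' : ∀ a, List (β a)} (hl : PTime e l) (hl' : PTime e l') :
    PTime e (fun a => l a ++ l' a) := by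
  have := foldr (e := e) (σ := fun a => List (β a)) (step := fun _ b s => b :: s) (l := l)
    (elem.cons state) hl' hl ?_
  · simpa using this
  · obtain ⟨q, hq⟩ := PolyW.exists_length_le hl
    refine ⟨2 * q + 1, fun a s b hb => ?_⟩
    have := ((PolyW.length_le_listW enc (l a)).2 b hb).trans (hq a)
    simp [enc, listW, length_pairW] at this ⊢
    omega

/-- A list as long as the input. -/
theorem clock : PTime e (fun a => List.replicate (e a).length ()) := by
  have := PolyW.clock e
  refine PolyW.congr this fun a => ?_
  beta_reduce
  induction (e a).length with
  | zero => rfl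
  | succ n ih =>
    rw [List.replicate_succ, ih]
    rfl

end PTime

/-! ### Arithmetic of natural numbers -/

theorem length_enc_nat (n : ℕ) : (enc n).length = n.size := (Nat.size_eq_bits_len n).symm ▸ rfl

/-- One step of a ripple-carry computation with table `F` on a carry, two numbers and the output. -/
def rippleStep (F : Bool → Bool → Bool → Bool × Bool) (s : Bool × ℕ × ℕ × List Bool) :
    Bool × ℕ × ℕ × List Bool :=
  ((F s.1 s.2.1.bodd s.2.2.1.bodd).1, s.2.1.div2, s.2.2.1.div2,
    (F s.1 s.2.1.bodd s.2.2.1.bodd).2 :: s.2.2.2)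

/-- The number whose bits, the most significant one first, are given. -/
def ofBits (l : List Bool) : ℕ := l.foldl (fun n b => Nat.bit b n) 0

/-- The final carry and the output of a ripple-carry computation of `k` steps. -/
def ripple (F : Bool → Bool → Bool → Bool × Bool) (k m n : ℕ) : Bool × ℕ :=
  let s := (List.replicate k ()).foldl (fun s _ => rippleStep F s) (false, m, n, [])
  (s.1, ofBits s.2.2.2)

theorem ofBits_foldl (l : List Bool) (n : ℕ) :
    l.foldl (fun n b => Nat.bit b n) n = ofBits l + 2 ^ l.length * n := by
  induction l generalizing n with
  | nil => simp [ofBits]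
  | cons b l ih =>
    rw [ofBits, List.foldl_cons, List.foldl_cons, ih, ih (Nat.bit b 0)]
    simp only [Nat.bit_val, List.length_cons]
    ring

theorem ofBits_cons (b : Bool) (l : List Bool) :
    ofBits (b :: l) = ofBits l + 2 ^ l.length * b.toNat := by
  rw [ofBits, List.foldl_cons, ofBits_foldl]
  simp [Nat.bit_val]

theorem ofBits_lt (l : List Bool) : ofBits l < 2 ^ l.length := by
  induction l with
  | nil => simp [ofBits]
  | cons b l ih =>
    rw [ofBits_cons, List.length_cons, pow_succ]
    cases b <;> simp <;> omega

/-- The table of a full adder: the new carry and the sum bit. -/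
def addTable (c x y : Bool) : Bool × Bool :=
  ((x && y) || (c && (x || y)), xor c (xor x y))

/-- The table of a full subtractor: the new borrow and the difference bit. -/
def subTable (c x y : Bool) : Bool × Bool :=
  ((!x && y) || (c && (!x || y)), xor c (xor x y))

theorem div2_lt_pow {n k : ℕ} (h : n < 2 ^ (k + 1)) : n.div2 < 2 ^ k := by
  rw [Nat.div2_val]
  rw [pow_succ] at h
  omega

/-- The remaining `k` steps of an addition, with the carry `c` and the output `l` so far. -/
theorem ripple_add_aux (k : ℕ) : ∀ (c : Bool) (m n : ℕ) (l : List Bool), m < 2 ^ k → n < 2 ^ k →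
    let s := (List.replicate k ()).foldl (fun s _ => rippleStep addTable s) (c, m, n, l)
    ofBits s.2.2.2 + 2 ^ (l.length + k) * s.1.toNat =
      ofBits l + 2 ^ l.length * (m + n + c.toNat) := by
  induction k with
  | zero =>
    intro c m n l hm hn
    obtain rfl : m = 0 := by omega
    obtain rfl : n = 0 := by omega
    simp
  | succ k ih =>
    intro c m n l hm hn
    have h := ih (rippleStep addTable (c, m, n, l)).1 m.div2 n.div2
      (rippleStep addTable (c, m, n, l)).2.2.2 (div2_lt_pow hm) (div2_lt_pow hn)
    simp only [List.replicate_succ, List.foldl_cons] at h ⊢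
    have e1 : (rippleStep addTable (c, m, n, l)).2.2.2.length = l.length + 1 := rfl
    rw [e1, show l.length + 1 + k = l.length + (k + 1) by omega] at h
    refine h.trans ?_
    have hm' := Nat.bodd_add_div2 m
    have hn' := Nat.bodd_add_div2 n
    simp only [rippleStep, ofBits_cons]
    rw [pow_succ]
    conv_rhs => rw [← hm', ← hn']
    cases c <;> cases m.bodd <;> cases n.bodd <;> simp [addTable] <;> ring

/-- The remaining `k` steps of a subtraction, with the borrow `c` and the output `l` so far. -/
theorem ripple_sub_aux (k : ℕ) : ∀ (c : Bool) (m n : ℕ) (l : List Bool), m < 2 ^ k → n < 2 ^ k →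
    let s := (List.replicate k ()).foldl (fun s _ => rippleStep subTable s) (c, m, n, l)
    (ofBits s.2.2.2 : ℤ) - 2 ^ (l.length + k) * s.1.toNat =
      ofBits l + 2 ^ l.length * (m - n - c.toNat) ∧ s.2.2.2.length = l.length + k := by
  induction k with
  | zero =>
    intro c m n l hm hn
    obtain rfl : m = 0 := by omega
    obtain rfl : n = 0 := by omega
    simp
    ring
  | succ k ih =>
    intro c m n l hm hn
    have h := ih (rippleStep subTable (c, m, n, l)).1 m.div2 n.div2
      (rippleStep subTable (c, m, n, l)).2.2.2 (div2_lt_pow hm) (div2_lt_pow hn)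
    simp only [List.replicate_succ, List.foldl_cons] at h ⊢
    have e1 : (rippleStep subTable (c, m, n, l)).2.2.2.length = l.length + 1 := rfl
    rw [e1, show l.length + 1 + k = l.length + (k + 1) by omega] at h
    refine ⟨h.1.trans ?_, h.2⟩
    have hm' := Nat.bodd_add_div2 m
    have hn' := Nat.bodd_add_div2 n
    simp only [rippleStep, ofBits_cons]
    rw [pow_succ]
    conv_rhs => rw [← hm', ← hn']
    cases c <;> cases m.bodd <;> cases n.bodd <;> simp [subTable] <;> ring

theorem ripple_add {k m n : ℕ} (hm : m < 2 ^ k) (hn : n < 2 ^ k) (h : m + n < 2 ^ k) :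
    (ripple addTable k m n).2 = m + n := by
  have := ripple_add_aux k false m n [] hm hn
  simp only [ripple, List.length_nil, Nat.zero_add, pow_zero, one_mul, Bool.toNat_false,
    Nat.add_zero] at this ⊢
  have h0 : ofBits [] = 0 := rfl
  rw [h0] at this
  generalize (List.replicate k ()).foldl _ _ = s at this ⊢
  cases hs : s.1 <;> simp [hs] at this <;> omega

theorem ripple_sub {k m n : ℕ} (hm : m < 2 ^ k) (hn : n < 2 ^ k) :
    (ripple subTable k m n).1 = decide (m < n) ∧
      (n ≤ m → (ripple subTable k m n).2 = m - n) := by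
  obtain ⟨h1, h2⟩ := ripple_sub_aux k false m n [] hm hn
  simp only [ripple, List.length_nil, Nat.zero_add, pow_zero, one_mul, Bool.toNat_false,
    Nat.cast_zero, sub_zero] at h1 h2 ⊢
  have h0 : ofBits [] = 0 := rfl
  rw [h0] at h1
  generalize (List.replicate k ()).foldl _ _ = s at h1 h2 ⊢
  have h3 := ofBits_lt s.2.2.2
  rw [h2] at h3
  have h3' : (ofBits s.2.2.2 : ℤ) < 2 ^ k := by exact_mod_cast h3
  cases hs : s.1 <;> simp [hs] at h1 ⊢ <;> omega

namespace PTime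

variable {α : Type} {e : α → Word}

theorem bodd {f : α → ℕ} (hf : PTime e f) : PTime e (fun a => (f a).bodd) := by
  have := PolyW.trans hf (PolyW.headBit _)
  refine PolyW.congr this fun a => ?_
  simp only [enc, Nat.bodd_eq_bits_head]
  cases (f a).bits <;> rfl

theorem div2 {f : α → ℕ} (hf : PTime e f) : PTime e (fun a => (f a).div2) := by
  have := PolyW.trans hf (PolyW.tailBits _)
  refine PolyW.congr this fun a => ?_
  simp only [enc, Nat.div2_bits_eq_tail]

theorem isZero {f : α → ℕ} (hf : PTime e f) : PTime e (fun a => decide (f a = 0)) := by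
  have := PolyW.trans hf (PolyW.isEmpty _)
  refine PolyW.congr this fun a => ?_
  have : (f a).bits.isEmpty = decide (f a = 0) := by
    rw [Bool.eq_iff_iff, List.isEmpty_iff, decide_eq_true_iff, ← List.length_eq_zero_iff,
      Nat.size_eq_bits_len, Nat.size_eq_zero]
  simp only [enc, this]

theorem bit {b : α → Bool} {f : α → ℕ} (hb : PTime e b) (hf : PTime e f) :
    PTime e (fun a => Nat.bit (b a) (f a)) := by
  have h1 := PolyW.ite (c := b) hb (PolyW.trans hf (PolyW.consBit true _))
    (PolyW.ite (c := fun a => decide (f a = 0)) hf.isZero (PolyW.const _ [])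
      (PolyW.trans hf (PolyW.consBit false _)))
  refine PolyW.congr h1 fun a => ?_
  simp only [enc, decide_eq_true_eq]
  cases hba : b a with
  | true => simp
  | false =>
    by_cases h : f a = 0
    · simp [h]
    · rw [if_neg h, Nat.bits_append_bit _ _ (fun h' => absurd h' h)]
      rfl

theorem size_bit_le (b : Bool) (n : ℕ) : (Nat.bit b n).size ≤ n.size + 1 := by
  rw [Nat.size_le, pow_succ, Nat.bit_val]
  have := Nat.lt_size_self n
  cases b <;> simp <;> omega

theorem ofBits {l : α → List Bool} (hl : PTime e l) : PTime e (fun a => ofBits (l a)) :=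
  foldl (e := e) (σ := fun _ => ℕ) (β := fun _ => Bool) (elem.bit state) (const 0) hl
    ⟨1, fun a s b _ => by simpa only [length_enc_nat, Polynomial.eval_one] using size_bit_le b s⟩

/-- The number of steps is the length of the code of the pair, as this is available to a program and
is large enough for all bits of the sum. -/
theorem ripple {F : Bool → Bool → Bool → Bool × Bool} {f g : α → ℕ} (hf : PTime e f)
    (hg : PTime e g) :
    PTime e (fun a => ripple F (enc (f a, g a)).length (f a) (g a)) := by
  suffices h : PTime (fun a => enc (f a, g a))
      (fun a => _root_.ripple F (enc (f a, g a)).length (f a) (g a)) from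
    PolyW.trans (hf.pair hg) h
  have hf : PTime (fun a => enc (f a, g a)) f := fst (f := fun a => (f a, g a)) (PolyW.refl _)
  have hg : PTime (fun a => enc (f a, g a)) g := snd (f := fun a => (f a, g a)) (PolyW.refl _)
  have h := foldl (e := fun a => enc (f a, g a)) (σ := fun _ => Bool × ℕ × ℕ × List Bool)
    (step := fun _ s _ => rippleStep F s) (l := fun a => List.replicate (enc (f a, g a)).length ())
    (i := fun a => (false, f a, g a, [])) ?_ ((const false).pair (hf.pair (hg.pair nil))) clock
    ⟨10, ?_⟩
  · exact h.fst.pair h.snd.snd.snd.ofBits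
  · have hs := state (e := fun a => enc (f a, g a)) (σ := fun _ => Bool × ℕ × ℕ × List Bool)
      (β := fun _ => Unit)
    have hF : ∀ {β : Type} [Enc β] (G : Bool × Bool → β), PTime _ _ := fun {β} _ G =>
      bool₃ (fun x y z => G (F x y z)) hs.fst hs.snd.fst.bodd hs.snd.snd.fst.bodd
    exact (hF Prod.fst).pair (hs.snd.fst.div2.pair (hs.snd.snd.fst.div2.pair
      ((hF Prod.snd).cons hs.snd.snd.snd)))
  · rintro a ⟨c, m, n, l⟩ - -
    have h1 : ∀ n : ℕ, n.div2.size ≤ n.size := fun n =>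
      Nat.size_le_size (by rw [Nat.div2_val]; omega)
    have h2 := h1 m
    have h3 := h1 n
    simp only [← length_enc_nat] at h2 h3
    simp [enc, rippleStep, length_pairW, listW] at h2 h3 ⊢
    omega

theorem lt_two_pow_enc_pair (m n : ℕ) : m < 2 ^ (enc (m, n)).length ∧
    n < 2 ^ (enc (m, n)).length ∧ m + n < 2 ^ (enc (m, n)).length := by
  have h1 := Nat.lt_size_self m
  have h2 := Nat.lt_size_self n
  have h3 : (enc (m, n)).length = m.size + m.size + 1 + n.size := by
    simp only [enc, length_pairW, ← length_enc_nat]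
    omega
  have h4 : m + n < 2 ^ (enc (m, n)).length := by
    have e1 : 2 ^ m.size ≤ 2 ^ (m.size + m.size + n.size) :=
      Nat.pow_le_pow_right (by simp) (by omega)
    have e2 : 2 ^ n.size ≤ 2 ^ (m.size + m.size + n.size) :=
      Nat.pow_le_pow_right (by simp) (by omega)
    rw [h3, show m.size + m.size + 1 + n.size = m.size + m.size + n.size + 1 by omega, pow_succ]
    omega
  omega

theorem add {f g : α → ℕ} (hf : PTime e f) (hg : PTime e g) : PTime e (fun a => f a + g a) := by
  refine PolyW.congr (hf.ripple (F := addTable) hg).snd fun a => ?_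
  obtain ⟨h1, h2, h3⟩ := lt_two_pow_enc_pair (f a) (g a)
  beta_reduce
  rw [ripple_add h1 h2 h3]

theorem lt {f g : α → ℕ} (hf : PTime e f) (hg : PTime e g) :
    PTime e (fun a => decide (f a < g a)) := by
  refine PolyW.congr (hf.ripple (F := subTable) hg).fst fun a => ?_
  obtain ⟨h1, h2, h3⟩ := lt_two_pow_enc_pair (f a) (g a)
  beta_reduce
  rw [(ripple_sub h1 h2).1]

theorem le {f g : α → ℕ} (hf : PTime e f) (hg : PTime e g) :
    PTime e (fun a => decide (f a ≤ g a)) := by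
  simpa using (hg.lt hf).not

theorem natEq {f g : α → ℕ} (hf : PTime e f) (hg : PTime e g) :
    PTime e (fun a => decide (f a = g a)) := by
  simpa only [le_antisymm_iff] using (hf.le hg).and (hg.le hf)

theorem sub {f g : α → ℕ} (hf : PTime e f) (hg : PTime e g) : PTime e (fun a => f a - g a) := by
  refine PolyW.congr ((hf.lt hg).ite' (const 0) (hf.ripple (F := subTable) hg).snd) fun a => ?_
  obtain ⟨h1, h2, h3⟩ := lt_two_pow_enc_pair (f a) (g a)
  beta_reduce
  split_ifs with h
  · rw [Nat.sub_eq_zero_of_le h.le]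
  · rw [(ripple_sub h1 h2).2 (not_lt.1 h)]

end PTime

/-- The bits of a number, the most significant one first. -/
def revBits (n : ℕ) : List Bool := n.bits.reverse

theorem ofBits_revBits (n : ℕ) : ofBits (revBits n) = n := by
  rw [ofBits, revBits, List.foldl_reverse]
  induction n using Nat.binaryRec' with
  | zero => simp
  | bit b n h ih => rw [Nat.bits_append_bit _ _ h, List.foldr_cons, ih]

namespace PTime

variable {α : Type} {e : α → Word}

theorem revBits {f : α → ℕ} (hf : PTime e f) : PTime e (fun a => revBits (f a)) := by
  suffices h : PTime (fun a => enc (f a)) (fun a => _root_.revBits (f a)) from PolyW.trans hf h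
  have hf : PTime (fun a => enc (f a)) f := PolyW.refl _
  have h := foldl (e := fun a => enc (f a)) (σ := fun _ => ℕ × List Bool)
    (step := fun _ s _ => (s.1.div2, s.1.bodd :: s.2))
    (l := fun a => List.replicate (enc (f a)).length ())
    (i := fun a => (f a, [])) ?_ (hf.pair nil) clock ⟨10, ?_⟩
  · refine PolyW.congr h.snd fun a => ?_
    have h1 : ∀ (n : ℕ) (l : List Bool),
        ((List.replicate n.bits.length ()).foldl
          (fun (s : ℕ × List Bool) _ => (s.1.div2, s.1.bodd :: s.2)) (n, l)).2 =
          n.bits.reverse ++ l := by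
      intro n
      induction n using Nat.binaryRec' with
      | zero => simp
      | bit b n h ih => simp [Nat.bits_append_bit _ _ h, List.replicate_succ, ih, Nat.div2_bit]
    exact congrArg enc ((h1 (f a) []).trans (List.append_nil _))
  · have hs := state (e := fun a => enc (f a)) (σ := fun _ => ℕ × List Bool)
      (β := fun _ => Unit)
    exact hs.fst.div2.pair (hs.fst.bodd.cons hs.snd)
  · rintro a ⟨n, l⟩ - -
    have h1 : n.div2.size ≤ n.size := Nat.size_le_size (by rw [Nat.div2_val]; omega)
    simp only [← length_enc_nat] at h1
    simp [enc, length_pairW, listW] at h1 ⊢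
    omega

/-- Products are computed by doubling and adding, from the most significant bit on. -/
theorem mul {f g : α → ℕ} (hf : PTime e f) (hg : PTime e g) : PTime e (fun a => f a * g a) := by
  obtain ⟨q, hq⟩ := PolyW.exists_length_le hg
  have h := foldl (e := e) (σ := fun _ => ℕ)
    (step := fun a s b => Nat.bit false s + if b then g a else 0)
    (l := fun a => _root_.revBits (f a)) (i := fun _ => 0) ?_ (const 0) hf.revBits ⟨q + 3, ?_⟩
  · refine PolyW.congr h fun a => ?_
    have h1 : ∀ (l : List Bool) (n : ℕ),
        l.foldl (fun s b => Nat.bit false s + if b then g a else 0) (n * g a) =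
        l.foldl (fun n b => Nat.bit b n) n * g a := by
      intro l
      induction l with
      | nil => simp
      | cons b l ih =>
        intro n
        rw [List.foldl_cons, List.foldl_cons, ← ih]
        congr 1
        cases b <;> simp [Nat.bit_val] <;> ring
    have h2 := h1 (_root_.revBits (f a)) 0
    rw [zero_mul] at h2
    have h3 := ofBits_revBits (f a)
    rw [_root_.ofBits] at h3
    beta_reduce
    rw [h2, h3]
  · exact ((const false).bit state).add (elem.ite hg.ctx (const 0))
  · intro a s b _
    have h1 := hq a
    simp only [length_enc_nat, Polynomial.eval_add, Polynomial.eval_ofNat] at h1 ⊢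
    have h2 : (Nat.bit false s + if b then g a else 0).size ≤ s.size + 1 + (g a).size + 1 := by
      rw [Nat.size_le]
      have e1 := Nat.lt_size_self s
      have e2 := Nat.lt_size_self (g a)
      have e3 : 2 ^ (s.size + 1) ≤ 2 ^ (s.size + 1 + (g a).size) :=
        Nat.pow_le_pow_right (by simp) (by omega)
      have e4 : 2 ^ (g a).size ≤ 2 ^ (s.size + 1 + (g a).size) :=
        Nat.pow_le_pow_right (by simp) (by omega)
      rw [pow_succ] at e3
      rw [pow_succ, Nat.bit_val]
      cases b <;> simp <;> omega
    omega

/-- Remainders are computed by long division, from the most significant bit on. -/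
theorem mod {f g : α → ℕ} (hf : PTime e f) (hg : PTime e g) : PTime e (fun a => f a % g a) := by
  have h := foldl (e := e) (σ := fun _ => ℕ)
    (step := fun a s b => if Nat.bit b s < g a then Nat.bit b s else Nat.bit b s - g a)
    (l := fun a => _root_.revBits (f a)) (i := fun _ => 0) ?_ (const 0) hf.revBits ⟨1, ?_⟩
  · refine PolyW.congr h fun a => ?_
    have h1 : ∀ (l : List Bool) (n : ℕ),
        l.foldl (fun s b => if Nat.bit b s < g a then Nat.bit b s else Nat.bit b s - g a)
          (n % g a) = l.foldl (fun n b => Nat.bit b n) n % g a := by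
      intro l
      induction l with
      | nil => simp
      | cons b l ih =>
        intro n
        rw [List.foldl_cons, List.foldl_cons, ← ih]
        congr 1
        rcases Nat.eq_zero_or_pos (g a) with h0 | h0
        · simp [h0]
        · have e1 := Nat.mod_lt n h0
          have e2 : Nat.bit b n % g a = Nat.bit b (n % g a) % g a := by
            simp only [Nat.bit_val]
            rw [Nat.add_mod, Nat.mul_mod]
            conv_rhs => rw [Nat.add_mod, Nat.mul_mod, Nat.mod_mod]
          rw [e2]
          split_ifs with h
          · exact (Nat.mod_eq_of_lt h).symm
          · rw [not_lt] at h
            have h4 : Nat.bit b (n % g a) - g a < g a := by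
              rw [Nat.bit_val] at h ⊢
              generalize n % g a = r at *
              cases b <;> simp only [Bool.toNat_true, Bool.toNat_false] at h ⊢ <;> omega
            rw [Nat.mod_eq_sub_mod h, Nat.mod_eq_of_lt h4]
    have h2 := h1 (_root_.revBits (f a)) 0
    rw [Nat.zero_mod] at h2
    have h3 := ofBits_revBits (f a)
    rw [_root_.ofBits] at h3
    beta_reduce
    rw [h2, h3]
  · exact ((elem.bit state).lt hg.ctx).ite' (elem.bit state) ((elem.bit state).sub hg.ctx)
  · intro a s b _
    have h1 := size_bit_le b s
    have h2 : (if Nat.bit b s < g a then Nat.bit b s else Nat.bit b s - g a).size ≤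
        (Nat.bit b s).size := Nat.size_le_size (by split_ifs <;> omega)
    simp only [length_enc_nat, Polynomial.eval_one]
    omega

end PTime

/-! ### Arithmetic modulo a prime and two-by-two matrices -/

instance (p : ℕ) : Enc (Matrix (Fin 2) (Fin 2) (ZMod p)) :=
  ⟨fun M => enc (M 0 0, M 0 1, M 1 0, M 1 1)⟩

instance (p : ℕ) : Enc (Matrix.GeneralLinearGroup (Fin 2) (ZMod p)) := ⟨fun g => enc g.val⟩

/-- A matrix as an element of the general linear group, with the junk value `1` if it is not
invertible. -/
def Matrix.toGL {F : Type*} [Field F] [DecidableEq F] (M : Matrix (Fin 2) (Fin 2) F) :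
    Matrix.GeneralLinearGroup (Fin 2) F :=
  if h : M.det ≠ 0 then Matrix.GeneralLinearGroup.mkOfDetNeZero M h else 1

theorem Matrix.val_toGL {F : Type*} [Field F] [DecidableEq F] {M : Matrix (Fin 2) (Fin 2) F}
    (h : M.det ≠ 0) : M.toGL.val = M := by
  rw [Matrix.toGL, dif_pos h]
  rfl

namespace PTime

variable {α : Type} {e : α → Word} {p : α → ℕ}

section ring

theorem val {f : ∀ a, ZMod (p a)} (hf : PTime e f) : PTime e (fun a => (f a).val) := hf

variable {M N : ∀ a, Matrix (Fin 2) (Fin 2) (ZMod (p a))}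

theorem m00 (hM : PTime e M) : PTime e (fun a => M a 0 0) :=
  fst (f := fun a => (M a 0 0, M a 0 1, M a 1 0, M a 1 1)) hM

theorem m01 (hM : PTime e M) : PTime e (fun a => M a 0 1) :=
  (snd (f := fun a => (M a 0 0, M a 0 1, M a 1 0, M a 1 1)) hM).fst

theorem m10 (hM : PTime e M) : PTime e (fun a => M a 1 0) :=
  (snd (f := fun a => (M a 0 0, M a 0 1, M a 1 0, M a 1 1)) hM).snd.fst

theorem m11 (hM : PTime e M) : PTime e (fun a => M a 1 1) :=
  (snd (f := fun a => (M a 0 0, M a 0 1, M a 1 0, M a 1 1)) hM).snd.snd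

theorem mk {f g h k : ∀ a, ZMod (p a)} (hf : PTime e f) (hg : PTime e g) (hh : PTime e h)
    (hk : PTime e k) : PTime e (fun a => !![f a, g a; h a, k a]) :=
  hf.pair (hg.pair (hh.pair hk))

theorem natCast (hp : PTime e p) {n : α → ℕ} (hn : PTime e n) :
    PTime e (β := fun a => ZMod (p a)) (fun a => (n a : ZMod (p a))) := by
  refine PolyW.congr (hn.mod hp) fun a => ?_
  beta_reduce
  rw [← ZMod.val_natCast]
  rfl

theorem natLit (hp : PTime e p) (n : ℕ) :
    PTime e (β := fun a => ZMod (p a)) (fun a => (n : ZMod (p a))) := natCast hp (const n)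

theorem zero (hp : PTime e p) : PTime e (β := fun a => ZMod (p a)) (fun _ => 0) := by
  simpa using natLit hp 0

theorem one (hp : PTime e p) : PTime e (β := fun a => ZMod (p a)) (fun _ => 1) := by
  simpa using natLit hp 1

theorem two (hp : PTime e p) : PTime e (β := fun a => ZMod (p a)) (fun _ => 2) := by
  simpa using natLit hp 2

theorem mone (hp : PTime e p) :
    PTime e (β := fun a => Matrix (Fin 2) (Fin 2) (ZMod (p a))) (fun _ => 1) := by
  simpa [← Matrix.one_fin_two] using mk hp.one hp.zero hp.zero hp.one

variable [∀ a, NeZero (p a)]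

theorem zadd (hp : PTime e p) {f g : ∀ a, ZMod (p a)} (hf : PTime e f) (hg : PTime e g) :
    PTime e (fun a => f a + g a) := by
  simpa using natCast hp (hf.val.add hg.val)

theorem zmul (hp : PTime e p) {f g : ∀ a, ZMod (p a)} (hf : PTime e f) (hg : PTime e g) :
    PTime e (fun a => f a * g a) := by
  simpa using natCast hp (hf.val.mul hg.val)

theorem zneg (hp : PTime e p) {f : ∀ a, ZMod (p a)} (hf : PTime e f) :
    PTime e (fun a => -f a) := by
  have h := natCast hp (hp.sub hf.val)
  simpa [Nat.cast_sub (ZMod.val_lt _).le] using h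

theorem zsub (hp : PTime e p) {f g : ∀ a, ZMod (p a)} (hf : PTime e f) (hg : PTime e g) :
    PTime e (fun a => f a - g a) := by
  simpa [sub_eq_add_neg] using hp.zadd hf (hp.zneg hg)

theorem zeq {f g : ∀ a, ZMod (p a)} (hf : PTime e f) (hg : PTime e g) :
    PTime e (fun a => decide (f a = g a)) := by
  simpa [(ZMod.val_injective _).eq_iff] using hf.val.natEq hg.val

theorem mmul (hp : PTime e p) (hM : PTime e M) (hN : PTime e N) :
    PTime e (fun a => M a * N a) := by
  have := mk (hp.zadd (hp.zmul hM.m00 hN.m00) (hp.zmul hM.m01 hN.m10))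
    (hp.zadd (hp.zmul hM.m00 hN.m01) (hp.zmul hM.m01 hN.m11))
    (hp.zadd (hp.zmul hM.m10 hN.m00) (hp.zmul hM.m11 hN.m10))
    (hp.zadd (hp.zmul hM.m10 hN.m01) (hp.zmul hM.m11 hN.m11))
  refine PolyW.congr this fun a => ?_
  beta_reduce
  rw [(M a).eta_fin_two, (N a).eta_fin_two, Matrix.mul_fin_two]
  simp

theorem mdet (hp : PTime e p) (hM : PTime e M) : PTime e (fun a => (M a).det) := by
  simpa only [Matrix.det_fin_two] using hp.zsub (hp.zmul hM.m00 hM.m11) (hp.zmul hM.m01 hM.m10)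

theorem mtrace (hp : PTime e p) (hM : PTime e M) : PTime e (fun a => (M a).trace) := by
  simpa only [Matrix.trace_fin_two] using hp.zadd hM.m00 hM.m11

/-- All residues modulo `p` have codes of polynomial length. -/
theorem exists_length_zmod_le (hp : PTime e p) :
    ∃ K : Polynomial ℕ, ∀ a (x : ZMod (p a)), (enc x).length ≤ K.eval (e a).length := by
  obtain ⟨K, hK⟩ := PolyW.exists_length_le hp
  refine ⟨K, fun a x => le_trans ?_ (hK a)⟩
  change (enc x.val).length ≤ _
  rw [length_enc_nat, length_enc_nat]
  exact Nat.size_le_size (ZMod.val_lt x).le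

theorem exists_length_matrix_le (hp : PTime e p) :
    ∃ K : Polynomial ℕ, ∀ a (x : Matrix (Fin 2) (Fin 2) (ZMod (p a))),
      (enc x).length ≤ K.eval (e a).length := by
  obtain ⟨K, hK⟩ := exists_length_zmod_le hp
  refine ⟨7 * K + 3, fun a M => ?_⟩
  have h1 := hK a (M 0 0)
  have h2 := hK a (M 0 1)
  have h3 := hK a (M 1 0)
  have h4 := hK a (M 1 1)
  have h5 : (enc M).length = 2 * (enc (M 0 0)).length + 1 + (2 * (enc (M 0 1)).length + 1 +
      (2 * (enc (M 1 0)).length + 1 + (enc (M 1 1)).length)) := by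
    change (enc (M 0 0, M 0 1, M 1 0, M 1 1)).length = _
    simp only [enc, length_pairW]
  simp only [Polynomial.eval_add, Polynomial.eval_mul, Polynomial.eval_ofNat]
  omega

/-- Powers are computed by repeated squaring. -/
theorem mpow (hp : PTime e p) (hM : PTime e M) {n : α → ℕ} (hn : PTime e n) :
    PTime e (fun a => M a ^ n a) := by
  have h := foldl_bdd (e := e) (σ := fun a => Matrix (Fin 2) (Fin 2) (ZMod (p a)))
    (step := fun a s b => s * s * if b then M a else 1)
    (l := fun a => _root_.revBits (n a)) (i := fun _ => 1) ?_ hp.mone hn.revBits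
    (exists_length_matrix_le hp)
  · refine PolyW.congr h fun a => ?_
    have h1 : ∀ (l : List Bool) (n : ℕ),
        l.foldl (fun s b => s * s * if b then M a else 1) (M a ^ n) =
          M a ^ l.foldl (fun n b => Nat.bit b n) n := by
      intro l
      induction l with
      | nil => simp
      | cons b l ih =>
        intro n
        rw [List.foldl_cons, List.foldl_cons, ← ih]
        congr 1
        cases b <;> simp [Nat.bit_val, pow_succ, two_mul, pow_add]
    have h2 := h1 (_root_.revBits (n a)) 0
    rw [pow_zero] at h2
    have h3 := ofBits_revBits (n a)
    rw [_root_.ofBits] at h3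
    beta_reduce
    rw [h2, h3]
  · exact hp.ctx.mmul (hp.ctx.mmul state state) (elem.ite hM.ctxD hp.ctx.mone)

/-- Powers in the field are entries of powers of diagonal matrices. -/
theorem zpow (hp : PTime e p) {f : ∀ a, ZMod (p a)} (hf : PTime e f) {n : α → ℕ}
    (hn : PTime e n) : PTime e (fun a => f a ^ n a) := by
  have h := (hp.mpow (mk hf hp.zero hp.zero hp.one) hn).m00
  have h1 : ∀ a, (!![f a, 0; 0, 1] ^ n a) 0 0 = f a ^ n a := fun a => by
    have : !![f a, 0; 0, 1] = Matrix.diagonal ![f a, 1] := by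
      ext i j; fin_cases i <;> fin_cases j <;> rfl
    rw [this, Matrix.diagonal_pow, Matrix.diagonal_apply_eq]
    simp
  simpa only [h1] using h

end ring

theorem gval {g : ∀ a, Matrix.GeneralLinearGroup (Fin 2) (ZMod (p a))} (hg : PTime e g) :
    PTime e (fun a => (g a).val) := hg

section field

variable [∀ a, Fact (p a).Prime]

/-- Inverses are computed as `(p - 2)`-th powers. -/
theorem zinv (hp : PTime e p) {f : ∀ a, ZMod (p a)} (hf : PTime e f) :
    PTime e (fun a => (f a)⁻¹) := by
  have h := (hf.zeq hp.zero).ite' hp.zero (hp.zpow hf (hp.sub (const 2)))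
  refine PolyW.congr h fun a => ?_
  beta_reduce
  split_ifs with h0
  · rw [h0, inv_zero]
  · congr 1
    refine eq_inv_of_mul_eq_one_left ?_
    have h2 := (Fact.out : (p a).Prime).two_le
    rw [← pow_succ, show p a - 2 + 1 = p a - 1 by omega, ZMod.pow_card_sub_one_eq_one h0]

theorem zdiv (hp : PTime e p) {f g : ∀ a, ZMod (p a)} (hf : PTime e f) (hg : PTime e g) :
    PTime e (fun a => f a / g a) := by
  simpa only [div_eq_mul_inv] using hp.zmul hf (hp.zinv hg)

variable {g h : ∀ a, Matrix.GeneralLinearGroup (Fin 2) (ZMod (p a))}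

theorem toGL (hp : PTime e p) {M : ∀ a, Matrix (Fin 2) (Fin 2) (ZMod (p a))} (hM : PTime e M) :
    PTime e (fun a => (M a).toGL) := by
  have h := ((hp.mdet hM).zeq hp.zero).ite' hp.mone hM
  refine PolyW.congr h fun a => ?_
  beta_reduce
  rw [Matrix.toGL]
  by_cases h0 : (M a).det = 0
  · rw [if_pos h0, dif_neg (not_not.2 h0)]
    rfl
  · rw [if_neg h0, dif_pos h0]
    rfl

theorem gone (hp : PTime e p) :
    PTime e (β := fun a => Matrix.GeneralLinearGroup (Fin 2) (ZMod (p a))) (fun _ => 1) :=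
  hp.mone

theorem gmul (hp : PTime e p) (hg : PTime e g) (hh : PTime e h) :
    PTime e (fun a => g a * h a) := hp.mmul hg.gval hh.gval

theorem ginv (hp : PTime e p) (hg : PTime e g) : PTime e (fun a => (g a)⁻¹) := by
  have hd := hp.mdet hg.gval
  have h := mk (hp.zdiv hg.gval.m11 hd) (hp.zdiv (hp.zneg hg.gval.m01) hd)
    (hp.zdiv (hp.zneg hg.gval.m10) hd) (hp.zdiv hg.gval.m00 hd)
  refine PolyW.congr h fun a => ?_
  change enc _ = enc (g a)⁻¹.val
  rw [Matrix.coe_units_inv, Matrix.inv_def, Matrix.adjugate_fin_two, Ring.inverse_eq_inv']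
  congr 1
  ext i j
  fin_cases i <;> fin_cases j <;> simp [div_eq_inv_mul]

theorem geq (hg : PTime e g) (hh : PTime e h) : PTime e (fun a => decide (g a = h a)) := by
  have h1 := (hg.gval.m00.zeq hh.gval.m00).and ((hg.gval.m01.zeq hh.gval.m01).and
    ((hg.gval.m10.zeq hh.gval.m10).and (hg.gval.m11.zeq hh.gval.m11)))
  refine PolyW.congr h1 fun a => ?_
  beta_reduce
  refine congrArg enc (decide_eq_decide.2 ?_)
  rw [Units.ext_iff, (g a).val.eta_fin_two, (h a).val.eta_fin_two]
  simp [and_assoc]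

theorem exists_length_gl_le (hp : PTime e p) :
    ∃ K : Polynomial ℕ, ∀ a (x : Matrix.GeneralLinearGroup (Fin 2) (ZMod (p a))),
      (enc x).length ≤ K.eval (e a).length :=
  let ⟨K, hK⟩ := exists_length_matrix_le hp
  ⟨K, fun a x => hK a x.val⟩

end field

end PTime

/-! ### Searching in lists -/

namespace PTime

variable {α : Type} {e : α → Word} {β : α → Type} [∀ a, Enc (β a)]

theorem of_eq {f g : ∀ a, β a} (hf : PTime e f) (h : ∀ a, f a = g a) : PTime e g :=
  (funext h : f = g) ▸ hf

theorem any {F : ∀ a, β a → Bool} {l : ∀ a, List (β a)}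
    (hF : PTime (stepCtx e (fun _ => Bool) β) (fun x => F x.1 x.2.2)) (hl : PTime e l) :
    PTime e (fun a => (l a).any (F a)) := by
  have h := foldr (e := e) (σ := fun _ => Bool) (step := fun a b s => F a b || s)
    (i := fun _ => false) (l := l) (bool₂ (fun x y => x || y) hF state) (const false) hl
    ⟨1, fun a s b _ => by simp [enc]⟩
  refine h.of_eq fun a => ?_
  induction l a with
  | nil => rfl
  | cons b l ih => rw [List.foldr_cons, ih, List.any_cons]

theorem find? {F : ∀ a, β a → Bool} {l : ∀ a, List (β a)}
    (hF : PTime (stepCtx e (fun a => Option (β a)) β) (fun x => F x.1 x.2.2)) (hl : PTime e l) :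
    PTime e (fun a => (l a).find? (F a)) := by
  obtain ⟨q, hq⟩ := PolyW.exists_length_le hl
  have h := foldr (e := e) (σ := fun a => Option (β a))
    (step := fun a b s => if F a b then some b else s)
    (i := fun _ => none) (l := l) (hF.ite elem.some' state) none' hl
    ⟨q + 1, fun a s b hb => ?_⟩
  · refine h.of_eq fun a => ?_
    induction l a with
    | nil => rfl
    | cons b l ih =>
      rw [List.foldr_cons, ih, List.find?_cons]
      cases F a b <;> rfl
  · have h1 := ((PolyW.length_le_listW enc (l a)).2 b hb).trans (hq a)
    simp only [Polynomial.eval_add, Polynomial.eval_one]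
    split_ifs
    · simp only [enc, Option.elim_some, List.length_cons]
      have : (enc b).length ≤ q.eval (e a).length := h1
      omega
    · omega

theorem filter {F : ∀ a, β a → Bool} {l : ∀ a, List (β a)}
    (hF : PTime (stepCtx e (fun a => List (β a)) β) (fun x => F x.1 x.2.2)) (hl : PTime e l) :
    PTime e (fun a => (l a).filter (F a)) := by
  obtain ⟨q, hq⟩ := PolyW.exists_length_le hl
  have h := foldr (e := e) (σ := fun a => List (β a))
    (step := fun a b s => if F a b then b :: s else s)
    (i := fun _ => []) (l := l) (hF.ite (elem.cons state) state) nil hl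
    ⟨2 * q + 1, fun a s b hb => ?_⟩
  · refine h.of_eq fun a => ?_
    induction l a with
    | nil => rfl
    | cons b l ih =>
      rw [List.foldr_cons, ih, List.filter_cons]
  · have h1 : (enc b).length ≤ q.eval (e a).length :=
      ((PolyW.length_le_listW enc (l a)).2 b hb).trans (hq a)
    simp only [Polynomial.eval_add, Polynomial.eval_one, Polynomial.eval_mul, Polynomial.eval_ofNat]
    split_ifs
    · simp only [enc, List.map_cons, listW, length_pairW] at h1 ⊢
      omega
    · omega

end PTime

/-! ### Spherical equations with a right-hand side -/

/-- The product of the conjugates `zᵢ⁻¹ cᵢ zᵢ`. -/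
def conjProd {G : Type*} [Group G] (c z : List G) : G :=
  (List.zipWith (fun ci zi => zi⁻¹ * ci * zi) c z).prod

/-- `z` solves the spherical equation with constants `c` and right-hand side `h`. -/
def SolvesTo {G : Type*} [Group G] (c z : List G) (h : G) : Prop :=
  z.length = c.length ∧ conjProd c z = h

section

variable {G : Type*} [Group G]

theorem solvesTo_nil {z : List G} {h : G} : SolvesTo [] z h ↔ z = [] ∧ h = 1 := by
  constructor
  · rintro ⟨h1, h2⟩
    rw [List.length_nil, List.length_eq_zero_iff] at h1
    subst h1
    exact ⟨rfl, h2.symm⟩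
  · rintro ⟨rfl, rfl⟩
    exact ⟨rfl, rfl⟩

theorem solvesTo_cons {c : G} {C z : List G} {h : G} :
    SolvesTo (c :: C) z h ↔ ∃ y z', z = y :: z' ∧ SolvesTo C z' ((y⁻¹ * c * y)⁻¹ * h) := by
  constructor
  · rintro ⟨h1, h2⟩
    cases z with
    | nil => simp at h1
    | cons y z' =>
      refine ⟨y, z', rfl, by simpa using h1, ?_⟩
      rw [← h2]
      simp [conjProd, mul_assoc]
  · rintro ⟨y, z', rfl, h1, h2⟩
    refine ⟨by simpa using h1, ?_⟩
    rw [conjProd] at h2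
    rw [conjProd, List.zipWith_cons_cons, List.prod_cons, h2, mul_inv_cancel_left]

end

/-! ### Exhaustive search in a finite group -/

section

variable {G : Type*} [Group G] [DecidableEq G]

/-- The elements of `L` that are a conjugate of `c` by an element of `L` times an element of `R`.
Filtering `L` keeps the result short. -/
def reachStep (L : List G) (c : G) (R : List G) : List G :=
  L.filter fun g => L.any fun z => R.any fun r => decide (z⁻¹ * c * z * r = g)

/-- The products of conjugates of the members of a list, where `L` enumerates the group. -/
def reach (L : List G) (C : List G) : List G := C.foldr (reachStep L) [1]

/-- The first `z` in `L` such that `h` is the conjugate of `c` by `z` times an element of `R`, with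
the junk value `1` if there is none. -/
def pickOne (L : List G) (c : G) (R : List G) (h : G) : G :=
  (L.find? fun z => R.any fun r => decide (z⁻¹ * c * z * r = h)).getD 1

/-- A solution of the spherical equation with right-hand side `h`, found by exhaustive search. -/
def pick (L : List G) : List G → G → List G
  | [], _ => []
  | c :: C, h =>
    let z := pickOne L c (reach L C) h
    z :: pick L C ((z⁻¹ * c * z)⁻¹ * h)

theorem mem_reachStep {L : List G} (hL : ∀ g, g ∈ L) {c : G} {R : List G} {g : G} :
    g ∈ reachStep L c R ↔ ∃ z, ∃ r ∈ R, z⁻¹ * c * z * r = g := by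
  simp [reachStep, hL]

theorem mem_reach_of_solvesTo {L : List G} (hL : ∀ g, g ∈ L) {C z : List G} {h : G}
    (hz : SolvesTo C z h) : h ∈ reach L C := by
  induction C generalizing z h with
  | nil =>
    rw [(solvesTo_nil.1 hz).2]
    simp [reach]
  | cons c C ih =>
    obtain ⟨y, z', rfl, hz'⟩ := solvesTo_cons.1 hz
    rw [reach, List.foldr_cons, mem_reachStep hL]
    exact ⟨y, _, ih hz', mul_inv_cancel_left _ _⟩

theorem solvesTo_pick {L : List G} (hL : ∀ g, g ∈ L) {C : List G} {h : G}
    (hh : h ∈ reach L C) : SolvesTo C (pick L C h) h := by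
  induction C generalizing h with
  | nil =>
    rw [reach, List.foldr_nil, List.mem_singleton] at hh
    exact solvesTo_nil.2 ⟨rfl, hh⟩
  | cons c C ih =>
    refine solvesTo_cons.2 ⟨_, _, rfl, ih ?_⟩
    rw [reach, List.foldr_cons, mem_reachStep hL] at hh
    obtain ⟨z, r, hr, hz⟩ := hh
    obtain ⟨y, hy⟩ : ∃ y, L.find? (fun z => (reach L C).any fun r =>
        decide (z⁻¹ * c * z * r = h)) = some y := by
      rw [← Option.isSome_iff_exists, List.find?_isSome]
      exact ⟨z, hL z, List.any_eq_true.2 ⟨r, hr, decide_eq_true hz⟩⟩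
    have h1 := List.find?_some hy
    obtain ⟨r', hr', hy'⟩ := List.any_eq_true.1 h1
    rw [decide_eq_true_iff] at hy'
    rw [pickOne, hy, Option.getD_some, ← hy', inv_mul_cancel_left]
    exact hr'

/-- The constants together with the elements that are reachable by the constants after them, and the
elements reachable by all constants. -/
def reachTable (L : List G) (C : List G) : List (G × List G) × List G :=
  C.foldr (fun c s => ((c, s.2) :: s.1, reachStep L c s.2)) ([], [1])

theorem reachTable_snd (L C : List G) : (reachTable L C).2 = reach L C := by
  induction C with
  | nil => rfl
  | cons c C ih => simp only [reachTable, reach, List.foldr_cons] at ih ⊢; rw [ih]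

/-- One step of the search: the remaining right-hand side and the conjugators found so far. -/
def pickStep (L : List G) (s : G × List G) (x : G × List G) : G × List G :=
  let z := pickOne L x.1 x.2 s.1
  ((z⁻¹ * x.1 * z)⁻¹ * s.1, z :: s.2)

theorem pick_eq_foldl (L C : List G) (h : G) (out : List G) :
    ((reachTable L C).1.foldl (pickStep L) (h, out)).2.reverse = out.reverse ++ pick L C h := by
  induction C generalizing h out with
  | nil => simp [reachTable, pick]
  | cons c C ih =>
    have h1 : (reachTable L (c :: C)).1 = (c, reach L C) :: (reachTable L C).1 := by
      rw [← reachTable_snd]; rfl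
    rw [h1, List.foldl_cons, pickStep, ih, pick]
    simp

end

/-- Candidates for all elements of `GL₂(p)` when `p ≤ 3`. -/
def smallGL (p : ℕ) [Fact p.Prime] : List (Matrix.GeneralLinearGroup (Fin 2) (ZMod p)) :=
  (((List.range 3).product (List.range 3)).product
    ((List.range 3).product (List.range 3))).map fun q =>
      (!![(q.1.1 : ZMod p), (q.1.2 : ZMod p); (q.2.1 : ZMod p), (q.2.2 : ZMod p)]).toGL

theorem mem_smallGL {p : ℕ} [Fact p.Prime] (hp : p ≤ 3)
    (g : Matrix.GeneralLinearGroup (Fin 2) (ZMod p)) : g ∈ smallGL p := by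
  have h1 : ∀ x : ZMod p, x.val ∈ List.range 3 := fun x =>
    List.mem_range.2 ((ZMod.val_lt x).trans_le hp)
  refine List.mem_map.2 ⟨(((g.val 0 0).val, (g.val 0 1).val), (g.val 1 0).val, (g.val 1 1).val),
    ?_, ?_⟩
  · simp only [List.product, List.mem_flatMap, List.mem_map, Prod.mk.injEq]
    exact ⟨_, ⟨_, h1 _, _, h1 _, rfl⟩, _, ⟨_, h1 _, _, h1 _, rfl⟩, rfl, rfl⟩
  · simp only [ZMod.natCast_zmod_val]
    rw [← Matrix.eta_fin_two]
    exact Units.ext (Matrix.val_toGL g.det.ne_zero)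

namespace PTime

variable {α : Type} {e : α → Word} {p : α → ℕ} [∀ a, Fact (p a).Prime]

theorem smallGL (hp : PTime e p) : PTime e (fun a => smallGL (p a)) := by
  obtain ⟨K, hK⟩ := exists_length_gl_le hp
  have hx := elem (e := e) (β := fun _ => (ℕ × ℕ) × (ℕ × ℕ))
    (σ := fun a => List (Matrix.GeneralLinearGroup (Fin 2) (ZMod (p a))))
  exact map (hp.ctx.toGL (mk (hp.ctx.natCast hx.fst.fst) (hp.ctx.natCast hx.fst.snd)
    (hp.ctx.natCast hx.snd.fst) (hp.ctx.natCast hx.snd.snd))) (const _) ⟨K, fun a _ _ => hK a _⟩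

variable {c z h : ∀ a, Matrix.GeneralLinearGroup (Fin 2) (ZMod (p a))}
  {L R C : ∀ a, List (Matrix.GeneralLinearGroup (Fin 2) (ZMod (p a)))}

theorem conjBy (hp : PTime e p) (hc : PTime e c) (hz : PTime e z) :
    PTime e (fun a => (z a)⁻¹ * c a * z a) := hp.gmul (hp.gmul (hp.ginv hz) hc) hz

theorem reachStep (hp : PTime e p) (hL : PTime e L) (hc : PTime e c) (hR : PTime e R) :
    PTime e (fun a => reachStep (L a) (c a) (R a)) :=
  filter (any (any (geq (hp.ctx.ctx.ctx.gmul (hp.ctx.ctx.ctx.conjBy hc.ctxD.ctxD.ctxD elem.ctxD)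
    elem) elem.ctxD.ctxD) hR.ctxD.ctxD) hL.ctxD) hL

theorem pickOne (hp : PTime e p) (hL : PTime e L) (hc : PTime e c) (hR : PTime e R)
    (hh : PTime e h) : PTime e (fun a => pickOne (L a) (c a) (R a) (h a)) :=
  (find? (any (geq (hp.ctx.ctx.gmul (hp.ctx.ctx.conjBy hc.ctxD.ctxD elem.ctxD)
    elem) hh.ctxD.ctxD) hR.ctxD) hL).getD hp.gone

theorem exists_length_reachStep_le (hL : PTime e L) :
    ∃ K : Polynomial ℕ, ∀ a c R,
      (enc (_root_.reachStep (L a) c R)).length ≤ K.eval (e a).length := by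
  obtain ⟨q, hq⟩ := PolyW.exists_length_le hL
  refine ⟨q, fun a c R => le_trans ?_ (hq a)⟩
  have h1 : ∀ {l l' : List (Matrix.GeneralLinearGroup (Fin 2) (ZMod (p a)))}, l.Sublist l' →
      (enc l).length ≤ (enc l').length := by
    intro l l' h
    induction h with
    | slnil => exact le_rfl
    | cons b _ ih => simp only [enc, List.map_cons, listW, length_pairW] at ih ⊢; omega
    | cons_cons b _ ih => simp only [enc, List.map_cons, listW, length_pairW] at ih ⊢; omega
  exact h1 List.filter_sublist

theorem reachTable (hp : PTime e p) (hL : PTime e L) (hC : PTime e C) :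
    PTime e (fun a => reachTable (L a) (C a)) := by
  obtain ⟨K, hK⟩ := exists_length_reachStep_le hL
  obtain ⟨K', hK'⟩ := exists_length_gl_le hp
  refine foldr_of_invariant (e := e)
    (step := fun a c s => ((c, s.2) :: s.1, _root_.reachStep (L a) c s.2)) (i := fun _ => ([], [1]))
    (((elem.pair state.snd).cons state.fst).pair (hp.ctx.reachStep hL.ctxD elem state.snd))
    (nil.pair (hp.gone.cons nil)) hC
    (fun a s => (enc s.2).length ≤ (2 * K' + 1 + K).eval (e a).length) ?_ ?_
    ⟨8 * K' + 6 + 4 * (2 * K' + 1 + K) + K, ?_⟩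
  · intro a
    have := hK' a 1
    simp only [enc, List.map_cons, List.map_nil, listW, length_pairW, Polynomial.eval_add,
      Polynomial.eval_mul, Polynomial.eval_ofNat, Polynomial.eval_one, List.length_nil] at this ⊢
    omega
  · intro a s _ c _
    have := hK a c s.2
    simp only [Polynomial.eval_add] at this ⊢
    omega
  · rintro a ⟨T, R⟩ hs c -
    have h1 := hK a c R
    have h2 := hK' a c
    simp only [enc, List.map_cons, listW, length_pairW, Polynomial.eval_add,
      Polynomial.eval_mul, Polynomial.eval_ofNat, Polynomial.eval_one] at hs h1 h2 ⊢
    omega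

theorem reach (hp : PTime e p) (hL : PTime e L) (hC : PTime e C) :
    PTime e (fun a => reach (L a) (C a)) := by
  simpa only [reachTable_snd] using (hp.reachTable hL hC).snd

variable {s x : ∀ a, Matrix.GeneralLinearGroup (Fin 2) (ZMod (p a)) ×
  List (Matrix.GeneralLinearGroup (Fin 2) (ZMod (p a)))}

theorem pickStep (hp : PTime e p) (hL : PTime e L) (hs : PTime e s) (hx : PTime e x) :
    PTime e (fun a => pickStep (L a) (s a) (x a)) := by
  have hz := hp.pickOne hL hx.fst hx.snd hs.fst
  exact (hp.gmul (hp.ginv (hp.conjBy hx.fst hz)) hs.fst).pair (hz.cons hs.snd)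

theorem pick (hp : PTime e p) (hL : PTime e L) (hC : PTime e C) (hh : PTime e h) :
    PTime e (fun a => pick (L a) (C a) (h a)) := by
  obtain ⟨K', hK'⟩ := exists_length_gl_le hp
  have h1 := foldl (e := e) (step := fun a s x => _root_.pickStep (L a) s x)
    (hp.ctx.pickStep hL.ctxD state elem) (hh.pair nil) (hp.reachTable hL hC).fst ⟨4 * K' + 1, ?_⟩
  · refine h1.snd.reverse.of_eq fun a => ?_
    exact (pick_eq_foldl (L a) (C a) (h a) []).trans (by simp)
  · rintro a ⟨g, zs⟩ x -
    have h2 := hK' a (_root_.pickStep (L a) (g, zs) x).1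
    have h3 := hK' a (_root_.pickOne (L a) x.1 x.2 g)
    rw [length_enc_prod, length_enc_prod, show (_root_.pickStep (L a) (g, zs) x).2 =
      _root_.pickOne (L a) x.1 x.2 g :: zs from rfl, length_enc_cons]
    simp only [Polynomial.eval_add, Polynomial.eval_mul, Polynomial.eval_ofNat,
      Polynomial.eval_one]
    omega

end PTime

/-! ### Reading and writing tuples of matrices -/

theorem encodeNat_eq_bits (n : ℕ) : encodeNat n = n.bits := by
  have h1 : ∀ m : PosNum, encodePosNum m = (m : ℕ).bits := by
    intro m
    induction m with
    | one => simp [encodePosNum]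
    | bit1 m ih => rw [encodePosNum, ih, PosNum.cast_bit1, ← two_mul, Nat.bit1_bits]
    | bit0 m ih =>
      rw [encodePosNum, ih, PosNum.cast_bit0, ← two_mul, Nat.bit0_bits _ m.cast_pos.ne']
  have h2 : ∀ m : Num, encodeNum m = (m : ℕ).bits := by
    intro m
    cases m with
    | zero => simp [encodeNum]
    | pos m => exact h1 m
  rw [encodeNat, h2, Num.to_of_nat]

/-- One step of reading a list of numbers from the right. -/
def readStep (x : Option Bool) (s : List ℕ) : List ℕ :=
  if x.isSome then Nat.bit (x.getD false) (s.headD 0) :: s.tail else 0 :: s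

/-- The numbers that are written in a word over `{0, 1, #}`, each one with the least significant bit
first and followed by `#`. -/
def readNats (w : List (Option Bool)) : List ℕ := w.foldr readStep []

theorem readNats_encodeNatList (l : List ℕ) : readNats (encodeNatList l) = l := by
  induction l with
  | nil => rfl
  | cons n l ih =>
    have h1 : ∀ b : List Bool, ((b.map some).foldr readStep (0 :: l)) =
        b.foldr Nat.bit 0 :: l := by
      intro b
      induction b with
      | nil => rfl
      | cons c b ih => simp [readStep, ih]
    have h2 : n.bits.foldr Nat.bit 0 = n := by
      have := ofBits_revBits n
      rwa [ofBits, revBits, List.foldl_reverse] at this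
    rw [encodeNatList, List.flatMap_cons, ← encodeNatList, readNats, List.foldr_append, ← readNats,
      ih, List.foldr_append, encodeNat_eq_bits]
    simp only [List.foldr_cons, List.foldr_nil]
    rw [readStep, if_neg (by simp), h1, h2]

/-- One step of grouping the entries of a list in fours, from the right. -/
def groupStep (n : ℕ) (s : List ℕ × List (ℕ × ℕ × ℕ × ℕ)) : List ℕ × List (ℕ × ℕ × ℕ × ℕ) :=
  if s.1.tail.tail.isEmpty then (n :: s.1, s.2)
  else ([], (n, s.1.headD 0, s.1.tail.headD 0, s.1.tail.tail.headD 0) :: s.2)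

theorem foldr_groupStep (l : List (ℕ × ℕ × ℕ × ℕ)) :
    (l.flatMap fun q => [q.1, q.2.1, q.2.2.1, q.2.2.2]).foldr groupStep ([], []) = ([], l) := by
  induction l with
  | nil => rfl
  | cons q l ih => rw [List.flatMap_cons, List.foldr_append, ih]; rfl

namespace PTime

variable {α : Type} {e : α → Word}

theorem readNats {w : α → List (Option Bool)} (hw : PTime e w) :
    PTime e (fun a => readNats (w a)) := by
  have hx := elem (e := e) (σ := fun _ => List ℕ) (β := fun _ => Option Bool)
  have hs := state (e := e) (σ := fun _ => List ℕ) (β := fun _ => Option Bool)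
  refine foldr (e := e) (σ := fun _ => List ℕ) (β := fun _ => Option Bool)
    (step := fun _ => readStep) (i := fun _ => [])
    (hx.isSome.ite (((hx.getD (const false)).bit (hs.headD (const 0))).cons hs.tail)
      ((const 0).cons hs)) nil hw ⟨3, fun a s x _ => ?_⟩
  have h0 : (enc 0).length = 0 := rfl
  simp only [readStep, Polynomial.eval_ofNat]
  split_ifs
  · rw [length_enc_cons]
    have h1 := size_bit_le (x.getD false) (s.headD 0)
    rw [← length_enc_nat, ← length_enc_nat] at h1
    cases s with
    | nil =>
      have h2 : (enc ([] : List ℕ)).length = 0 := rfl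
      simp only [List.headD_nil, List.tail_nil, h0, h2] at h1 ⊢
      omega
    | cons n s =>
      simp only [List.headD_cons, List.tail_cons, length_enc_cons] at h1 ⊢
      omega
  · rw [length_enc_cons, h0]
    omega

theorem groupStep_foldr {l : α → List ℕ} (hl : PTime e l) :
    PTime e (fun a => (l a).foldr groupStep ([], [])) := by
  obtain ⟨q, hq⟩ := PolyW.exists_length_le hl
  have hx := elem (e := e) (σ := fun _ => List ℕ × List (ℕ × ℕ × ℕ × ℕ)) (β := fun _ => ℕ)
  have hs := state (e := e) (σ := fun _ => List ℕ × List (ℕ × ℕ × ℕ × ℕ)) (β := fun _ => ℕ)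
  have hz : PTime (stepCtx e (fun _ => List ℕ × List (ℕ × ℕ × ℕ × ℕ)) fun _ => ℕ) fun _ => 0 :=
    const 0
  refine foldr (e := e) (σ := fun _ => List ℕ × List (ℕ × ℕ × ℕ × ℕ)) (β := fun _ => ℕ)
    (step := fun _ => groupStep) (i := fun _ => ([], []))
    (hs.fst.tail.tail.isEmpty.ite ((hx.cons hs.fst).pair hs.snd) (nil.pair
      ((hx.pair ((hs.fst.headD hz).pair ((hs.fst.tail.headD hz).pair
        (hs.fst.tail.tail.headD hz)))).cons hs.snd))) (nil.pair nil) hl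
    ⟨4 * q + 10, ?_⟩
  rintro a ⟨s, t⟩ n hn
  have h1 : (enc n).length ≤ q.eval (e a).length :=
    ((PolyW.length_le_listW enc (l a)).2 n hn).trans (hq a)
  have h0 : (enc ([] : List ℕ)).length = 0 := rfl
  simp only [Polynomial.eval_add, Polynomial.eval_mul, Polynomial.eval_ofNat]
  rw [groupStep]
  split_ifs with h
  · simp only [length_enc_prod, length_enc_cons]
    omega
  · match s, h with
    | x :: y :: z :: s, _ =>
      simp only [length_enc_prod, length_enc_cons, h0, List.tail_cons, List.headD_cons]
      omega

theorem encodeNatList {l : α → List ℕ} (hl : PTime e l) :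
    PTime e (fun a => encodeNatList (l a)) := by
  obtain ⟨q, hq⟩ := PolyW.exists_length_le hl
  have hx := elem (e := e) (σ := fun _ => List (Option Bool)) (β := fun _ => ℕ)
  have hs := state (e := e) (σ := fun _ => List (Option Bool)) (β := fun _ => ℕ)
  have hb : ∀ b : Bool, (enc (some b)).length = 2 := fun b => rfl
  have h0 : (enc (none : Option Bool)).length = 0 := rfl
  have h := foldr (e := e) (σ := fun _ => List (Option Bool)) (β := fun _ => ℕ)
    (step := fun _ n s => (_root_.revBits n).reverse.map some ++ none :: s) (i := fun _ => [])
    ((map elem.some' hx.revBits.reverse ⟨2, fun a b _ => by simp [hb]⟩).append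
      (none'.cons hs)) nil hl ⟨5 * q + 1, ?_⟩
  · refine h.of_eq fun a => ?_
    induction l a with
    | nil => rfl
    | cons n l ih =>
      rw [List.foldr_cons, ih, _root_.encodeNatList, _root_.encodeNatList, List.flatMap_cons,
        encodeNat_eq_bits, _root_.revBits, List.reverse_reverse]
      simp
  · intro a s n hn
    have h1 : (enc n).length ≤ q.eval (e a).length :=
      ((PolyW.length_le_listW enc (l a)).2 n hn).trans (hq a)
    have h2 : ∀ (b : List Bool) (s : List (Option Bool)),
        (enc (b.map some ++ s)).length = 5 * b.length + (enc s).length := by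
      intro b s
      induction b with
      | nil => simp
      | cons c b ih =>
        simp only [List.map_cons, List.cons_append, length_enc_cons, ih, hb, List.length_cons]
        omega
    rw [h2, length_enc_cons, h0, _root_.revBits, List.reverse_reverse]
    change n.bits.length ≤ _ at h1
    simp only [Polynomial.eval_add, Polynomial.eval_mul, Polynomial.eval_ofNat,
      Polynomial.eval_one]
    omega

section

variable {p : α → ℕ}

theorem flatMap_matrixEntries (hp : PTime e p)
    {C : ∀ a, List (Matrix.GeneralLinearGroup (Fin 2) (ZMod (p a)))} (hC : PTime e C)
    [∀ a, NeZero (p a)] :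
    PTime e (fun a => (C a).flatMap matrixEntries) := by
  obtain ⟨q, hq⟩ := exists_length_zmod_le hp
  have hx := elem (e := e) (σ := fun _ => List ℕ)
    (β := fun a => Matrix.GeneralLinearGroup (Fin 2) (ZMod (p a)))
  have hs := state (e := e) (σ := fun _ => List ℕ)
    (β := fun a => Matrix.GeneralLinearGroup (Fin 2) (ZMod (p a)))
  have h := foldr (e := e) (σ := fun _ => List ℕ)
    (step := fun a M s => (M.val 0 0).val :: (M.val 0 1).val :: (M.val 1 0).val ::
      (M.val 1 1).val :: s) (i := fun _ => [])
    (hx.gval.m00.val.cons (hx.gval.m01.val.cons (hx.gval.m10.val.cons (hx.gval.m11.val.cons hs))))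
    nil hC ⟨8 * q + 4, ?_⟩
  · refine h.of_eq fun a => ?_
    induction C a with
    | nil => rfl
    | cons M C ih => rw [List.foldr_cons, ih, List.flatMap_cons]; rfl
  · intro a s M _
    have h1 := hq a (M.val 0 0)
    have h2 := hq a (M.val 0 1)
    have h3 := hq a (M.val 1 0)
    have h4 := hq a (M.val 1 1)
    change (enc (M.val 0 0).val).length ≤ _ at h1
    change (enc (M.val 0 1).val).length ≤ _ at h2
    change (enc (M.val 1 0).val).length ≤ _ at h3
    change (enc (M.val 1 1).val).length ≤ _ at h4
    simp only [length_enc_cons, Polynomial.eval_add, Polynomial.eval_mul, Polynomial.eval_ofNat]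
    omega

end

end PTime

instance (I : MatrixTuple) : Fact I.p.Prime := ⟨I.prime⟩

namespace PTime

variable {α : Type} {e : α → Word} {I : α → MatrixTuple}

theorem modulus (h : PTime e fun a => encodeMatrixTuple (I a)) : PTime e (fun a => (I a).p) :=
  (h.readNats.headD (const 0)).of_eq fun a => by
    rw [encodeMatrixTuple, readNats_encodeNatList, List.headD_cons]

theorem mats (h : PTime e fun a => encodeMatrixTuple (I a)) : PTime e (fun a => (I a).mats) := by
  refine PolyW.congr h.readNats.tail.groupStep_foldr.snd fun a => ?_
  beta_reduce
  rw [encodeMatrixTuple, readNats_encodeNatList, List.tail_cons]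
  have h1 : (I a).mats.flatMap matrixEntries = ((I a).mats.map fun M => ((M.val 0 0).val,
      (M.val 0 1).val, (M.val 1 0).val, (M.val 1 1).val)).flatMap
      fun q => [q.1, q.2.1, q.2.2.1, q.2.2.2] := by
    rw [List.flatMap_map]; rfl
  rw [h1, foldr_groupStep]
  change listW _ = listW _
  rw [List.map_map]
  rfl

theorem encodeMatrixTuple (hp : PTime e fun a => (I a).p) (hC : PTime e fun a => (I a).mats) :
    PTime e (fun a => encodeMatrixTuple (I a)) :=
  (hp.cons (flatMap_matrixEntries hp hC)).encodeNatList

end PTime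

open scoped MatrixGroups

/-! ### Conjugacy of two-by-two matrices -/

section

variable {F : Type*} [Field F] [DecidableEq F]

/-- A two-by-two matrix is scalar, in terms of its entries. -/
def IsScalar (M : Matrix (Fin 2) (Fin 2) F) : Prop := M 0 1 = 0 ∧ M 1 0 = 0 ∧ M 0 0 = M 1 1

instance (M : Matrix (Fin 2) (Fin 2) F) : Decidable (IsScalar M) := by
  unfold IsScalar; infer_instance

omit [DecidableEq F] in
theorem isScalar_iff {M : Matrix (Fin 2) (Fin 2) F} :
    IsScalar M ↔ ∃ a : F, M = Matrix.scalar (Fin 2) a := by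
  constructor
  · rintro ⟨h1, h2, h3⟩
    refine ⟨M 0 0, ?_⟩
    ext i j
    fin_cases i <;> fin_cases j <;> simp [h1, h2, h3]
  · rintro ⟨a, rfl⟩
    simp [IsScalar]

/-- The columns `v` and `M v`, where `v` is one of `e₁`, `e₂`, `e₁ + e₂` that is no eigenvector
of `M`, if there is one. -/
def cyc (M : Matrix (Fin 2) (Fin 2) F) : Matrix (Fin 2) (Fin 2) F :=
  if M 1 0 ≠ 0 then !![1, M 0 0; 0, M 1 0]
  else if M 0 1 ≠ 0 then !![0, M 0 1; 1, M 1 1] else !![1, M 0 0; 1, M 1 1]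

/-- The companion matrix of `x² - t x + d`. -/
def companion (t d : F) : Matrix (Fin 2) (Fin 2) F := !![0, -d; 1, t]

theorem det_cyc_ne_zero {M : Matrix (Fin 2) (Fin 2) F} (h : ¬ IsScalar M) : (cyc M).det ≠ 0 := by
  rw [cyc]
  split_ifs with h1 h2
  · simpa [Matrix.det_fin_two] using h1
  · simpa [Matrix.det_fin_two] using h2
  · rw [not_not] at h1 h2
    simp only [Matrix.det_fin_two, Matrix.of_apply, Matrix.cons_val', Matrix.cons_val_zero,
      Matrix.cons_val_one, Matrix.cons_val_fin_one, one_mul, mul_one]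
    exact fun h3 => h ⟨h2, h1, (sub_eq_zero.1 h3).symm⟩

/-- By the Cayley–Hamilton theorem `M` sends `M v` to `t M v - d v`. -/
theorem mul_cyc (M : Matrix (Fin 2) (Fin 2) F) :
    M * cyc M = cyc M * companion M.trace M.det := by
  rw [cyc, companion, Matrix.det_fin_two, Matrix.trace_fin_two]
  split_ifs with h1 h2
  · ext i j; fin_cases i <;> fin_cases j <;> simp [Matrix.mul_apply, Fin.sum_univ_two] <;> ring
  · ext i j; fin_cases i <;> fin_cases j <;> simp [Matrix.mul_apply, Fin.sum_univ_two] <;> ring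
  · rw [not_not] at h1 h2
    ext i j; fin_cases i <;> fin_cases j <;> simp [Matrix.mul_apply, Fin.sum_univ_two, h1, h2] <;>
      ring

/-- A basis in which a non-scalar matrix becomes its companion matrix. -/
def basis (A : GL (Fin 2) F) : GL (Fin 2) F := (cyc A.val).toGL

theorem inv_basis_mul_mul_basis {A : GL (Fin 2) F} (hA : ¬ IsScalar A.val) :
    ((basis A)⁻¹ * A * basis A).val = companion A.val.trace A.val.det := by
  have h1 : (A * basis A).val = (basis A).val * companion A.val.trace A.val.det := by
    rw [Units.val_mul, basis, Matrix.val_toGL (det_cyc_ne_zero hA), mul_cyc]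
  rw [mul_assoc, Units.val_mul, h1, ← Matrix.mul_assoc, ← Units.val_mul, inv_mul_cancel,
    Units.val_one, Matrix.one_mul]

/-- A matrix that conjugates `A` into `B` if they are non-scalar with the same trace and
determinant. -/
def conjOf (A B : GL (Fin 2) F) : GL (Fin 2) F := basis A * (basis B)⁻¹

theorem conjOf_spec {A B : GL (Fin 2) F} (hA : ¬ IsScalar A.val) (hB : ¬ IsScalar B.val)
    (ht : A.val.trace = B.val.trace) (hd : A.val.det = B.val.det) :
    (conjOf A B)⁻¹ * A * conjOf A B = B := by
  have h1 : (basis A)⁻¹ * A * basis A = (basis B)⁻¹ * B * basis B := by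
    apply Units.ext
    rw [inv_basis_mul_mul_basis hA, inv_basis_mul_mul_basis hB, ht, hd]
  calc (conjOf A B)⁻¹ * A * conjOf A B
      = basis B * ((basis A)⁻¹ * A * basis A) * (basis B)⁻¹ := by rw [conjOf]; group
    _ = B := by rw [h1]; group

omit [DecidableEq F] in
theorem det_ne_zero' (g : GL (Fin 2) F) : g.val.det ≠ 0 := g.det.ne_zero

omit [DecidableEq F] in
theorem trace_conj (g A : GL (Fin 2) F) : (g⁻¹ * A * g).val.trace = A.val.trace := by
  rw [Units.val_mul, Units.val_mul, Matrix.trace_mul_cycle, ← Units.val_mul, mul_inv_cancel]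
  simp

omit [DecidableEq F] in
theorem det_conj (g A : GL (Fin 2) F) : (g⁻¹ * A * g).val.det = A.val.det := by
  rw [Units.val_mul, Units.val_mul, Matrix.det_mul, Matrix.det_mul, mul_right_comm,
    ← Matrix.det_mul, ← Units.val_mul, inv_mul_cancel]
  simp

omit [DecidableEq F] in
theorem isScalar_commute {A : GL (Fin 2) F} (hA : IsScalar A.val) (g : GL (Fin 2) F) :
    g * A = A * g := by
  obtain ⟨a, ha⟩ := isScalar_iff.1 hA
  apply Units.ext
  rw [Units.val_mul, Units.val_mul, ha]
  exact (Matrix.scalar_commute a (fun r => mul_comm a r) _).symm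

omit [DecidableEq F] in
theorem isScalar_conj (g A : GL (Fin 2) F) : IsScalar (g⁻¹ * A * g).val ↔ IsScalar A.val := by
  have h1 : ∀ g A : GL (Fin 2) F, IsScalar A.val → IsScalar (g⁻¹ * A * g).val := by
    intro g A h
    rw [mul_assoc, ← isScalar_commute h, inv_mul_cancel_left]
    exact h
  refine ⟨fun h => ?_, h1 g A⟩
  have := h1 g⁻¹ _ h
  rwa [show (g⁻¹)⁻¹ * (g⁻¹ * A * g) * g⁻¹ = A by group] at this

omit [DecidableEq F] in
theorem isScalar_mul {A B : GL (Fin 2) F} (hA : IsScalar A.val) (hB : IsScalar B.val) :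
    IsScalar (A * B).val := by
  obtain ⟨a, ha⟩ := isScalar_iff.1 hA
  obtain ⟨b, hb⟩ := isScalar_iff.1 hB
  refine isScalar_iff.2 ⟨a * b, ?_⟩
  rw [Units.val_mul, ha, hb, map_mul]

omit [DecidableEq F] in
theorem isScalar_one : IsScalar (1 : GL (Fin 2) F).val := by simp [IsScalar]

omit [DecidableEq F] in
theorem isScalar_inv {A : GL (Fin 2) F} (hA : IsScalar A.val) : IsScalar A⁻¹.val := by
  rw [Matrix.coe_units_inv, Matrix.inv_def, Matrix.adjugate_fin_two]
  obtain ⟨h1, h2, h3⟩ := hA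
  simp [IsScalar, h1, h2, h3]

/-- The matrix `M` with respect to the basis in which `X` is its companion matrix. -/
def inBasis (X : GL (Fin 2) F) (M : Matrix (Fin 2) (Fin 2) F) : GL (Fin 2) F :=
  basis X * M.toGL * (basis X)⁻¹

section inBasis

variable {X : GL (Fin 2) F} {M : Matrix (Fin 2) (Fin 2) F}

theorem inv_mul_inBasis (hM : M.det ≠ 0) : ((basis X)⁻¹ * inBasis X M * basis X).val = M := by
  have : (basis X)⁻¹ * inBasis X M * basis X = M.toGL := by rw [inBasis]; group
  rw [this, Matrix.val_toGL hM]

theorem inv_mul_inBasis_mul (hX : ¬ IsScalar X.val) (hM : M.det ≠ 0) :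
    ((basis X)⁻¹ * (inBasis X M * X) * basis X).val =
      M * companion X.val.trace X.val.det := by
  have : (basis X)⁻¹ * (inBasis X M * X) * basis X =
      M.toGL * ((basis X)⁻¹ * X * basis X) := by rw [inBasis]; group
  rw [this, Units.val_mul, Matrix.val_toGL hM, inv_basis_mul_mul_basis hX]

theorem trace_inBasis (hM : M.det ≠ 0) : (inBasis X M).val.trace = M.trace := by
  rw [← trace_conj (basis X), inv_mul_inBasis hM]

theorem det_inBasis (hM : M.det ≠ 0) : (inBasis X M).val.det = M.det := by
  rw [← det_conj (basis X), inv_mul_inBasis hM]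

theorem isScalar_inBasis (hM : M.det ≠ 0) : IsScalar (inBasis X M).val ↔ IsScalar M := by
  rw [← isScalar_conj (basis X), inv_mul_inBasis hM]

theorem trace_inBasis_mul (hX : ¬ IsScalar X.val) (hM : M.det ≠ 0) :
    (inBasis X M * X).val.trace = (M * companion X.val.trace X.val.det).trace := by
  rw [← trace_conj (basis X), inv_mul_inBasis_mul hX hM]

theorem isScalar_inBasis_mul (hX : ¬ IsScalar X.val) (hM : M.det ≠ 0) :
    IsScalar (inBasis X M * X).val ↔ IsScalar (M * companion X.val.trace X.val.det) := by
  rw [← isScalar_conj (basis X), inv_mul_inBasis_mul hX hM]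

/-- Every invertible matrix can be written in the basis of `X`. -/
theorem exists_inBasis (X B : GL (Fin 2) F) : ∃ M, M.det ≠ 0 ∧ inBasis X M = B := by
  refine ⟨((basis X)⁻¹ * B * basis X).val, det_ne_zero' _, ?_⟩
  have : (((basis X)⁻¹ * B * basis X).val).toGL = (basis X)⁻¹ * B * basis X :=
    Units.ext (Matrix.val_toGL (det_ne_zero' _))
  rw [inBasis, this]
  group

end inBasis

/-! ### Merging non-scalar matrices into one -/

/-- The discriminant of the characteristic polynomial of a matrix. -/
def disc (M : Matrix (Fin 2) (Fin 2) F) : F := M.trace ^ 2 - 4 * M.det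

/-- A conjugate of `N` whose product with `X` has two distinct eigenvalues in the field. With
`d = det N * det X`, the product is triangular in the basis of `X`, with diagonal entries `u` and
`d / u`, so `u` has to satisfy `u ^ 2 ≠ d`. If `d ≠ 1` then `u = 1` will do, and otherwise `u = 2`,
provided that `4 ≠ 1`. -/
def splitter (N X : GL (Fin 2) F) : GL (Fin 2) F :=
  let u : F := if N.val.det * X.val.det = 1 then 2 else 1
  inBasis X !![N.val.trace, u; -N.val.det / u, 0]

omit [DecidableEq F] in
theorem disc_of_isScalar {M : Matrix (Fin 2) (Fin 2) F} (h : IsScalar M) : disc M = 0 := by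
  obtain ⟨h1, h2, h3⟩ := h
  rw [disc, Matrix.trace_fin_two, Matrix.det_fin_two, h1, h3]
  ring

theorem splitter_spec (h2 : (2 : F) ≠ 0) (h3 : (3 : F) ≠ 0) {N X : GL (Fin 2) F}
    (hX : ¬ IsScalar X.val) :
    ¬ IsScalar (splitter N X).val ∧ (splitter N X).val.trace = N.val.trace ∧
      (splitter N X).val.det = N.val.det ∧
      ∃ δ : F, δ ≠ 0 ∧ disc (splitter N X * X).val = δ ^ 2 := by
  have hu : ∃ u : F, u ≠ 0 ∧ u ^ 2 ≠ N.val.det * X.val.det ∧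
      splitter N X = inBasis X !![N.val.trace, u; -N.val.det / u, 0] := by
    refine ⟨_, ?_, ?_, rfl⟩
    · split_ifs <;> simp [h2]
    · split_ifs with h
      · rw [h]
        intro h4
        exact h3 (by linear_combination h4)
      · rw [one_pow]
        exact fun h4 => h h4.symm
  obtain ⟨u, hu0, hu, hs⟩ := hu
  have hdN : N.val.det ≠ 0 := det_ne_zero' N
  have hdet : (!![N.val.trace, u; -N.val.det / u, 0] : Matrix (Fin 2) (Fin 2) F).det =
      N.val.det := by
    rw [Matrix.det_fin_two_of]
    field_simp
    ring
  have hdet0 : (!![N.val.trace, u; -N.val.det / u, 0] : Matrix (Fin 2) (Fin 2) F).det ≠ 0 :=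
    by rw [hdet]; exact hdN
  rw [hs]
  refine ⟨?_, ?_, ?_, u - N.val.det * X.val.det / u, ?_, ?_⟩
  · rw [isScalar_inBasis hdet0]
    exact fun h => hu0 (by simpa using h.1)
  · rw [trace_inBasis hdet0]
    simp [Matrix.trace_fin_two]
  · rw [det_inBasis hdet0, hdet]
  · intro h
    apply hu
    field_simp at h
    linear_combination h
  · rw [disc, trace_inBasis_mul hX hdet0, Units.val_mul, Matrix.det_mul, det_inBasis hdet0, hdet,
      companion, Matrix.mul_fin_two, Matrix.trace_fin_two_of]
    field_simp
    ring

/-- Conjugates of non-scalar matrices are multiplied up from the right, in such a way that the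
product stays non-scalar. The result is the product together with the conjugators. -/
def chain (l : List (GL (Fin 2) F)) : GL (Fin 2) F × List (GL (Fin 2) F) :=
  l.foldr (fun N s => if s.2.isEmpty then (N, [1])
    else (splitter N s.1 * s.1, conjOf N (splitter N s.1) :: s.2)) (1, [])

theorem chain_singleton (X : GL (Fin 2) F) : chain [X] = (X, [1]) := rfl

/-- The product of `chain` is non-scalar since it has two distinct eigenvalues, if there are at
least two factors. -/
theorem chain_spec (h2 : (2 : F) ≠ 0) (h3 : (3 : F) ≠ 0) (l : List (GL (Fin 2) F))
    (hl : ∀ N ∈ l, ¬ IsScalar N.val) :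
    SolvesTo l (chain l).2 (chain l).1 ∧ (l ≠ [] → ¬ IsScalar (chain l).1.val) ∧
      (2 ≤ l.length → ∃ δ : F, δ ≠ 0 ∧ disc (chain l).1.val = δ ^ 2) := by
  induction l with
  | nil => exact ⟨solvesTo_nil.2 ⟨rfl, rfl⟩, fun h => absurd rfl h, fun h => by simp at h⟩
  | cons N l ih =>
    obtain ⟨i1, i2, i3⟩ := ih fun M hM => hl M (List.mem_cons_of_mem _ hM)
    have hN := hl N (by simp)
    cases l with
    | nil =>
      refine ⟨solvesTo_cons.2 ⟨1, [], rfl, ?_⟩, fun _ => hN, fun h => by simp at h⟩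
      rw [chain_singleton]
      simp [solvesTo_nil]
    | cons N' l =>
      have h4 : chain (N :: N' :: l) = (splitter N (chain (N' :: l)).1 * (chain (N' :: l)).1,
          conjOf N (splitter N (chain (N' :: l)).1) :: (chain (N' :: l)).2) := by
        have : (chain (N' :: l)).2.isEmpty = false := by
          have := i1.1
          cases h : (chain (N' :: l)).2 with
          | nil => rw [h] at this; simp at this
          | cons => rfl
        conv_lhs => rw [chain, List.foldr_cons, ← chain]
        rw [if_neg (by simp [this])]
      obtain ⟨s1, s2, s3, s4⟩ := splitter_spec h2 h3 (N := N) (i2 (by simp))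
      rw [h4]
      refine ⟨solvesTo_cons.2 ⟨_, _, rfl, ?_⟩, fun _ h => ?_, fun _ => s4⟩
      · rw [conjOf_spec hN s1 s2.symm s3.symm]
        simpa using i1
      · obtain ⟨δ, h5, h6⟩ := s4
        rw [disc_of_isScalar h] at h6
        exact h5 (pow_eq_zero_iff (by norm_num) |>.1 h6.symm)

end

/-! ### Three conjugacy classes and a conic -/

section

variable {F : Type*} [Field F] [DecidableEq F]

/-- The pair `z` solves `z₁⁻¹ A z₁ · z₂⁻¹ B z₂ · X = T`. -/
def pairCheck (A B X T : GL (Fin 2) F) (z : GL (Fin 2) F × GL (Fin 2) F) : Bool :=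
  decide ((z.1⁻¹ * A * z.1) * (z.2⁻¹ * B * z.2) * X = T)

/-- The discriminant of the conic, as a quadratic equation for the other coordinate: the matrices
`M` with lower left entry `c` such that `M` has the trace and determinant of `B`, and `M K` the
trace of `A⁻¹ T`, for `K` the companion matrix of `X`, correspond to the square roots of the
value at `c`. -/
def conicDisc (A B X T : GL (Fin 2) F) (c : F) : F :=
  disc X.val * c ^ 2 + (2 * X.val.trace * B.val.trace - 4 * (A⁻¹ * T).val.trace) * c + disc B.val

/-- Up to a factor `4`, the discriminant of the polynomial `conicDisc`. -/
def conicDet (A B X T : GL (Fin 2) F) : F :=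
  (X.val.trace * B.val.trace - 2 * (A⁻¹ * T).val.trace) ^ 2 - disc X.val * disc B.val

/-- The matrix that corresponds to the point `(c, r)` of the conic `r ^ 2 = conicDisc c`. -/
def conicMatrix (A B X T : GL (Fin 2) F) (c r : F) : Matrix (Fin 2) (Fin 2) F :=
  let a := (B.val.trace - X.val.trace * c + r) / 2
  !![a, (A⁻¹ * T).val.trace - X.val.trace * (B.val.trace - a) + X.val.det * c;
    c, B.val.trace - a]

/-- The conjugators that correspond to the point `(c, r)` of the conic. -/
def conicPair (A B X T : GL (Fin 2) F) (c r : F) : GL (Fin 2) F × GL (Fin 2) F :=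
  let B' := inBasis X (conicMatrix A B X T c r)
  (conjOf A (T * (B' * X)⁻¹), conjOf B B')

/-- The point `(c, r)` is on the conic and gives non-scalar matrices. -/
def ConicGood (A B X T : GL (Fin 2) F) (c r : F) : Prop :=
  r ^ 2 = conicDisc A B X T c ∧ ¬ IsScalar (conicMatrix A B X T c r) ∧
    ¬ IsScalar (conicMatrix A B X T c r * companion X.val.trace X.val.det)

omit [DecidableEq F] in
theorem trace_inv (Y : GL (Fin 2) F) : Y⁻¹.val.trace = Y.val.trace / Y.val.det := by
  rw [Matrix.coe_units_inv, Matrix.inv_def, Matrix.trace_smul, Matrix.adjugate_fin_two,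
    Matrix.trace_fin_two_of, Matrix.trace_fin_two, Ring.inverse_eq_inv', smul_eq_mul]
  ring

omit [DecidableEq F] in
theorem det_inv' (Y : GL (Fin 2) F) : Y⁻¹.val.det = (Y.val.det)⁻¹ := by
  rw [Matrix.coe_units_inv, Matrix.det_nonsing_inv, Ring.inverse_eq_inv']

omit [DecidableEq F] in
theorem trace_mul_of_isScalar {T : GL (Fin 2) F} (hT : IsScalar T.val) (Y : GL (Fin 2) F) :
    (Y * T).val.trace = T.val 0 0 * Y.val.trace ∧ T.val.det = T.val 0 0 ^ 2 := by
  obtain ⟨h1, h2, h3⟩ := hT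
  constructor
  · rw [Units.val_mul, Matrix.trace_fin_two, Matrix.trace_fin_two]
    simp only [Matrix.mul_apply, Fin.sum_univ_two, h1, h2, ← h3]
    ring
  · rw [Matrix.det_fin_two, h1, h2, ← h3]
    ring

omit [DecidableEq F] in
/-- If the determinants fit then `A` has the trace of `T Y⁻¹` as soon as `Y` has the trace
of `A⁻¹ T`. -/
theorem trace_mul_inv_of_isScalar {A T Y : GL (Fin 2) F} (hT : IsScalar T.val)
    (hd : A.val.det * Y.val.det = T.val.det) (h : Y.val.trace = (A⁻¹ * T).val.trace) :
    (T * Y⁻¹).val.trace = A.val.trace := by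
  have h1 := det_ne_zero' A
  have h2 := det_ne_zero' Y
  rw [← isScalar_commute hT, (trace_mul_of_isScalar hT _).1, trace_inv, h,
    (trace_mul_of_isScalar hT _).1, trace_inv]
  rw [(trace_mul_of_isScalar hT 1).2] at hd
  field_simp
  linear_combination (-A.val.trace) * hd

variable {A B X T : GL (Fin 2) F} {c r : F}

omit [DecidableEq F] in
theorem trace_conicMatrix : (conicMatrix A B X T c r).trace = B.val.trace := by
  simp [conicMatrix, Matrix.trace_fin_two]

omit [DecidableEq F] in
theorem trace_conicMatrix_mul :
    (conicMatrix A B X T c r * companion X.val.trace X.val.det).trace =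
      (A⁻¹ * T).val.trace := by
  simp only [conicMatrix, companion, Matrix.mul_fin_two, Matrix.trace_fin_two_of]
  ring

omit [DecidableEq F] in
theorem det_conicMatrix (h2 : (2 : F) ≠ 0) (h : r ^ 2 = conicDisc A B X T c) :
    (conicMatrix A B X T c r).det = B.val.det := by
  simp only [conicDisc, disc] at h
  simp only [conicMatrix, Matrix.det_fin_two_of]
  field_simp
  linear_combination (-1 : F) * h

/-- Good points of the conic give solutions: by the choice of traces and determinants, `B` is
conjugate to `B'` and `A` is conjugate to `T (B' X)⁻¹`. -/
theorem pairCheck_conicPair (h2 : (2 : F) ≠ 0) (hA : ¬ IsScalar A.val) (hB : ¬ IsScalar B.val)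
    (hX : ¬ IsScalar X.val) (hT : IsScalar T.val)
    (hd : A.val.det * B.val.det * X.val.det = T.val.det) (h : ConicGood A B X T c r) :
    pairCheck A B X T (conicPair A B X T c r) = true := by
  obtain ⟨h3, h4, h5⟩ := h
  have hM := det_conicMatrix h2 h3
  have hM0 : (conicMatrix A B X T c r).det ≠ 0 := hM ▸ det_ne_zero' B
  rw [pairCheck, conicPair, decide_eq_true_iff]
  rw [← isScalar_inBasis_mul hX hM0] at h5
  rw [← isScalar_inBasis (X := X) hM0] at h4
  have e1 := trace_inBasis (X := X) hM0
  have e2 := det_inBasis (X := X) hM0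
  have e3 := trace_inBasis_mul hX hM0
  rw [trace_conicMatrix_mul] at e3
  rw [trace_conicMatrix] at e1
  rw [hM] at e2
  generalize inBasis X (conicMatrix A B X T c r) = B' at *
  have e4 : A.val.det * (B' * X).val.det = T.val.det := by
    rw [Units.val_mul, Matrix.det_mul, e2, ← hd, mul_assoc]
  rw [conjOf_spec hB h4 e1.symm e2.symm, conjOf_spec hA ?_
    (trace_mul_inv_of_isScalar hT e4 e3).symm ?_]
  · group
  · intro h6
    apply h5
    have := isScalar_mul (isScalar_inv h6) hT
    rwa [show (T * (B' * X)⁻¹)⁻¹ * T = B' * X by group] at this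
  · rw [Units.val_mul, Matrix.det_mul, det_inv', ← e4, mul_inv_cancel_right₀ (det_ne_zero' _)]

omit [DecidableEq F] in
/-- Points of the conic can be bad only if the conic is degenerate, and then only for two
values of `c`. -/
theorem conicGood_of (h2 : (2 : F) ≠ 0) (h : r ^ 2 = conicDisc A B X T c)
    (h' : conicDet A B X T ≠ 0 ∨ (c ≠ 0 ∧ 2 * X.val.det * c ≠ -(A⁻¹ * T).val.trace)) :
    ConicGood A B X T c r := by
  have hd := det_conicMatrix h2 h
  have hd1 := det_ne_zero' X
  refine ⟨h, ?_, ?_⟩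
  · rintro ⟨h3, h4, h5⟩
    simp only [conicMatrix, Matrix.of_apply, Matrix.cons_val', Matrix.cons_val_zero,
      Matrix.cons_val_one, Matrix.cons_val_fin_one, Matrix.det_fin_two_of] at h3 h4 h5 hd
    generalize (B.val.trace - X.val.trace * c + r) / 2 = a at *
    rcases h' with h' | h'
    · apply h'
      rw [conicDet, disc, disc, ← hd]
      subst h4
      have e1 : B.val.trace = 2 * a := by linear_combination -h5
      rw [e1] at h3 ⊢
      have e2 : (A⁻¹ * T).val.trace = X.val.trace * a := by linear_combination h3
      rw [e2]
      ring
    · exact h'.1 h4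
  · rintro ⟨h3, h4, h5⟩
    simp only [conicMatrix, companion, Matrix.mul_fin_two, Matrix.of_apply, Matrix.cons_val',
      Matrix.cons_val_zero, Matrix.cons_val_one, Matrix.cons_val_fin_one,
      Matrix.det_fin_two_of] at h3 h4 h5 hd
    generalize (B.val.trace - X.val.trace * c + r) / 2 = a at *
    have e1 : B.val.trace = a := by linear_combination h4
    rw [e1] at h3 h5 hd
    have e2 : (A⁻¹ * T).val.trace = -2 * X.val.det * c := by linear_combination h5
    rcases h' with h' | h'
    · apply h'
      have e3 : X.val.det * (a + X.val.trace * c) = 0 := by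
        rw [e2] at h3
        linear_combination -h3
      have e4 : a = -(X.val.trace * c) := by
        rcases mul_eq_zero.1 e3 with e | e
        · exact absurd e hd1
        · linear_combination e
      rw [conicDet, disc, disc, ← hd, e1, e2, e4]
      ring
    · exact h'.2 (by linear_combination e2)

omit [DecidableEq F] in
theorem det_eq_of_solvesTo {C z : List (GL (Fin 2) F)} {h : GL (Fin 2) F} (hz : SolvesTo C z h) :
    (C.map fun M => M.val.det).prod = h.val.det := by
  induction C generalizing z h with
  | nil => simp [(solvesTo_nil.1 hz).2]
  | cons A C ih =>
    obtain ⟨y, z', rfl, hz'⟩ := solvesTo_cons.1 hz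
    rw [List.map_cons, List.prod_cons, ih hz', Units.val_mul, Matrix.det_mul, det_inv', det_conj,
      mul_inv_cancel_left₀ (det_ne_zero' _)]

/-- Every solution with three matrices gives a good point of the conic. -/
theorem exists_conicGood (h2 : (2 : F) ≠ 0) (hA : ¬ IsScalar A.val) (hB : ¬ IsScalar B.val)
    (hX : ¬ IsScalar X.val) (hT : IsScalar T.val) {z : List (GL (Fin 2) F)}
    (hz : SolvesTo [A, B, X] z T) : ∃ c r, ConicGood A B X T c r := by
  obtain ⟨z1, w1, rfl, hz1⟩ := solvesTo_cons.1 hz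
  obtain ⟨z2, w2, rfl, hz2⟩ := solvesTo_cons.1 hz1
  obtain ⟨z3, w3, rfl, hz3⟩ := solvesTo_cons.1 hz2
  replace hz := (solvesTo_nil.1 hz3).2
  obtain ⟨M, hM, hB'⟩ := exists_inBasis X ((z2 * z3⁻¹)⁻¹ * B * (z2 * z3⁻¹))
  have hY : inBasis X M * X = ((z1 * z3⁻¹)⁻¹ * A * (z1 * z3⁻¹))⁻¹ * T := by
    rw [hB']
    have e1 : T = z3 * T * z3⁻¹ := by rw [isScalar_commute hT]; group
    have e2 : T = (z1⁻¹ * A * z1) * (z2⁻¹ * B * z2) * (z3⁻¹ * X * z3) := by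
      rw [inv_mul_eq_one.1 hz]
      group
    rw [e1]
    nth_rw 1 [e2]
    group
  have hY' : (inBasis X M * X).val.trace = (A⁻¹ * T).val.trace := by
    rw [hY, (trace_mul_of_isScalar hT _).1, (trace_mul_of_isScalar hT _).1, trace_inv, trace_inv,
      trace_conj, det_conj]
  have ht := trace_inBasis (X := X) hM
  have hd := det_inBasis (X := X) hM
  have hs := isScalar_inBasis (X := X) hM
  rw [hB', trace_conj] at ht
  rw [hB', det_conj] at hd
  rw [hB', isScalar_conj] at hs
  have hs' := isScalar_inBasis_mul hX hM
  rw [trace_inBasis_mul hX hM] at hY'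
  have hYs : ¬ IsScalar (inBasis X M * X).val := by
    rw [hY]
    intro h
    have h3 := isScalar_mul hT (isScalar_inv h)
    rw [show T * (((z1 * z3⁻¹)⁻¹ * A * (z1 * z3⁻¹))⁻¹ * T)⁻¹ =
      (z1 * z3⁻¹)⁻¹ * A * (z1 * z3⁻¹) by group, isScalar_conj] at h3
    exact hA h3
  rw [hs'] at hYs
  rw [hs] at hB
  obtain ⟨a, b, c, d, rfl⟩ : ∃ a b c d, M = !![a, b; c, d] := ⟨_, _, _, _, M.eta_fin_two⟩
  rw [companion, Matrix.mul_fin_two, Matrix.trace_fin_two_of] at hY'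
  rw [Matrix.trace_fin_two_of] at ht
  rw [Matrix.det_fin_two_of] at hd
  have hMc : conicMatrix A B X T c (2 * a - B.val.trace + X.val.trace * c) = !![a, b; c, d] := by
    rw [conicMatrix, ← hY', ht, show (a + d - X.val.trace * c + (2 * a - (a + d) +
      X.val.trace * c)) / 2 = a by field_simp; ring]
    ext i j
    fin_cases i <;> fin_cases j <;> (simp; try ring)
  refine ⟨c, 2 * a - B.val.trace + X.val.trace * c, ?_, ?_, ?_⟩
  · rw [conicDisc, ← hY', disc, disc, hd, ht]
    ring
  · rwa [hMc]
  · rwa [hMc]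

end

/-! ### Square values of quadratic polynomials over a finite field -/

section

variable {F : Type*} [Field F] [Fintype F] [DecidableEq F]

open Finset

theorem sum_quadraticChar_sq_sub (hF : ringChar F ≠ 2) {δ : F} (hδ : δ ≠ 0) :
    ∑ x : F, quadraticChar F (x ^ 2 - δ) = -1 := by
  have h2 : (2 : F) ≠ 0 := Ring.two_ne_zero hF
  -- count the points of the hyperbola `x² - y² = δ` in two ways
  have h1 : (Fintype.card {u : F // u ≠ 0} : ℤ) =
      ∑ x : F, (quadraticChar F (x ^ 2 - δ) + 1) := by
    have e : {u : F // u ≠ 0} ≃ Σ x : F, {y : F // y ^ 2 = x ^ 2 - δ} :=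
      { toFun := fun u => ⟨(u + δ / u) / 2, (u - δ / u) / 2, by
          have := u.2
          field_simp
          ring⟩
        invFun := fun z => ⟨z.1 + z.2.1, fun h => hδ (by
          linear_combination (z.1 - z.2.1) * h + z.2.2)⟩
        left_inv := fun u => by
          have := u.2
          apply Subtype.ext
          field_simp
          ring
        right_inv := fun ⟨x, y, h⟩ => by
          have h3 : x + y ≠ 0 := fun h' => hδ (by linear_combination (x - y) * h' + h)
          have h4 : δ / (x + y) = x - y := by
            rw [div_eq_iff h3]
            linear_combination h
          have h5 : (x + y + δ / (x + y)) / 2 = x := by rw [h4]; field_simp; ring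
          have h6 : (x + y - δ / (x + y)) / 2 = y := by rw [h4]; field_simp; ring
          refine Sigma.subtype_ext h5 h6 }
    rw [Fintype.card_congr e, Fintype.card_sigma, Nat.cast_sum]
    refine Finset.sum_congr rfl fun x _ => ?_
    rw [← quadraticChar_card_sqrts hF, Set.toFinset_card]
    rfl
  have h3 : (Fintype.card {u : F // u ≠ 0} : ℤ) = Fintype.card F - 1 := by
    rw [Fintype.card_subtype_compl, Fintype.card_subtype_eq,
      Nat.cast_sub Fintype.card_pos, Nat.cast_one]
  rw [Finset.sum_add_distrib, Finset.sum_const, Finset.card_univ, h3, nsmul_eq_mul, mul_one] at h1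
  linarith

/-- A quadratic polynomial without double root takes square values at about half of all places. -/
theorem card_isSquare_quadratic (hF : ringChar F ≠ 2) {α β γ : F} (h : β ^ 2 - 4 * α * γ ≠ 0) :
    Fintype.card F ≤ 2 * #{c : F | IsSquare (α * c ^ 2 + β * c + γ)} + 1 := by
  have h2 : (2 : F) ≠ 0 := Ring.two_ne_zero hF
  have h1 : -1 ≤ ∑ c : F, quadraticChar F (α * c ^ 2 + β * c + γ) := by
    by_cases hα : α = 0
    · subst hα
      have hβ : β ≠ 0 := fun h' => h (by simp [h'])
      have := Fintype.sum_equiv ((Equiv.mulLeft₀ β hβ).trans (Equiv.addRight γ))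
        (fun c => quadraticChar F (0 * c ^ 2 + β * c + γ)) (quadraticChar F) (fun c => by simp)
      rw [this, quadraticChar_sum_zero hF]
      norm_num
    · have h4 : (4 : F) * α ≠ 0 := mul_ne_zero (by
        rw [show (4 : F) = 2 * 2 by norm_num]; exact mul_ne_zero h2 h2) hα
      have h5 : (2 : F) * α ≠ 0 := mul_ne_zero h2 hα
      have e1 : ∀ c : F, quadraticChar F (α * c ^ 2 + β * c + γ) =
          quadraticChar F α * quadraticChar F ((2 * α * c + β) ^ 2 - (β ^ 2 - 4 * α * γ)) := by
        intro c
        have e2 : (2 * α * c + β) ^ 2 - (β ^ 2 - 4 * α * γ) =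
          2 ^ 2 * (α * (α * c ^ 2 + β * c + γ)) := by ring
        rw [e2, map_mul, map_mul, quadraticChar_sq_one' h2, one_mul, ← mul_assoc, ← sq,
          quadraticChar_sq_one hα, one_mul]
      have e3 := Fintype.sum_equiv ((Equiv.mulLeft₀ (2 * α) h5).trans (Equiv.addRight β))
        (fun c => quadraticChar F ((2 * α * c + β) ^ 2 - (β ^ 2 - 4 * α * γ)))
        (fun x => quadraticChar F (x ^ 2 - (β ^ 2 - 4 * α * γ))) (fun c => by simp)
      rw [Finset.sum_congr rfl fun c _ => e1 c, ← Finset.mul_sum, e3,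
        sum_quadraticChar_sq_sub hF h]
      rcases quadraticChar_dichotomy hα with h' | h' <;> rw [h'] <;> norm_num
  have h3 : ∑ c : F, quadraticChar F (α * c ^ 2 + β * c + γ) ≤
      ∑ c : F, ((if IsSquare (α * c ^ 2 + β * c + γ) then 2 else 0) - 1) := by
    refine Finset.sum_le_sum fun c _ => ?_
    split_ifs with hc
    · rcases quadraticChar_isQuadratic (F := F) (α * c ^ 2 + β * c + γ) with h' | h' | h' <;>
        rw [h'] <;> norm_num
    · rw [quadraticChar_neg_one_iff_not_isSquare.2 hc]
      norm_num
  rw [Finset.sum_sub_distrib, Finset.sum_const, Finset.card_univ, ← Finset.sum_filter,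
    Finset.sum_const, nsmul_eq_mul, nsmul_eq_mul] at h3
  have h4 := h1.trans h3
  zify
  linarith

/-- About half of the values of `a² - δ` are not squares. -/
theorem card_not_isSquare_sq_sub (hF : ringChar F ≠ 2) {δ : F} (hδ : δ ≠ 0) :
    Fintype.card F ≤ 2 * #{a : F | ¬ IsSquare (a ^ 2 - δ)} + 1 := by
  have h1 := sum_quadraticChar_sq_sub hF hδ
  have h3 : ∑ a : F, ((1 - (if ¬ IsSquare (a ^ 2 - δ) then 2 else 0)) -
      (if a ^ 2 = δ then 1 else 0)) ≤ ∑ a : F, quadraticChar F (a ^ 2 - δ) := by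
    refine Finset.sum_le_sum fun a _ => ?_
    by_cases h0 : a ^ 2 = δ
    · simp [h0]
    · have h0' := sub_ne_zero.2 h0
      by_cases hc : IsSquare (a ^ 2 - δ)
      · simp [hc, h0, (quadraticChar_one_iff_isSquare h0').2 hc]
      · simp [hc, h0, quadraticChar_neg_one_iff_not_isSquare.2 hc]
  have h4 : (#{a : F | a ^ 2 = δ} : ℤ) ≤ 2 := by
    have := quadraticChar_card_sqrts hF δ
    rw [Set.toFinset_ofPred] at this
    rw [this]
    rcases quadraticChar_isQuadratic (F := F) δ with h' | h' | h' <;> rw [h'] <;> norm_num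
  rw [Finset.sum_sub_distrib, Finset.sum_sub_distrib, Finset.sum_const, Finset.card_univ,
    ← Finset.sum_filter, ← Finset.sum_filter,
    Finset.sum_const, Finset.sum_const, nsmul_eq_mul, nsmul_eq_mul, nsmul_eq_mul, h1] at h3
  zify
  linarith

/-! ### Which conics have good points -/

/-- The abscissa of the double point of a degenerate conic, with the junk value `0` if
`disc X = 0`. -/
def conicVertex (A B X T : GL (Fin 2) F) : F :=
  (2 * (A⁻¹ * T).val.trace - X.val.trace * B.val.trace) / disc X.val

/-- The criterion for the conic `r ^ 2 = conicDisc c` to have good points. If it is degenerate, with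
`conicDisc c = δ (c - c₀) ^ 2` for `δ = disc X ≠ 0` or with `conicDisc` constant, then it has points
other than `(c₀, 0)` only if `δ` or the constant is a square; the point `(c₀, 0)` is tried
directly. -/
def ConicCriterion (A B X T : GL (Fin 2) F) : Prop :=
  conicDet A B X T ≠ 0 ∨ (disc X.val ≠ 0 ∧ IsSquare (disc X.val)) ∨
    (disc X.val = 0 ∧ IsSquare (disc B.val)) ∨
    pairCheck A B X T (conicPair A B X T (conicVertex A B X T) 0) = true

variable {A B X T : GL (Fin 2) F}

omit [Fintype F] [DecidableEq F] in
theorem conicDisc_of_disc_ne_zero (h : conicDet A B X T = 0) (hδ : disc X.val ≠ 0) (c : F) :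
    conicDisc A B X T c = disc X.val * (c - conicVertex A B X T) ^ 2 := by
  have h9 : disc X.val * conicVertex A B X T =
      2 * (A⁻¹ * T).val.trace - X.val.trace * B.val.trace := by
    rw [conicVertex]
    field_simp
  refine mul_left_cancel₀ hδ ?_
  rw [conicDet] at h
  rw [conicDisc]
  linear_combination (-1 : F) * h + (2 * disc X.val * c - disc X.val *
    conicVertex A B X T - (2 * (A⁻¹ * T).val.trace - X.val.trace * B.val.trace)) * h9

omit [Fintype F] [DecidableEq F] in
theorem conicDisc_of_disc_eq_zero (h : conicDet A B X T = 0) (hδ : disc X.val = 0) (c : F) :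
    conicDisc A B X T c = disc B.val := by
  rw [conicDet, hδ, zero_mul, sub_zero, sq_eq_zero_iff] at h
  rw [conicDisc, hδ]
  linear_combination 2 * c * h

omit [Fintype F] in
theorem conicCriterion_of_conicGood (hF : ringChar F ≠ 2) (hA : ¬ IsScalar A.val)
    (hB : ¬ IsScalar B.val) (hX : ¬ IsScalar X.val) (hT : IsScalar T.val)
    (hd : A.val.det * B.val.det * X.val.det = T.val.det) {c r : F}
    (h : ConicGood A B X T c r) : ConicCriterion A B X T := by
  have h2 : (2 : F) ≠ 0 := Ring.two_ne_zero hF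
  by_contra h'
  simp only [ConicCriterion, not_or, not_and, not_not] at h'
  obtain ⟨h3, h4, h5, h6⟩ := h'
  have h7 := h.1
  by_cases hδ : disc X.val = 0
  · refine h5 hδ ⟨r, ?_⟩
    rw [← conicDisc_of_disc_eq_zero h3 hδ c, ← h7, sq]
  · have h8 := conicDisc_of_disc_ne_zero h3 hδ c
    by_cases hc : c = conicVertex A B X T
    · rw [h8, hc, sub_self, zero_pow two_ne_zero, mul_zero, sq_eq_zero_iff] at h7
      rw [← hc] at h6
      rw [h7] at h
      exact h6 (pairCheck_conicPair h2 hA hB hX hT hd h)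
    · have hc' := sub_ne_zero.2 hc
      refine h4 hδ ⟨r / (c - conicVertex A B X T), ?_⟩
      rw [h8] at h7
      field_simp
      exact h7.symm

/-- If the criterion holds then the vertex of the conic is a good point, or there are good points
above half of all `c`. -/
theorem card_good_of_conicCriterion (hF : ringChar F ≠ 2) (hA : ¬ IsScalar A.val)
    (hB : ¬ IsScalar B.val) (hX : ¬ IsScalar X.val) (hT : IsScalar T.val)
    (hd : A.val.det * B.val.det * X.val.det = T.val.det) (h : ConicCriterion A B X T) :
    pairCheck A B X T (conicPair A B X T (conicVertex A B X T) 0) = true ∨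
    Fintype.card F ≤ 2 * #{c : F | IsSquare (conicDisc A B X T c) ∧ ∀ r,
      r ^ 2 = conicDisc A B X T c → pairCheck A B X T (conicPair A B X T c r) = true} + 1 := by
  have h2 : (2 : F) ≠ 0 := Ring.two_ne_zero hF
  have hd1 := det_ne_zero' X
  by_cases h3 : conicDet A B X T = 0
  · -- all `c` except for two are good
    have h4 : (disc X.val ≠ 0 ∧ IsSquare (disc X.val)) ∨ (disc X.val = 0 ∧ IsSquare (disc B.val)) →
        ∀ c, IsSquare (conicDisc A B X T c) := by
      rintro (⟨h6, δ, h7⟩ | ⟨h6, h7⟩) c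
      · rw [conicDisc_of_disc_ne_zero h3 h6, h7]
        exact ⟨δ * (c - conicVertex A B X T), by ring⟩
      · rwa [conicDisc_of_disc_eq_zero h3 h6]
    have h5 : (∀ c, IsSquare (conicDisc A B X T c)) →
        Fintype.card F ≤ 2 * #{c : F | IsSquare (conicDisc A B X T c) ∧ ∀ r,
          r ^ 2 = conicDisc A B X T c → pairCheck A B X T (conicPair A B X T c r) = true} + 1 := by
      intro h6
      have h7 : univ \ {0, -(A⁻¹ * T).val.trace / (2 * X.val.det)} ⊆
          ({c : F | IsSquare (conicDisc A B X T c) ∧ ∀ r, r ^ 2 = conicDisc A B X T c →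
            pairCheck A B X T (conicPair A B X T c r) = true} : Finset F) := by
        intro c hc
        simp only [mem_sdiff, mem_univ, mem_insert, mem_singleton, true_and, not_or] at hc
        refine mem_filter.2 ⟨mem_univ _, h6 c, fun r hr => pairCheck_conicPair h2 hA hB hX hT hd
          (conicGood_of h2 hr (Or.inr ⟨hc.1, fun h' => hc.2 ?_⟩))⟩
        rw [eq_div_iff (mul_ne_zero h2 hd1)]
        linear_combination h'
      have h8 := card_le_card h7
      have h9 := (le_card_sdiff {0, -(A⁻¹ * T).val.trace / (2 * X.val.det)} univ).trans h8
      have h10 : #({0, -(A⁻¹ * T).val.trace / (2 * X.val.det)} : Finset F) ≤ 2 := card_le_two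
      have h11 := FiniteField.odd_card_of_char_ne_two hF
      have h12 := Fintype.one_lt_card (α := F)
      rw [card_univ] at h9
      omega
    rcases h with h | h | h | h
    · exact absurd h3 h
    · exact Or.inr (h5 (h4 (Or.inl h)))
    · exact Or.inr (h5 (h4 (Or.inr h)))
    · exact Or.inl h
  · -- all points of a nondegenerate conic are good
    right
    refine (card_isSquare_quadratic hF (α := disc X.val)
      (β := 2 * X.val.trace * B.val.trace - 4 * (A⁻¹ * T).val.trace) (γ := disc B.val)
      (fun h' => h3 ?_)).trans ?_
    · rw [conicDet]
      have h4 : (4 : F) ≠ 0 := by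
        rw [show (4 : F) = 2 * 2 by norm_num]; exact mul_ne_zero h2 h2
      refine (mul_eq_zero.1 (?_ : (4 : F) * _ = 0)).resolve_left h4
      linear_combination h'
    · gcongr with c
      exact fun hc => ⟨hc, fun r hr => pairCheck_conicPair h2 hA hB hX hT hd
        (conicGood_of h2 hr (Or.inl h3))⟩

end

/-! ### Square roots modulo a prime -/

section

variable {p : ℕ} [Fact p.Prime]

/-- Cipolla's square root of `d`: the rational part of `(a + √(a² - d)) ^ ((p + 1) / 2)`, computed
with matrices. It is a square root of `d` if `d` has one and `a² - d` has none. -/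
def cipolla (d a : ZMod p) : ZMod p :=
  if d = 0 then 0 else (!![a, a ^ 2 - d; 1, a] ^ ((p + 1) / 2)) 0 0

theorem cipolla_sq (hp : p ≠ 2) {d a : ZMod p} (hd : IsSquare d)
    (ha : d ≠ 0 → ¬ IsSquare (a ^ 2 - d)) : cipolla d a ^ 2 = d := by
  by_cases hd0 : d = 0
  · simp [cipolla, hd0]
  replace ha := ha hd0
  rw [cipolla, if_neg hd0]
  obtain ⟨k, hk⟩ := (Fact.out : p.Prime).odd_of_ne_two hp
  generalize hw : a ^ 2 - d = w at ha ⊢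
  have hw0 : w ≠ 0 := fun h => ha (h ▸ IsSquare.zero)
  have hwk : w ^ k = -1 := by
    have h1 := ZMod.euler_criterion p hw0
    have h2 := ZMod.pow_div_two_eq_neg_one_or_one p hw0
    rw [show p / 2 = k by omega] at h1 h2
    exact h2.resolve_left fun h => ha (h1.2 h)
  set W : Matrix (Fin 2) (Fin 2) (ZMod p) := !![0, w; 1, 0] with hW
  have hW2 : W ^ 2 = w • 1 := by
    rw [sq, hW, Matrix.mul_fin_two, Matrix.one_fin_two]
    ext i j; fin_cases i <;> fin_cases j <;> simp
  have hM : !![a, w; 1, a] = a • 1 + W := by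
    rw [hW, Matrix.one_fin_two]
    ext i j; fin_cases i <;> fin_cases j <;> simp
  -- the Frobenius map sends `√w` to `-√w`, so the power `p + 1` is the norm
  have hWp : W ^ p = -W := by
    refine (congrArg (W ^ ·) hk).trans ?_
    change W ^ (2 * k + 1) = -W
    rw [pow_succ, pow_mul, hW2, smul_pow, hwk, one_pow, neg_smul, one_smul, neg_one_mul]
  have hMp : (a • 1 + W) ^ p = a • 1 - W := by
    have hc : Commute (a • (1 : Matrix (Fin 2) (Fin 2) (ZMod p))) W :=
      (Commute.one_left W).smul_left a
    rw [add_pow_char_of_commute _ hc, hWp, smul_pow, one_pow, ZMod.pow_card, sub_eq_add_neg]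
  have hMp1 : (a • 1 + W) ^ (p + 1) = d • 1 := by
    have h1 : d = a ^ 2 - w := by rw [← hw]; ring
    rw [pow_succ, hMp, h1, hW, Matrix.one_fin_two]
    ext i j; fin_cases i <;> fin_cases j <;>
      simp [Matrix.mul_apply, Fin.sum_univ_two] <;> ring
  have hform : ∀ n, ∃ u v : ZMod p, !![a, w; 1, a] ^ n = !![u, w * v; v, u] := by
    intro n
    induction n with
    | zero => exact ⟨1, 0, by rw [pow_zero, Matrix.one_fin_two, mul_zero]⟩
    | succ n ih =>
      obtain ⟨u, v, h⟩ := ih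
      refine ⟨u * a + w * v, v * a + u, ?_⟩
      rw [pow_succ, h, Matrix.mul_fin_two]
      ext i j; fin_cases i <;> fin_cases j <;> simp <;> ring
  obtain ⟨u, v, h⟩ := hform ((p + 1) / 2)
  have h2 : (!![a, w; 1, a] ^ ((p + 1) / 2)) ^ 2 = d • 1 := by
    rw [← pow_mul, show (p + 1) / 2 * 2 = p + 1 by omega, hM, hMp1]
  rw [h] at h2 ⊢
  rw [sq, Matrix.mul_fin_two] at h2
  have e1 : u * u + w * v * v = d := by simpa using congrFun (congrFun h2 0) 0
  have e2 : v * u + u * v = 0 := by simpa using congrFun (congrFun h2 1) 0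
  have e3 : (2 : ZMod p) ≠ 0 := Ring.two_ne_zero (by rwa [ZMod.ringChar_zmod_n])
  change u ^ 2 = d
  have e4 : u = 0 ∨ v = 0 := by
    have : 2 * (u * v) = 0 := by linear_combination e2
    exact mul_eq_zero.1 ((mul_eq_zero.1 this).resolve_left e3)
  rcases e4 with rfl | rfl
  · exfalso
    obtain ⟨s, hs⟩ := hd
    have hv : v ≠ 0 := fun hv => hd0 (by rw [← e1, hv]; ring)
    refine ha ⟨s / v, ?_⟩
    field_simp
    linear_combination e1 + hs
  · linear_combination e1

theorem isSquare_iff_pow (x : ZMod p) : IsSquare x ↔ x = 0 ∨ x ^ (p / 2) = 1 := by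
  by_cases h : x = 0
  · simp [h]
  · simp [h, ZMod.euler_criterion p h]

end

/-! ### Scalar matrices -/

section

variable {F : Type*} [Field F] [DecidableEq F]

/-- The product of the scalar matrices in a list. -/
def scalarPart (C : List (GL (Fin 2) F)) : GL (Fin 2) F :=
  C.foldr (fun M s => if IsScalar M.val then M * s else s) 1

/-- The non-scalar matrices in a list. -/
def nonscalars (C : List (GL (Fin 2) F)) : List (GL (Fin 2) F) :=
  C.filter fun M => decide (¬ IsScalar M.val)

/-- The conjugators `zs` for the non-scalar matrices in a list, filled up with `1` at the scalar
matrices. -/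
def spread : List (GL (Fin 2) F) → List (GL (Fin 2) F) → List (GL (Fin 2) F)
  | [], _ => []
  | M :: C, zs => if IsScalar M.val then 1 :: spread C zs else zs.headD 1 :: spread C zs.tail

theorem isScalar_scalarPart (C : List (GL (Fin 2) F)) : IsScalar (scalarPart C).val := by
  induction C with
  | nil => exact isScalar_one
  | cons M C ih =>
    rw [scalarPart, List.foldr_cons, ← scalarPart]
    split_ifs with h
    · exact isScalar_mul h ih
    · exact ih

theorem solvesTo_spread {C zs : List (GL (Fin 2) F)} {h : GL (Fin 2) F}
    (hz : SolvesTo (nonscalars C) zs ((scalarPart C)⁻¹ * h)) : SolvesTo C (spread C zs) h := by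
  induction C generalizing zs h with
  | nil =>
    rw [nonscalars, List.filter_nil, solvesTo_nil] at hz
    exact solvesTo_nil.2 ⟨rfl, by simpa [scalarPart] using hz.2⟩
  | cons M C ih =>
    have hs : scalarPart (M :: C) = if IsScalar M.val then M * scalarPart C else scalarPart C := rfl
    rw [hs] at hz
    rw [spread]
    by_cases hM : IsScalar M.val
    · rw [nonscalars, List.filter_cons_of_neg (by simpa using hM), ← nonscalars, if_pos hM] at hz
      rw [if_pos hM]
      refine solvesTo_cons.2 ⟨1, _, rfl, ih ?_⟩
      rw [show (scalarPart C)⁻¹ * ((1⁻¹ * M * 1)⁻¹ * h) = (M * scalarPart C)⁻¹ * h by group]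
      exact hz
    · rw [nonscalars, List.filter_cons_of_pos (by simpa using hM), ← nonscalars, if_neg hM] at hz
      rw [if_neg hM]
      obtain ⟨y, z', rfl, hz'⟩ := solvesTo_cons.1 hz
      refine solvesTo_cons.2 ⟨y, _, rfl, ih ?_⟩
      have := isScalar_commute (isScalar_inv (isScalar_scalarPart C)) (y⁻¹ * M * y)⁻¹
      rwa [← mul_assoc, ← this, mul_assoc]

theorem solvesTo_nonscalars {C z : List (GL (Fin 2) F)} {h : GL (Fin 2) F}
    (hz : SolvesTo C z h) : ∃ zs, SolvesTo (nonscalars C) zs ((scalarPart C)⁻¹ * h) := by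
  induction C generalizing z h with
  | nil => exact ⟨[], solvesTo_nil.2 ⟨rfl, by simp [scalarPart, (solvesTo_nil.1 hz).2]⟩⟩
  | cons M C ih =>
    have hs : scalarPart (M :: C) = if IsScalar M.val then M * scalarPart C else scalarPart C := rfl
    rw [hs]
    obtain ⟨y, z', rfl, hz'⟩ := solvesTo_cons.1 hz
    obtain ⟨zs, hzs⟩ := ih hz'
    by_cases hM : IsScalar M.val
    · rw [nonscalars, List.filter_cons_of_neg (by simpa using hM), ← nonscalars, if_pos hM]
      refine ⟨zs, ?_⟩
      rw [mul_assoc, ← isScalar_commute hM, inv_mul_cancel_left] at hzs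
      rwa [mul_inv_rev, mul_assoc]
    · rw [nonscalars, List.filter_cons_of_pos (by simpa using hM), ← nonscalars, if_neg hM]
      refine ⟨y :: zs, solvesTo_cons.2 ⟨y, zs, rfl, ?_⟩⟩
      have := isScalar_commute (isScalar_inv (isScalar_scalarPart C)) (y⁻¹ * M * y)⁻¹
      rwa [← mul_assoc, this, mul_assoc]

end

/-! ### The algorithm for primes greater than three -/

section

variable {p : ℕ} [Fact p.Prime]

/-- The conjugators for the point of the conic above `x.1`, with the square root computed
from `x.2`. -/
def conicTrial (A B X T : GL (Fin 2) (ZMod p)) (x : ZMod p × ZMod p) :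
    GL (Fin 2) (ZMod p) × GL (Fin 2) (ZMod p) :=
  conicPair A B X T x.1 (cipolla (conicDisc A B X T x.1) x.2)

/-- The candidates for the first two conjugators: the only choice if there are just two matrices,
the vertex of the conic, and the points of the conic for given random pairs. -/
def candidates (A B X T : GL (Fin 2) (ZMod p)) (tr : List (ZMod p × ZMod p)) :
    List (GL (Fin 2) (ZMod p) × GL (Fin 2) (ZMod p)) :=
  (1, conjOf B (A⁻¹ * T)) :: conicPair A B X T (conicVertex A B X T) 0 ::
    tr.map (conicTrial A B X T)

/-- The search for a solution of the equation with non-scalar constants `N` and scalar right-hand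
side `T`, using the random pairs `tr`. -/
def searchNonscalar (N : List (GL (Fin 2) (ZMod p))) (T : GL (Fin 2) (ZMod p))
    (tr : List (ZMod p × ZMod p)) : Option (List (GL (Fin 2) (ZMod p))) :=
  if N.isEmpty then if T = 1 then some [] else none
  else if N.tail.isEmpty then none
  else
    let X := chain N.tail.tail
    let o := (candidates (N.headD 1) (N.tail.headD 1) X.1 T tr).find?
      (pairCheck (N.headD 1) (N.tail.headD 1) X.1 T)
    if o.isSome then some ((o.getD 1).1 :: (o.getD 1).2 :: X.2) else none

/-- The decision whether the equation with non-scalar constants `N` and scalar right-hand side `T`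
has a solution. -/
def DecideNonscalar (N : List (GL (Fin 2) (ZMod p))) (T : GL (Fin 2) (ZMod p)) : Prop :=
  if N.isEmpty then T = 1
  else if N.tail.isEmpty then False
  else
    let X := chain N.tail.tail
    (N.headD 1).val.det * (N.tail.headD 1).val.det * X.1.val.det = T.val.det ∧
    if N.tail.tail.isEmpty then
      pairCheck (N.headD 1) (N.tail.headD 1) X.1 T
        (1, conjOf (N.tail.headD 1) ((N.headD 1)⁻¹ * T)) = true
    else ConicCriterion (N.headD 1) (N.tail.headD 1) X.1 T

theorem pairCheck_two {A B T : GL (Fin 2) (ZMod p)} (hT : IsScalar T.val)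
    (hB : ¬ IsScalar B.val) {z : List (GL (Fin 2) (ZMod p))} (hz : SolvesTo [A, B] z T) :
    pairCheck A B 1 T (1, conjOf B (A⁻¹ * T)) = true := by
  obtain ⟨z1, w1, rfl, hz1⟩ := solvesTo_cons.1 hz
  obtain ⟨z2, w2, rfl, hz2⟩ := solvesTo_cons.1 hz1
  have h1 := (solvesTo_nil.1 hz2).2
  have h2 : A⁻¹ * T = (z2 * z1⁻¹)⁻¹ * B * (z2 * z1⁻¹) := by
    have h3 : z2⁻¹ * B * z2 = (z1⁻¹ * A * z1)⁻¹ * T := inv_mul_eq_one.1 h1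
    calc A⁻¹ * T = z1 * ((z1⁻¹ * A * z1)⁻¹ * (z1⁻¹ * T * z1)) * z1⁻¹ := by group
      _ = z1 * ((z1⁻¹ * A * z1)⁻¹ * T) * z1⁻¹ := by
        rw [isScalar_commute hT z1⁻¹, inv_mul_cancel_right]
      _ = _ := by rw [← h3]; group
  have h4 : ¬ IsScalar (A⁻¹ * T).val := by rw [h2, isScalar_conj]; exact hB
  rw [pairCheck, decide_eq_true_iff, conjOf_spec hB h4 (by rw [h2, trace_conj])
    (by rw [h2, det_conj])]
  group

theorem not_solvesTo_singleton {A T : GL (Fin 2) (ZMod p)} (hA : ¬ IsScalar A.val)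
    (hT : IsScalar T.val) (z : List (GL (Fin 2) (ZMod p))) : ¬ SolvesTo [A] z T := by
  intro hz
  obtain ⟨z1, w1, rfl, hz1⟩ := solvesTo_cons.1 hz
  have h1 := inv_mul_eq_one.1 (solvesTo_nil.1 hz1).2
  rw [← h1, isScalar_conj] at hT
  exact hA hT

theorem solvesTo_of_pairCheck {A B X T : GL (Fin 2) (ZMod p)}
    {x : GL (Fin 2) (ZMod p) × GL (Fin 2) (ZMod p)} (h : pairCheck A B X T x = true)
    {C z : List (GL (Fin 2) (ZMod p))} (hz : SolvesTo C z X) :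
    SolvesTo (A :: B :: C) (x.1 :: x.2 :: z) T := by
  rw [pairCheck, decide_eq_true_iff] at h
  refine solvesTo_cons.2 ⟨_, _, rfl, solvesTo_cons.2 ⟨_, _, rfl, ?_⟩⟩
  rwa [← h, show (x.2⁻¹ * B * x.2)⁻¹ * ((x.1⁻¹ * A * x.1)⁻¹ *
    (x.1⁻¹ * A * x.1 * (x.2⁻¹ * B * x.2) * X)) = X by group]

variable (hp : 5 ≤ p) {N : List (GL (Fin 2) (ZMod p))} {T : GL (Fin 2) (ZMod p)}
  (hN : ∀ M ∈ N, ¬ IsScalar M.val) (hT : IsScalar T.val)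

include hp

theorem natCast_ne_zero_of_lt {n : ℕ} (h0 : n ≠ 0) (hn : n < 5) : (n : ZMod p) ≠ 0 := by
  rw [Ne, ZMod.natCast_eq_zero_iff]
  exact fun h => absurd (Nat.le_of_dvd (by omega) h) (by omega)

theorem chain_spec_zmod (hN : ∀ M ∈ N, ¬ IsScalar M.val) :
    SolvesTo N (chain N).2 (chain N).1 ∧ (N ≠ [] → ¬ IsScalar (chain N).1.val) ∧
      (2 ≤ N.length → ∃ δ : ZMod p, δ ≠ 0 ∧ disc (chain N).1.val = δ ^ 2) :=
  chain_spec (by exact_mod_cast natCast_ne_zero_of_lt hp (n := 2) (by norm_num) (by norm_num))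
    (by exact_mod_cast natCast_ne_zero_of_lt hp (n := 3) (by norm_num) (by norm_num)) N hN

include hN

theorem solvesTo_of_searchNonscalar {tr : List (ZMod p × ZMod p)}
    {z : List (GL (Fin 2) (ZMod p))} (h : searchNonscalar N T tr = some z) : SolvesTo N z T := by
  match N, hN with
  | [], _ =>
    simp only [searchNonscalar, List.isEmpty_nil, if_true] at h
    split_ifs at h with h1
    exact solvesTo_nil.2 ⟨(Option.some.inj h).symm, h1⟩
  | [A], _ => simp [searchNonscalar] at h
  | A :: B :: C, hN =>
    simp only [searchNonscalar, List.isEmpty_cons, List.tail_cons, List.headD_cons] at h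
    cases ho : (candidates A B (chain C).1 T tr).find? (pairCheck A B (chain C).1 T) with
    | none => simp [ho] at h
    | some x =>
      simp only [ho, Option.isSome_some, if_true, Option.getD_some, Option.some.injEq,
        Bool.false_eq_true, if_false] at h
      subst h
      exact solvesTo_of_pairCheck (List.find?_some ho)
        (chain_spec_zmod hp fun M hM => hN M (by simp [hM])).1

omit hp hN in
theorem isSome_searchNonscalar {A B : GL (Fin 2) (ZMod p)} {C : List (GL (Fin 2) (ZMod p))}
    {tr : List (ZMod p × ZMod p)}
    {x : GL (Fin 2) (ZMod p) × GL (Fin 2) (ZMod p)} (hx : x ∈ candidates A B (chain C).1 T tr)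
    (h : pairCheck A B (chain C).1 T x = true) :
    (searchNonscalar (A :: B :: C) T tr).isSome = true := by
  have h1 : ((candidates A B (chain C).1 T tr).find? (pairCheck A B (chain C).1 T)).isSome =
      true := List.find?_isSome.2 ⟨x, hx, h⟩
  simp [searchNonscalar, h1]

include hT

theorem decideNonscalar_of_solvesTo {z : List (GL (Fin 2) (ZMod p))} (hz : SolvesTo N z T) :
    DecideNonscalar N T := by
  have hF : ringChar (ZMod p) ≠ 2 := by rw [ZMod.ringChar_zmod_n]; omega
  match N, hN, hz with
  | [], _, hz => exact (solvesTo_nil.1 hz).2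
  | [A], hN, hz => exact absurd hz (not_solvesTo_singleton (hN A (by simp)) hT z)
  | A :: B :: C, hN, hz =>
    obtain ⟨c1, c2, c3⟩ := chain_spec_zmod hp (N := C) fun M hM => hN M (by simp [hM])
    have hA := hN A (by simp)
    have hB := hN B (by simp)
    have hd : A.val.det * B.val.det * (chain C).1.val.det = T.val.det := by
      rw [← det_eq_of_solvesTo hz, ← det_eq_of_solvesTo c1, List.map_cons, List.map_cons,
        List.prod_cons, List.prod_cons, mul_assoc]
    simp only [DecideNonscalar, List.isEmpty_cons, List.tail_cons, List.headD_cons,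
      Bool.false_eq_true, if_false]
    refine ⟨hd, ?_⟩
    match C, c2, c3 with
    | [], _, _ => exact pairCheck_two hT hB hz
    | [X], c2, _ =>
      obtain ⟨c, r, h⟩ := exists_conicGood (Ring.two_ne_zero hF) hA hB (c2 (by simp)) hT hz
      exact conicCriterion_of_conicGood hF hA hB (c2 (by simp)) hT hd h
    | X :: Y :: C, _, c3 =>
      obtain ⟨δ, h1, h2⟩ := c3 (by simp)
      exact Or.inr (Or.inl ⟨h2 ▸ pow_ne_zero 2 h1, h2 ▸ IsSquare.sq δ⟩)

open Finset in
/-- If the decision is positive then the search succeeds as soon as one of the pairs `(c, a)` is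
good, where about half of all `c` are good, and then about half of all `a`. -/
theorem exists_good_pairs (h : DecideNonscalar N T) :
    ∃ (S : Finset (ZMod p)) (R : ZMod p → Finset (ZMod p)), p ≤ 2 * #S + 1 ∧
      (∀ c ∈ S, p ≤ 2 * #(R c) + 1) ∧
      ∀ tr : List (ZMod p × ZMod p), (∃ x ∈ tr, x.1 ∈ S ∧ x.2 ∈ R x.1) →
        (searchNonscalar N T tr).isSome = true := by
  have hF : ringChar (ZMod p) ≠ 2 := by rw [ZMod.ringChar_zmod_n]; omega
  have huniv : p ≤ 2 * #(univ : Finset (ZMod p)) + 1 := by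
    rw [card_univ, ZMod.card]; omega
  -- cases in which the search does not depend on the random pairs
  have hdet : (∀ tr, (searchNonscalar N T tr).isSome = true) →
      ∃ (S : Finset (ZMod p)) (R : ZMod p → Finset (ZMod p)), p ≤ 2 * #S + 1 ∧
      (∀ c ∈ S, p ≤ 2 * #(R c) + 1) ∧
      ∀ tr : List (ZMod p × ZMod p), (∃ x ∈ tr, x.1 ∈ S ∧ x.2 ∈ R x.1) →
        (searchNonscalar N T tr).isSome = true :=
    fun h => ⟨univ, fun _ => univ, huniv, fun _ _ => huniv, fun tr _ => h tr⟩
  match N, hN, h, hdet with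
  | [], _, h, hdet =>
    have h : T = 1 := h
    exact hdet fun tr => by simp [searchNonscalar, h]
  | [A], _, h, _ => exact False.elim h
  | A :: B :: C, hN, h, hdet =>
    obtain ⟨c1, c2, c3⟩ := chain_spec_zmod hp (N := C) fun M hM => hN M (by simp [hM])
    have hA := hN A (by simp)
    have hB := hN B (by simp)
    obtain ⟨hd, h⟩ : A.val.det * B.val.det * (chain C).1.val.det = T.val.det ∧
      if C.isEmpty = true then
        pairCheck A B (chain C).1 T (1, conjOf B (A⁻¹ * T)) = true
      else ConicCriterion A B (chain C).1 T := h
    by_cases hC : C.isEmpty = true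
    · rw [if_pos hC] at h
      exact hdet fun tr => isSome_searchNonscalar (by simp [candidates]) h
    · rw [if_neg hC] at h
      replace c2 := c2 (by simpa using hC)
      rcases card_good_of_conicCriterion hF hA hB c2 hT hd h with h1 | h1
      · exact hdet fun tr => isSome_searchNonscalar (by simp [candidates]) h1
      · rw [ZMod.card] at h1
        refine ⟨_, fun c => if conicDisc A B (chain C).1 T c = 0 then univ else
          ({a | ¬ IsSquare (a ^ 2 - conicDisc A B (chain C).1 T c)} : Finset (ZMod p)), h1,
          fun c _ => ?_, fun tr hx => ?_⟩
        · beta_reduce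
          split_ifs with h0
          · exact huniv
          · have := card_not_isSquare_sq_sub hF h0
            rwa [ZMod.card] at this
        · obtain ⟨⟨c, a⟩, hx, hx1, hx2⟩ := hx
          obtain ⟨hc1, hc2⟩ := (mem_filter.1 hx1).2
          refine isSome_searchNonscalar (x := conicTrial A B (chain C).1 T (c, a)) ?_
            (hc2 _ (cipolla_sq (by omega) hc1 ?_))
          · exact List.mem_cons_of_mem _ (List.mem_cons_of_mem _
              (List.mem_map.2 ⟨(c, a), hx, rfl⟩))
          · intro h0
            simp only [if_neg h0] at hx2
            exact (mem_filter.1 hx2).2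

/-- A positive decision yields a solution because good pairs exist; that half of all pairs are
good is not needed here. -/
theorem decideNonscalar_iff : DecideNonscalar N T ↔ ∃ z, SolvesTo N z T := by
  refine ⟨fun h => ?_, fun ⟨z, hz⟩ => decideNonscalar_of_solvesTo hp hN hT hz⟩
  obtain ⟨S, R, h1, h2, h3⟩ := exists_good_pairs hp hN hT h
  obtain ⟨c, hc⟩ : S.Nonempty := Finset.card_pos.1 (by omega)
  have h4 := h2 c hc
  obtain ⟨a, ha⟩ : (R c).Nonempty := Finset.card_pos.1 (by omega)
  obtain ⟨z, hz⟩ := Option.isSome_iff_exists.1 (h3 [(c, a)] ⟨(c, a), by simp, hc, ha⟩)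
  exact ⟨z, solvesTo_of_searchNonscalar hp hN hz⟩

omit hT in
/-- With at least four non-scalar constants only the determinants matter: all but the first two can
be merged into one matrix whose discriminant is a nonzero square, and then the criterion holds. -/
theorem isSolvable_of_four_le (hlen : 4 ≤ N.length)
    (hdet : (N.map fun M => M.val.det).prod = 1) : ∃ z, SolvesTo N z 1 := by
  refine (decideNonscalar_iff hp hN isScalar_one).1 ?_
  match N, hN, hlen, hdet with
  | A :: B :: X :: Y :: C, hN, _, hdet =>
    obtain ⟨c1, c2, c3⟩ := chain_spec_zmod hp (N := X :: Y :: C) fun M hM => hN M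
      (List.mem_cons_of_mem _ (List.mem_cons_of_mem _ hM))
    obtain ⟨δ, h1, h2⟩ := c3 (by simp)
    have h3 : A.val.det * B.val.det * (chain (X :: Y :: C)).1.val.det =
        (1 : GL (Fin 2) (ZMod p)).val.det := by
      rw [List.map_cons, List.map_cons, List.prod_cons, List.prod_cons] at hdet
      rw [← det_eq_of_solvesTo c1, Units.val_one, Matrix.det_one, mul_assoc, hdet]
    exact ⟨h3, Or.inr (Or.inl ⟨h2 ▸ pow_ne_zero 2 h1, h2 ▸ IsSquare.sq δ⟩)⟩

end

/-! ### The algorithm runs in polynomial time -/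

section

variable {F : Type*} [Field F] [DecidableEq F]

/-- One step of `spread`, from the left, with the output in reverse order. -/
def spreadStep (s : List (GL (Fin 2) F) × List (GL (Fin 2) F)) (M : GL (Fin 2) F) :
    List (GL (Fin 2) F) × List (GL (Fin 2) F) :=
  if IsScalar M.val then (s.1, 1 :: s.2) else (s.1.tail, s.1.headD 1 :: s.2)

theorem spread_eq_foldl (C zs out : List (GL (Fin 2) F)) :
    (C.foldl spreadStep (zs, out)).2.reverse = out.reverse ++ spread C zs := by
  induction C generalizing zs out with
  | nil => simp [spread]
  | cons M C ih =>
    rw [List.foldl_cons, spread, spreadStep]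
    split_ifs with h <;> rw [ih] <;> simp

end

namespace PTime

variable {α : Type} {e : α → Word}

theorem of_iff {c d : α → Prop} [∀ a, Decidable (c a)] [∀ a, Decidable (d a)]
    (h : PTime e fun a => decide (c a)) (hcd : ∀ a, c a ↔ d a) : PTime e fun a => decide (d a) :=
  h.of_eq fun a => decide_eq_decide.2 (hcd a)

theorem eq_true {b : α → Bool} (h : PTime e b) : PTime e fun a => decide (b a = true) :=
  h.of_eq fun a => by simp

variable {p : α → ℕ} [∀ a, Fact (p a).Prime]
  {M : ∀ a, Matrix (Fin 2) (Fin 2) (ZMod (p a))}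
  {A B X T : ∀ a, GL (Fin 2) (ZMod (p a))} {c r : ∀ a, ZMod (p a)}
  {N : ∀ a, List (GL (Fin 2) (ZMod (p a)))}

theorem isScalar (hp : PTime e p) (hM : PTime e M) : PTime e (fun a => decide (IsScalar (M a))) :=
  ((hM.m01.zeq hp.zero).and ((hM.m10.zeq hp.zero).and (hM.m00.zeq hM.m11))).of_iff
    fun _ => Iff.rfl

theorem isSquare (hp : PTime e p) (hc : PTime e c) :
    PTime e (fun a => decide (IsSquare (c a))) :=
  ((hc.zeq hp.zero).or ((hp.zpow hc hp.div2).zeq hp.one)).of_iff fun a => by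
    rw [isSquare_iff_pow, Nat.div2_val]

theorem cyc (hp : PTime e p) (hM : PTime e M) : PTime e (fun a => cyc (M a)) :=
  ite' (hM.m10.zeq hp.zero).not (mk hp.one hM.m00 hp.zero hM.m10)
    (ite' (hM.m01.zeq hp.zero).not (mk hp.zero hM.m01 hp.one hM.m11)
      (mk hp.one hM.m00 hp.one hM.m11))

theorem basis (hp : PTime e p) (hA : PTime e A) : PTime e (fun a => basis (A a)) :=
  hp.toGL (hp.cyc hA.gval)

theorem conjOf (hp : PTime e p) (hA : PTime e A) (hB : PTime e B) :
    PTime e (fun a => conjOf (A a) (B a)) := hp.gmul (hp.basis hA) (hp.ginv (hp.basis hB))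

theorem inBasis (hp : PTime e p) (hX : PTime e X) (hM : PTime e M) :
    PTime e (fun a => inBasis (X a) (M a)) :=
  hp.gmul (hp.gmul (hp.basis hX) (hp.toGL hM)) (hp.ginv (hp.basis hX))

theorem disc (hp : PTime e p) (hM : PTime e M) : PTime e (fun a => disc (M a)) :=
  hp.zsub (hp.zpow (hp.mtrace hM) (const 2)) (hp.zmul (hp.natLit 4) (hp.mdet hM))

theorem splitter (hp : PTime e p) (hA : PTime e A) (hX : PTime e X) :
    PTime e (fun a => splitter (A a) (X a)) := by
  have hd := hp.mdet hA.gval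
  have hu := ite' ((hp.zmul hd (hp.mdet hX.gval)).zeq hp.one) hp.two hp.one
  exact hp.inBasis hX (mk (hp.mtrace hA.gval) hu (hp.zdiv (hp.zneg hd) hu) hp.zero)

theorem chain (hp : PTime e p) (hN : PTime e N) : PTime e (fun a => chain (N a)) := by
  obtain ⟨K, hK⟩ := exists_length_gl_le hp
  have hx := elem (e := e) (σ := fun a => GL (Fin 2) (ZMod (p a)) × List (GL (Fin 2) (ZMod (p a))))
    (β := fun a => GL (Fin 2) (ZMod (p a)))
  have hs := state (e := e) (σ := fun a => GL (Fin 2) (ZMod (p a)) × List (GL (Fin 2) (ZMod (p a))))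
    (β := fun a => GL (Fin 2) (ZMod (p a)))
  have hsp := hp.ctx.splitter hx hs.fst
  refine foldr (e := e) (σ := fun a => GL (Fin 2) (ZMod (p a)) × List (GL (Fin 2) (ZMod (p a))))
    (step := fun a M s => if s.2.isEmpty then (M, [1]) else
      (_root_.splitter M s.1 * s.1, _root_.conjOf M (_root_.splitter M s.1) :: s.2))
    (i := fun _ => (1, []))
    (hs.snd.isEmpty.ite (hx.pair (hp.ctx.gone.cons nil))
      ((hp.ctx.gmul hsp hs.fst).pair ((hp.ctx.conjOf hx hsp).cons hs.snd)))
    (hp.gone.pair nil) hN ⟨4 * K + 2, ?_⟩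
  rintro a ⟨X, zs⟩ M -
  have h0 : (enc ([] : List (GL (Fin 2) (ZMod (p a))))).length = 0 := rfl
  have h1 := hK a M
  have h2 := hK a 1
  have h3 := hK a (_root_.splitter M X * X)
  have h4 := hK a (_root_.conjOf M (_root_.splitter M X))
  simp only [Polynomial.eval_add, Polynomial.eval_mul, Polynomial.eval_ofNat]
  split_ifs
  · simp only [length_enc_prod, length_enc_cons, h0]
    omega
  · simp only [length_enc_prod, length_enc_cons]
    omega

theorem scalarPart (hp : PTime e p) (hN : PTime e N) : PTime e (fun a => scalarPart (N a)) := by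
  obtain ⟨K, hK⟩ := exists_length_gl_le hp
  have hx := elem (e := e) (σ := fun a => GL (Fin 2) (ZMod (p a)))
    (β := fun a => GL (Fin 2) (ZMod (p a)))
  have hs := state (e := e) (σ := fun a => GL (Fin 2) (ZMod (p a)))
    (β := fun a => GL (Fin 2) (ZMod (p a)))
  have h1 := ite' (hp.ctx.isScalar hx.gval) (hp.ctx.gmul hx hs) hs
  exact foldr (e := e) (σ := fun a => GL (Fin 2) (ZMod (p a)))
    (β := fun a => GL (Fin 2) (ZMod (p a)))
    (step := fun a M s => if IsScalar M.val then M * s else s) h1 hp.gone hN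
    ⟨K, fun a s M _ => Nat.le_add_left_of_le (hK a (if IsScalar M.val then M * s else s))⟩

theorem nonscalars (hp : PTime e p) (hN : PTime e N) : PTime e (fun a => nonscalars (N a)) :=
  filter (hp.ctx.isScalar elem.gval).not hN

theorem spreadStep (hp : PTime e p)
    {s : ∀ a, List (GL (Fin 2) (ZMod (p a))) × List (GL (Fin 2) (ZMod (p a)))}
    (hs : PTime e s) (hA : PTime e A) : PTime e (fun a => spreadStep (s a) (A a)) := by
  have h1 := hs.fst.pair (hp.gone.cons hs.snd)
  have h2 := hs.fst.tail.pair ((hs.fst.headD hp.gone).cons hs.snd)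
  exact ite' (hp.isScalar hA.gval) h1 h2

theorem spread (hp : PTime e p) {zs : ∀ a, List (GL (Fin 2) (ZMod (p a)))} (hN : PTime e N)
    (hz : PTime e zs) : PTime e (fun a => spread (N a) (zs a)) := by
  obtain ⟨K, hK⟩ := exists_length_gl_le hp
  have h := foldl (e := e) (step := fun a s M => _root_.spreadStep s M)
    (hp.ctx.spreadStep state elem) (hz.pair nil) hN ⟨2 * K + 1, ?_⟩
  · exact h.snd.reverse.of_eq fun a => (spread_eq_foldl _ _ []).trans (by simp)
  · rintro a ⟨zs, out⟩ M -
    have h1 := hK a 1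
    have h2 := hK a (zs.headD 1)
    have h3 : (enc zs.tail).length ≤ (enc zs).length := by
      cases zs with
      | nil => exact le_rfl
      | cons z zs => rw [List.tail_cons, length_enc_cons]; omega
    simp only [Polynomial.eval_add, Polynomial.eval_mul, Polynomial.eval_ofNat,
      Polynomial.eval_one]
    rw [_root_.spreadStep]
    split_ifs <;> simp only [length_enc_prod, length_enc_cons] <;> omega

section conic

variable (hp : PTime e p) (hA : PTime e A) (hB : PTime e B) (hX : PTime e X) (hT : PTime e T)

include hp hA hB hX hT

theorem conicDisc (hc : PTime e c) :
    PTime e (fun a => conicDisc (A a) (B a) (X a) (T a) (c a)) := by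
  have hb := hp.zsub (hp.zmul (hp.zmul hp.two (hp.mtrace hX.gval)) (hp.mtrace hB.gval))
    (hp.zmul (hp.natLit 4) (hp.mtrace (hp.gmul (hp.ginv hA) hT).gval))
  exact hp.zadd (hp.zadd (hp.zmul (hp.disc hX.gval) (hp.zpow hc (const 2))) (hp.zmul hb hc))
    (hp.disc hB.gval)

theorem conicDet : PTime e (fun a => conicDet (A a) (B a) (X a) (T a)) :=
  hp.zsub (hp.zpow (hp.zsub (hp.zmul (hp.mtrace hX.gval) (hp.mtrace hB.gval))
    (hp.zmul hp.two (hp.mtrace (hp.gmul (hp.ginv hA) hT).gval))) (const 2))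
    (hp.zmul (hp.disc hX.gval) (hp.disc hB.gval))

theorem conicVertex : PTime e (fun a => conicVertex (A a) (B a) (X a) (T a)) :=
  hp.zdiv (hp.zsub (hp.zmul hp.two (hp.mtrace (hp.gmul (hp.ginv hA) hT).gval))
    (hp.zmul (hp.mtrace hX.gval) (hp.mtrace hB.gval))) (hp.disc hX.gval)

theorem conicMatrix (hc : PTime e c) (hr : PTime e r) :
    PTime e (fun a => conicMatrix (A a) (B a) (X a) (T a) (c a) (r a)) := by
  have ha := hp.zdiv (hp.zadd (hp.zsub (hp.mtrace hB.gval) (hp.zmul (hp.mtrace hX.gval) hc)) hr)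
    hp.two
  have hd := hp.zsub (hp.mtrace hB.gval) ha
  exact mk ha (hp.zadd (hp.zsub (hp.mtrace (hp.gmul (hp.ginv hA) hT).gval)
    (hp.zmul (hp.mtrace hX.gval) hd)) (hp.zmul (hp.mdet hX.gval) hc)) hc hd

theorem conicPair (hc : PTime e c) (hr : PTime e r) :
    PTime e (fun a => conicPair (A a) (B a) (X a) (T a) (c a) (r a)) := by
  have hB' := hp.inBasis hX (hp.conicMatrix hA hB hX hT hc hr)
  exact (hp.conjOf hA (hp.gmul hT (hp.ginv (hp.gmul hB' hX)))).pair (hp.conjOf hB hB')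

theorem pairCheck {z : ∀ a, GL (Fin 2) (ZMod (p a)) × GL (Fin 2) (ZMod (p a))}
    (hz : PTime e z) : PTime e (fun a => pairCheck (A a) (B a) (X a) (T a) (z a)) :=
  (hp.gmul (hp.gmul (hp.conjBy hA hz.fst) (hp.conjBy hB hz.snd)) hX).geq hT

open Classical in
theorem conicCriterion : PTime e (fun a => decide (ConicCriterion (A a) (B a) (X a) (T a))) :=
  ((((hp.conicDet hA hB hX hT).zeq hp.zero).not).or
    ((((hp.disc hX.gval).zeq hp.zero).not.and (hp.isSquare (hp.disc hX.gval))).or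
    ((((hp.disc hX.gval).zeq hp.zero).and (hp.isSquare (hp.disc hB.gval))).or
    (hp.pairCheck hA hB hX hT (hp.conicPair hA hB hX hT (hp.conicVertex hA hB hX hT)
      hp.zero)).eq_true))).of_iff fun _ => Iff.rfl

end conic

theorem cipolla (hp : PTime e p) (hc : PTime e c) (hr : PTime e r) :
    PTime e (fun a => cipolla (c a) (r a)) := by
  have hn : PTime e (fun a => (p a + 1) / 2) :=
    (hp.add (const 1)).div2.of_eq fun a => Nat.div2_val _
  exact ite' (hc.zeq hp.zero) hp.zero
    (hp.mpow (mk hr (hp.zsub (hp.zpow hr (const 2)) hc) hp.one hr) hn).m00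

variable {tr : ∀ a, List (ZMod (p a) × ZMod (p a))}

theorem conicTrial (hp : PTime e p) (hA : PTime e A) (hB : PTime e B) (hX : PTime e X)
    (hT : PTime e T) {x : ∀ a, ZMod (p a) × ZMod (p a)} (hx : PTime e x) :
    PTime e (fun a => conicTrial (A a) (B a) (X a) (T a) (x a)) :=
  hp.conicPair hA hB hX hT hx.fst (hp.cipolla (hp.conicDisc hA hB hX hT hx.fst) hx.snd)

theorem candidates (hp : PTime e p) (hA : PTime e A) (hB : PTime e B) (hX : PTime e X)
    (hT : PTime e T) (htr : PTime e tr) :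
    PTime e (fun a => candidates (A a) (B a) (X a) (T a) (tr a)) := by
  obtain ⟨K, hK⟩ := exists_length_gl_le hp
  refine (hp.gone.pair (hp.conjOf hB (hp.gmul (hp.ginv hA) hT))).cons
    ((hp.conicPair hA hB hX hT (hp.conicVertex hA hB hX hT) hp.zero).cons
    (map (g := fun a x => _root_.conicTrial (A a) (B a) (X a) (T a) x)
      (hp.ctx.conicTrial hA.ctxD hB.ctxD hX.ctxD hT.ctxD elem) htr ⟨3 * K + 1, fun a x _ => ?_⟩))
  rw [length_enc_prod]
  have h1 := hK a (_root_.conicTrial (A a) (B a) (X a) (T a) x).1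
  have h2 := hK a (_root_.conicTrial (A a) (B a) (X a) (T a) x).2
  simp only [Polynomial.eval_add, Polynomial.eval_mul, Polynomial.eval_ofNat,
    Polynomial.eval_one]
  omega

theorem searchNonscalar (hp : PTime e p) (hN : PTime e N) (hT : PTime e T) (htr : PTime e tr) :
    PTime e (fun a => searchNonscalar (N a) (T a) (tr a)) := by
  have hA := hN.headD hp.gone
  have hB := hN.tail.headD hp.gone
  have hX := hp.chain hN.tail.tail
  have ho := find? (F := fun a => _root_.pairCheck ((N a).headD 1) ((N a).tail.headD 1)
    (_root_.chain (N a).tail.tail).1 (T a))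
    (hp.ctx.pairCheck hA.ctxD hB.ctxD hX.fst.ctxD hT.ctxD elem)
    (hp.candidates hA hB hX.fst hT htr)
  have hz := ho.getD (hp.gone.pair hp.gone)
  exact hN.isEmpty.ite (ite' (hT.geq hp.gone) nil.some' none')
    (hN.tail.isEmpty.ite none' (ho.isSome.ite (hz.fst.cons (hz.snd.cons hX.snd)).some' none'))

open Classical in
theorem decideNonscalar (hp : PTime e p) (hN : PTime e N) (hT : PTime e T) :
    PTime e (fun a => decide (DecideNonscalar (N a) (T a))) := by
  have hA := hN.headD hp.gone
  have hB := hN.tail.headD hp.gone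
  have hX := hp.chain hN.tail.tail
  have h := hN.isEmpty.ite (hT.geq hp.gone) (hN.tail.isEmpty.ite (const false)
    (bool₂ (fun x y => x && y) ((hp.zmul (hp.zmul (hp.mdet hA.gval) (hp.mdet hB.gval))
      (hp.mdet hX.fst.gval)).zeq (hp.mdet hT.gval)) (hN.tail.tail.isEmpty.ite
      (hp.pairCheck hA hB hX.fst hT (hp.gone.pair (hp.conjOf hB (hp.gmul (hp.ginv hA) hT))))
      (hp.conicCriterion hA hB hX.fst hT))))
  refine h.of_eq fun a => ?_
  rw [DecideNonscalar]
  split_ifs <;> simp [*]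

end PTime

/-! ### Random residues from random bits -/

/-- Reads a number with as many bits as `w` is long from a list of bits. The result is the rest of
the list and the number. -/
def draw {β : Type*} (w : List β) (l : List Bool) : List Bool × ℕ :=
  w.foldl (fun s _ => (s.1.tail, Nat.bit (s.1.headD false) s.2)) (l, 0)

/-- Reads a pair of residues, each one from as many bits as `w` is long, and adds it to a list. -/
def drawPair {β : Type*} (p : ℕ) (w : List β) (s : List Bool × List (ZMod p × ZMod p)) :
    List Bool × List (ZMod p × ZMod p) :=
  ((draw w (draw w s.1).1).1,
    (((draw w s.1).2 : ZMod p), ((draw w (draw w s.1).1).2 : ZMod p)) :: s.2)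

/-- Reads `t` pairs of residues. -/
def drawPairs {β : Type*} (p : ℕ) (w : List β) (t : ℕ) (s : List Bool × List (ZMod p × ZMod p)) :
    List (ZMod p × ZMod p) :=
  ((List.replicate t ()).foldl (fun s _ => drawPair p w s) s).2

theorem draw_append {β : Type*} (w : List β) (u l : List Bool) (h : u.length = w.length) :
    draw w (u ++ l) = (l, ofBits u) := by
  have h1 : ∀ (w : List β) (u : List Bool) (n : ℕ), u.length = w.length →
      w.foldl (fun s _ => (s.1.tail, Nat.bit (s.1.headD false) s.2)) (u ++ l, n) =
        (l, u.foldl (fun n b => Nat.bit b n) n) := by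
    intro w
    induction w with
    | nil => intro u n h; simp [List.length_eq_zero_iff.1 h]
    | cons x w ih =>
      intro u n h
      cases u with
      | nil => simp at h
      | cons b u =>
        rw [List.foldl_cons, List.foldl_cons, ← ih u _ (by simpa using h)]
        rfl
  exact h1 w u 0 h

theorem drawPairs_append {β : Type*} (p : ℕ) (w : List β) (t : ℕ) (u v l : List Bool)
    (out : List (ZMod p × ZMod p)) (hu : u.length = w.length) (hv : v.length = w.length) :
    drawPairs p w (t + 1) (u ++ (v ++ l), out) =
      drawPairs p w t (l, ((ofBits u : ZMod p), (ofBits v : ZMod p)) :: out) := by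
  rw [drawPairs, List.replicate_succ, List.foldl_cons, drawPair, draw_append w u _ hu,
    draw_append w v _ hv, drawPairs]

theorem mem_drawPairs {β : Type*} {p : ℕ} {w : List β} {t : ℕ} {l : List Bool}
    {out : List (ZMod p × ZMod p)} {x : ZMod p × ZMod p} (hx : x ∈ out) :
    x ∈ drawPairs p w t (l, out) := by
  induction t generalizing l out with
  | zero => exact hx
  | succ t ih =>
    rw [drawPairs, List.replicate_succ, List.foldl_cons, ← drawPairs]
    exact ih (List.mem_cons_of_mem _ hx)

/-- The number of words of `m` bits that satisfy `P`. -/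
noncomputable def bitCount (m : ℕ) (P : List Bool → Prop) : ℕ :=
  Nat.card {r : Fin m → Bool // P (List.ofFn r)}

theorem bitCount_eq_sum (m : ℕ) (P : List Bool → Prop) [DecidablePred P] :
    bitCount m P = ∑ r : Fin m → Bool, if P (List.ofFn r) then 1 else 0 := by
  rw [bitCount, Nat.card_eq_fintype_card, Fintype.card_subtype, Finset.card_filter]

theorem bitCount_congr {m : ℕ} {P Q : List Bool → Prop} (h : ∀ l, l.length = m → (P l ↔ Q l)) :
    bitCount m P = bitCount m Q := by
  classical
  rw [bitCount_eq_sum, bitCount_eq_sum]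
  exact Finset.sum_congr rfl fun r _ => by simp only [h _ (List.length_ofFn (f := r))]

theorem bitCount_not (m : ℕ) (P : List Bool → Prop) :
    bitCount m P + bitCount m (fun l => ¬ P l) = 2 ^ m := by
  classical
  rw [bitCount_eq_sum, bitCount_eq_sum, ← Finset.sum_add_distrib]
  have : ∀ r : Fin m → Bool, ((if P (List.ofFn r) then 1 else 0) +
      if ¬ P (List.ofFn r) then 1 else 0) = 1 := fun r => by split_ifs <;> rfl
  simp only [this]
  simp

theorem bitCount_mono {m : ℕ} {P Q : List Bool → Prop} (h : ∀ l, P l → Q l) :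
    bitCount m P ≤ bitCount m Q := by
  classical
  rw [bitCount_eq_sum, bitCount_eq_sum]
  refine Finset.sum_le_sum fun r _ => ?_
  split_ifs with h1 h2
  · exact le_rfl
  · exact absurd (h _ h1) h2
  · exact Nat.zero_le _
  · exact le_rfl

theorem bitCount_add (m k : ℕ) (P : List Bool → Prop) :
    bitCount (m + k) P = ∑ u : Fin m → Bool, bitCount k fun l => P (List.ofFn u ++ l) := by
  classical
  simp only [bitCount_eq_sum]
  rw [← Fintype.sum_prod_type', ← (Fin.appendEquiv m k).sum_comp]
  refine Finset.sum_congr rfl fun x _ => ?_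
  rw [← List.ofFn_fin_append]
  rfl

/-- If the first `m` bits satisfy `Q`, then at least `y` continuations satisfy `P`. -/
theorem mul_le_bitCount_add {m k y : ℕ} {P Q : List Bool → Prop}
    (h : ∀ u, u.length = m → Q u → y ≤ bitCount k fun l => P (u ++ l)) :
    bitCount m Q * y ≤ bitCount (m + k) P := by
  classical
  rw [bitCount_add, bitCount_eq_sum, Finset.sum_mul]
  refine Finset.sum_le_sum fun u _ => ?_
  split_ifs with hu
  · rw [one_mul]
    exact h _ (by simp) hu
  · simp

/-- If the first `m` bits satisfy `Q`, then at most `y` continuations satisfy `P`, and otherwise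
none does. -/
theorem bitCount_add_le {m k y : ℕ} {P Q : List Bool → Prop}
    (h : ∀ u, u.length = m → Q u → (bitCount k fun l => P (u ++ l)) ≤ y)
    (h' : ∀ u, u.length = m → ¬ Q u → ∀ l, ¬ P (u ++ l)) :
    bitCount (m + k) P ≤ bitCount m Q * y := by
  classical
  rw [bitCount_add, bitCount_eq_sum m Q, Finset.sum_mul]
  refine Finset.sum_le_sum fun u _ => ?_
  split_ifs with hu
  · rw [one_mul]
    exact h _ (by simp) hu
  · rw [bitCount_eq_sum]
    simp [h' _ (by simp) hu]

theorem exists_ofBits_eq {n x : ℕ} (hx : x < 2 ^ n) :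
    ∃ r : Fin n → Bool, ofBits (List.ofFn r) = x := by
  have h1 : ∀ n x, x < 2 ^ n → ∃ l : List Bool, l.length = n ∧ ofBits l = x := by
    intro n
    induction n with
    | zero => exact fun x hx => ⟨[], rfl, by simpa [ofBits] using (Nat.lt_one_iff.1 hx).symm⟩
    | succ n ih =>
      intro x hx
      obtain ⟨l, h1, h2⟩ := ih x.div2 (div2_lt_pow hx)
      refine ⟨l ++ [x.bodd], by simp [h1], ?_⟩
      rw [ofBits, List.foldl_append, ← ofBits, h2, List.foldl_cons, List.foldl_nil,
        Nat.bit_bodd_div2]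
  obtain ⟨l, rfl, h2⟩ := h1 n x hx
  exact ⟨l.get, by rw [List.ofFn_get, h2]⟩

/-- Every residue is represented by at least `2 ^ n / p` numbers of `n` bits. -/
theorem card_mul_le_bitCount {p n : ℕ} [NeZero p] (S : Finset (ZMod p)) :
    S.card * (2 ^ n / p) ≤ bitCount n fun l => (ofBits l : ZMod p) ∈ S := by
  have h1 : ∀ x : S × Fin (2 ^ n / p), ∃ r : Fin n → Bool,
      ofBits (List.ofFn r) = x.1.val.val + p * x.2 := by
    intro x
    refine exists_ofBits_eq ?_
    have h2 := ZMod.val_lt x.1.val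
    calc x.1.val.val + p * x.2 < p * (x.2 + 1) := by rw [mul_add, mul_one]; omega
      _ ≤ p * (2 ^ n / p) := Nat.mul_le_mul_left _ x.2.2
      _ ≤ 2 ^ n := Nat.mul_div_le _ _
  choose r hr using h1
  have h2 : ∀ x, ((ofBits (List.ofFn (r x)) : ℕ) : ZMod p) = x.1.val := fun x => by
    rw [hr, Nat.cast_add, ZMod.natCast_zmod_val, Nat.cast_mul, ZMod.natCast_self, zero_mul,
      add_zero]
  rw [bitCount]
  refine le_trans (le_of_eq ?_) (Nat.card_le_card_of_injective
    (fun x : S × Fin (2 ^ n / p) => (⟨r x, by rw [h2]; exact x.1.2⟩ :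
      {r : Fin n → Bool // (ofBits (List.ofFn r) : ZMod p) ∈ S})) ?_)
  · simp
  · intro x y hxy
    have h3 : r x = r y := congrArg Subtype.val hxy
    have h4 : x.1 = y.1 := Subtype.ext (by rw [← h2, ← h2, h3])
    have h5 := hr x
    rw [h3, hr y, h4] at h5
    refine Prod.ext h4 (Fin.ext ?_)
    exact (Nat.eq_of_mul_eq_mul_left (NeZero.pos p) (Nat.add_left_cancel h5)).symm

/-- A set of about half of the residues is hit with probability at least `1 / 5`. -/
theorem two_pow_le_bitCount {p n : ℕ} (hp : 5 ≤ p) (hpn : p ≤ 2 ^ n) {S : Finset (ZMod p)}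
    (hS : p ≤ 2 * S.card + 1) : 2 ^ n ≤ 5 * bitCount n fun l => (ofBits l : ZMod p) ∈ S := by
  have : NeZero p := ⟨by omega⟩
  refine le_trans ?_ (Nat.mul_le_mul_left 5 (card_mul_le_bitCount S))
  have h1 : 1 ≤ 2 ^ n / p := Nat.div_pos hpn (by omega)
  have h2 : 2 ^ n < p * (2 ^ n / p + 1) := Nat.lt_mul_div_succ _ (by omega)
  generalize 2 ^ n / p = q at *
  generalize S.card = s at *
  nlinarith [Nat.mul_le_mul_right q hS, Nat.mul_le_mul_left p h1, Nat.mul_le_mul_right q hp]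

/-- The probability that `t` independent random pairs contain no good one is at most
`(24 / 25) ^ t`, as either component of a pair is good with probability at least `1 / 5`. -/
theorem bitCount_drawPairs_le {p : ℕ} {β : Type*} {w : List β} (hp : 5 ≤ p)
    (hpw : p ≤ 2 ^ w.length) {S : Finset (ZMod p)} {R : ZMod p → Finset (ZMod p)}
    (hS : p ≤ 2 * S.card + 1) (hR : ∀ c ∈ S, p ≤ 2 * (R c).card + 1) (t : ℕ)
    (out : List (ZMod p × ZMod p)) :
    25 ^ t * bitCount (t * (w.length + w.length)) (fun l =>
      ¬ ∃ x ∈ drawPairs p w t (l, out), x.1 ∈ S ∧ x.2 ∈ R x.1) ≤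
      24 ^ t * 2 ^ (t * (w.length + w.length)) := by
  induction t generalizing out with
  | zero =>
    have := bitCount_not (0 * (w.length + w.length)) fun l =>
      ∃ x ∈ drawPairs p w 0 (l, out), x.1 ∈ S ∧ x.2 ∈ R x.1
    rw [pow_zero, pow_zero, one_mul, one_mul, ← this]
    exact Nat.le_add_left _ _
  | succ t ih =>
    set n := w.length with hn
    set Good : List Bool → Prop := fun l =>
      ((draw w l).2 : ZMod p) ∈ S ∧ ((draw w (draw w l).1).2 : ZMod p) ∈ R (draw w l).2
    have hgood : ∀ u v l : List Bool, u.length = n → v.length = n →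
        (Good (u ++ (v ++ l)) ↔ (ofBits u : ZMod p) ∈ S ∧ (ofBits v : ZMod p) ∈ R (ofBits u)) := by
      intro u v l hu hv
      simp only [Good, draw_append w u _ hu, draw_append w v _ hv]
    have h1 : 2 ^ (n + n) ≤ 25 * bitCount (n + n) Good := by
      have h2 := two_pow_le_bitCount hp hpw hS
      have h3 := mul_le_bitCount_add (m := n) (k := n) (P := Good) (y := (2 ^ n + 4) / 5)
        (Q := fun l => (ofBits l : ZMod p) ∈ S) fun u hu hu' => by
          have h4 := two_pow_le_bitCount hp hpw (hR _ hu')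
          rw [bitCount_congr (Q := fun l => (ofBits l : ZMod p) ∈ R (ofBits u))]
          · omega
          · intro v hv
            have := hgood u v [] hu hv
            rw [List.append_nil] at this
            rw [this, and_iff_right hu']
      have h5 : 2 ^ n ≤ 5 * ((2 ^ n + 4) / 5) := by omega
      calc 2 ^ (n + n) = 2 ^ n * 2 ^ n := pow_add _ _ _
        _ ≤ (5 * bitCount n fun l => (ofBits l : ZMod p) ∈ S) * (5 * ((2 ^ n + 4) / 5)) :=
          Nat.mul_le_mul h2 h5
        _ = 25 * ((bitCount n fun l => (ofBits l : ZMod p) ∈ S) * ((2 ^ n + 4) / 5)) := by ring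
        _ ≤ _ := Nat.mul_le_mul_left _ h3
    have h2 : 25 * bitCount (n + n) (fun l => ¬ Good l) ≤ 24 * 2 ^ (n + n) := by
      have := bitCount_not (n + n) Good
      omega
    have hsplit : ∀ u : List Bool, u.length = n + n →
        ∃ u1 u2 : List Bool, u = u1 ++ u2 ∧ u1.length = n ∧ u2.length = n := fun u hu =>
      ⟨u.take n, u.drop n, (List.take_append_drop n u).symm, by simp [hu], by simp [hu]⟩
    have h3 := bitCount_add_le (m := n + n) (k := t * (n + n))
      (P := fun l => ¬ ∃ x ∈ drawPairs p w (t + 1) (l, out), x.1 ∈ S ∧ x.2 ∈ R x.1)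
      (Q := fun l => ¬ Good l) (y := 24 ^ t * 2 ^ (t * (n + n)) / 25 ^ t) ?_ ?_
    · rw [show (t + 1) * (n + n) = n + n + t * (n + n) by ring]
      refine (Nat.mul_le_mul_left _ h3).trans ?_
      have h4 := Nat.mul_div_le (24 ^ t * 2 ^ (t * (n + n))) (25 ^ t)
      generalize 24 ^ t * 2 ^ (t * (n + n)) / 25 ^ t = y at *
      calc 25 ^ (t + 1) * (bitCount (n + n) (fun l => ¬ Good l) * y)
          = (25 * bitCount (n + n) (fun l => ¬ Good l)) * (25 ^ t * y) := by ring
        _ ≤ (24 * 2 ^ (n + n)) * (24 ^ t * 2 ^ (t * (n + n))) := Nat.mul_le_mul h2 h4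
        _ = _ := by ring
    · intro u hu _
      obtain ⟨u1, u2, rfl, h4, h5⟩ := hsplit u hu
      rw [Nat.le_div_iff_mul_le (by positivity), mul_comm]
      have := ih (((ofBits u1 : ZMod p), (ofBits u2 : ZMod p)) :: out)
      simpa only [List.append_assoc, drawPairs_append p w t u1 u2 _ out h4 h5] using this
    · intro u hu hu' l h6
      obtain ⟨u1, u2, rfl, h4, h5⟩ := hsplit u hu
      rw [not_not] at hu'
      have h7 := hgood u1 u2 [] h4 h5
      rw [List.append_nil] at h7
      obtain ⟨h8, h9⟩ := h7.1 hu'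
      refine h6 ⟨((ofBits u1 : ZMod p), (ofBits u2 : ZMod p)), ?_, h8, h9⟩
      rw [List.append_assoc, drawPairs_append p w t u1 u2 _ out h4 h5]
      exact mem_drawPairs (by simp)

namespace PTime

variable {α : Type} {e : α → Word}

theorem draw {β : Type} [Enc β] {w : α → List β} {l : α → List Bool} (hw : PTime e w)
    (hl : PTime e l) : PTime e (fun a => draw (w a) (l a)) := by
  have hs := state (e := e) (σ := fun _ => List Bool × ℕ) (β := fun _ => β)
  refine foldl (e := e) (σ := fun _ => List Bool × ℕ) (β := fun _ => β)
    (step := fun _ s _ => (s.1.tail, Nat.bit (s.1.headD false) s.2))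
    (hs.fst.tail.pair ((hs.fst.headD (const false)).bit hs.snd)) (hl.pair (const 0)) hw
    ⟨1, fun a s x _ => ?_⟩
  obtain ⟨l, n⟩ := s
  have h1 := size_bit_le (l.headD false) n
  rw [← length_enc_nat, ← length_enc_nat] at h1
  simp only [length_enc_prod, Polynomial.eval_one]
  cases l with
  | nil => simp only [List.tail_nil]; omega
  | cons b l => rw [List.tail_cons, length_enc_cons]; omega

theorem length_draw_le {β : Type} (w : List β) (l : List Bool) :
    (enc (_root_.draw w l).1).length ≤ (enc l).length := by
  have h1 : ∀ (w : List β) (s : List Bool × ℕ), (enc (w.foldl (fun s _ =>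
      (s.1.tail, Nat.bit (s.1.headD false) s.2)) s).1).length ≤ (enc s.1).length := by
    intro w
    induction w with
    | nil => exact fun _ => le_rfl
    | cons x w ih =>
      rintro ⟨l, n⟩
      refine (ih _).trans ?_
      cases l with
      | nil => exact le_refl (enc ([] : List Bool)).length
      | cons b l =>
        change (enc l).length ≤ (enc (b :: l)).length
        rw [length_enc_cons]
        omega
  exact h1 w _

variable {p : α → ℕ}

theorem drawPair (hp : PTime e p) {β : Type} [Enc β] {w : α → List β} (hw : PTime e w)
    {s : ∀ a, List Bool × List (ZMod (p a) × ZMod (p a))} (hs : PTime e s) :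
    PTime e (fun a => drawPair (p a) (w a) (s a)) := by
  have h1 := hw.draw hs.fst
  have h2 := hw.draw h1.fst
  exact h2.fst.pair (((hp.natCast h1.snd).pair (hp.natCast h2.snd)).cons hs.snd)

theorem drawPairs [∀ a, NeZero (p a)] (hp : PTime e p) {β : Type} [Enc β] {w : α → List β}
    (hw : PTime e w) {l : α → List Bool} (hl : PTime e l) (t : ℕ) :
    PTime e (fun a => drawPairs (p a) (w a) t (l a, [])) := by
  obtain ⟨K, hK⟩ := exists_length_zmod_le hp
  have h := foldl (e := e) (σ := fun a => List Bool × List (ZMod (p a) × ZMod (p a)))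
    (β := fun _ => Unit) (step := fun a s _ => _root_.drawPair (p a) (w a) s)
    (hp.ctx.drawPair hw.ctx state) (hl.pair nil) (const (List.replicate t ())) ⟨6 * K + 3, ?_⟩
  · exact h.snd
  · rintro a ⟨l, out⟩ u -
    have h1 := length_draw_le (w a) l
    have h2 := length_draw_le (w a) (_root_.draw (w a) l).1
    have h3 := hK a ((_root_.draw (w a) l).2 : ZMod (p a))
    have h4 := hK a ((_root_.draw (w a) (_root_.draw (w a) l).1).2 : ZMod (p a))
    rw [_root_.drawPair]
    simp only [length_enc_prod, length_enc_cons, Polynomial.eval_add, Polynomial.eval_mul,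
      Polynomial.eval_ofNat]
    omega

end PTime

/-! ### The algorithms for tuples of matrices -/

/-- The search for a solution with the random bits `r`: exhaustive for the primes `2` and `3`, and
with `30` random pairs otherwise. For every residue as many bits are read as the input is long,
which is enough as `p` is part of the input. -/
def searchTuple (I : MatrixTuple) (r : List Bool) : Option (List (GL (Fin 2) (ZMod I.p))) :=
  if I.p < 5 then
    if 1 ∈ reach (smallGL I.p) I.mats then some (pick (smallGL I.p) I.mats 1) else none
  else
    let o := searchNonscalar (nonscalars I.mats) (scalarPart I.mats)⁻¹
      (drawPairs I.p (encodeMatrixTuple I) 30 (r, []))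
    if o.isSome then some (spread I.mats (o.getD [])) else none

/-- The decision whether there is a solution, by the same two methods as in `searchTuple`. -/
def DecideTuple (I : MatrixTuple) : Prop :=
  if I.p < 5 then 1 ∈ reach (smallGL I.p) I.mats
  else DecideNonscalar (nonscalars I.mats) (scalarPart I.mats)⁻¹

theorem le_three_of_prime {p : ℕ} (hp : p.Prime) (h : p < 5) : p ≤ 3 := by
  by_contra h'
  obtain rfl : p = 4 := by omega
  exact absurd hp (by norm_num)

theorem not_isScalar_of_mem_nonscalars {F : Type*} [Field F] [DecidableEq F]
    {C : List (GL (Fin 2) F)} : ∀ M ∈ nonscalars C, ¬ IsScalar M.val := fun M hM => by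
  simpa using (List.mem_filter.1 hM).2

theorem solvesTo_of_searchTuple {I : MatrixTuple} {r : List Bool}
    {z : List (GL (Fin 2) (ZMod I.p))} (h : searchTuple I r = some z) : SolvesTo I.mats z 1 := by
  rw [searchTuple] at h
  split_ifs at h with h1 h2
  · rw [← Option.some.inj h]
    exact solvesTo_pick (mem_smallGL (le_three_of_prime I.prime h1)) h2
  · dsimp only at h
    split_ifs at h with h3
    rw [← Option.some.inj h]
    obtain ⟨zs, hzs⟩ := Option.isSome_iff_exists.1 h3
    rw [hzs, Option.getD_some]
    refine solvesTo_spread ?_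
    rw [mul_one]
    exact solvesTo_of_searchNonscalar (not_lt.1 h1) not_isScalar_of_mem_nonscalars hzs

theorem decideTuple_iff (I : MatrixTuple) : DecideTuple I ↔ I.Satisfiable := by
  rw [DecideTuple]
  split_ifs with h1
  · have h2 := mem_smallGL (le_three_of_prime I.prime h1)
    exact ⟨fun h => ⟨_, solvesTo_pick h2 h⟩, fun ⟨z, hz⟩ => mem_reach_of_solvesTo h2 hz⟩
  · rw [decideNonscalar_iff (not_lt.1 h1) not_isScalar_of_mem_nonscalars
      (isScalar_inv (isScalar_scalarPart _))]
    constructor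
    · rintro ⟨z, hz⟩
      exact ⟨_, solvesTo_spread (by rwa [mul_one])⟩
    · rintro ⟨z, hz⟩
      obtain ⟨zs, hzs⟩ := solvesTo_nonscalars (h := 1) hz
      exact ⟨zs, by rwa [mul_one] at hzs⟩

theorem modulus_le_two_pow (I : MatrixTuple) : I.p ≤ 2 ^ (encodeMatrixTuple I).length := by
  have h1 : I.p.size ≤ (encodeMatrixTuple I).length := by
    rw [encodeMatrixTuple, encodeNatList, List.flatMap_cons, encodeNat_eq_bits,
      ← Nat.size_eq_bits_len]
    simp only [List.length_append, List.length_map]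
    omega
  exact (Nat.lt_size_self _).le.trans (Nat.pow_le_pow_right (by norm_num) h1)

/-- The search succeeds with probability at least `2 / 3` if there is a solution. It reads `30`
pairs of residues, and `(24 / 25) ^ 30 ≤ 1 / 3`. -/
theorem bitCount_searchTuple {I : MatrixTuple} (h : I.Satisfiable) :
    2 * 2 ^ (60 * (encodeMatrixTuple I).length) ≤
      3 * bitCount (60 * (encodeMatrixTuple I).length)
        fun r => (searchTuple I r).isSome = true := by
  have h0 := (decideTuple_iff I).2 h
  rw [DecideTuple] at h0
  split_ifs at h0 with h1
  · have h2 : ∀ r, (searchTuple I r).isSome = true := fun r => by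
      rw [searchTuple, if_pos h1, if_pos h0, Option.isSome_some]
    have h3 := bitCount_not (60 * (encodeMatrixTuple I).length)
      fun r => (searchTuple I r).isSome = true
    have h4 : (bitCount (60 * (encodeMatrixTuple I).length)
        fun r => ¬ (searchTuple I r).isSome = true) = 0 := by
      classical
      rw [bitCount_eq_sum]
      simp [h2]
    omega
  · obtain ⟨S, R, hS, hR, hSR⟩ := exists_good_pairs (not_lt.1 h1) not_isScalar_of_mem_nonscalars
      (isScalar_inv (isScalar_scalarPart I.mats)) h0
    have h2 := bitCount_drawPairs_le (not_lt.1 h1) (modulus_le_two_pow I) hS hR 30 []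
    rw [show 30 * ((encodeMatrixTuple I).length + (encodeMatrixTuple I).length) =
      60 * (encodeMatrixTuple I).length by ring] at h2
    have h3 := bitCount_not (60 * (encodeMatrixTuple I).length)
      fun r => ∃ x ∈ drawPairs I.p (encodeMatrixTuple I) 30 (r, []), x.1 ∈ S ∧ x.2 ∈ R x.1
    have h4 : (bitCount (60 * (encodeMatrixTuple I).length) fun r =>
        ∃ x ∈ drawPairs I.p (encodeMatrixTuple I) 30 (r, []), x.1 ∈ S ∧ x.2 ∈ R x.1) ≤
        bitCount (60 * (encodeMatrixTuple I).length) fun r => (searchTuple I r).isSome = true := by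
      refine bitCount_mono fun r hr => ?_
      rw [searchTuple, if_neg h1]
      simp [hSR _ hr]
    omega

namespace PTime

variable {α : Type} {e : α → Word}

theorem gmem {p : α → ℕ} [∀ a, Fact (p a).Prime] {g : ∀ a, GL (Fin 2) (ZMod (p a))}
    {l : ∀ a, List (GL (Fin 2) (ZMod (p a)))} (hg : PTime e g) (hl : PTime e l) :
    PTime e (fun a => decide (g a ∈ l a)) :=
  (any (F := fun a x => decide (x = g a)) (elem.geq hg.ctxD) hl).of_eq fun a => by
    rw [Bool.eq_iff_iff, List.any_eq_true, decide_eq_true_iff]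
    simp

variable {I : α → MatrixTuple}

open Classical in
theorem decideTuple (h : PTime e fun a => _root_.encodeMatrixTuple (I a)) :
    PTime e (fun a => decide (DecideTuple (I a))) := by
  have hp := h.modulus
  have hC := h.mats
  have h1 := (hp.lt (const 5)).ite (gmem hp.gone (hp.reach hp.smallGL hC))
    (hp.decideNonscalar (hp.nonscalars hC) (hp.ginv (hp.scalarPart hC)))
  refine h1.of_eq fun a => ?_
  by_cases h2 : (I a).p < 5
  · simp [DecideTuple, h2]
  · simp [DecideTuple, h2]

theorem searchTuple (h : PTime e fun a => _root_.encodeMatrixTuple (I a)) {r : α → List Bool}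
    (hr : PTime e r) : PTime e (fun a => searchTuple (I a) (r a)) := by
  have hp := h.modulus
  have hC := h.mats
  have ho := hp.searchNonscalar (hp.nonscalars hC) (hp.ginv (hp.scalarPart hC))
    (hp.drawPairs h hr 30)
  exact ite' (hp.lt (const 5)) (ite' (gmem hp.gone (hp.reach hp.smallGL hC))
    (hp.pick hp.smallGL hC hp.gone).some' none')
    (ho.isSome.ite (hp.spread hC (ho.getD nil)).some' none')

end PTime

/-! ### Words over the input and output alphabets -/

theorem length_enc_option_bool_le (o : Option Bool) : (enc o).length ≤ 2 := by
  cases o with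
  | none => exact Nat.zero_le 2
  | some b => exact le_refl 2

theorem enc_bool_injective : Function.Injective (enc : Bool → Word) :=
  fun _ _ h => (List.cons.inj h).1

theorem enc_option_injective {β : Type} [Enc β] (h : Function.Injective (enc : β → Word)) :
    Function.Injective (enc : Option β → Word) := by
  intro x y hxy
  cases x <;> cases y
  · rfl
  · exact absurd hxy (List.cons_ne_nil _ _).symm
  · exact absurd hxy (List.cons_ne_nil _ _)
  · exact congrArg some (h (List.cons.inj hxy).2)

namespace PTime

variable {α : Type} {e : α → Word}

/-- The left part of a word over a sum of alphabets. -/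
theorem lefts {w : α → List (Option Bool)} {r : α → List Bool}
    (h : PTime e fun a => (w a).map (Sum.inl (β := Bool)) ++ (r a).map Sum.inr) : PTime e w := by
  have hx := elem (e := e) (σ := fun _ => List (Option Bool)) (β := fun _ => Option Bool ⊕ Bool)
  have hs := state (e := e) (σ := fun _ => List (Option Bool)) (β := fun _ => Option Bool ⊕ Bool)
  have h1 := foldr (e := e) (σ := fun _ => List (Option Bool)) (β := fun _ => Option Bool ⊕ Bool)
    (step := fun _ x s => if x.isRight then s else (x.elim id fun _ => none) :: s)
    (i := fun _ => [])
    (hx.isRight.ite hs ((hx.getLeftD (const none)).cons hs)) nil h ⟨5, fun a s x _ => ?_⟩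
  · refine h1.of_eq fun a => ?_
    rw [List.foldr_append]
    have h2 : ∀ l : List Bool, (l.map (Sum.inr (α := Option Bool))).foldr
        (fun x s => if x.isRight then s else (x.elim id fun _ => none) :: s) [] = [] := by
      intro l
      induction l with
      | nil => rfl
      | cons b l ih => rw [List.map_cons, List.foldr_cons, ih]; rfl
    rw [h2]
    induction w a with
    | nil => rfl
    | cons b l ih => rw [List.map_cons, List.foldr_cons, ih]; rfl
  · simp only [Polynomial.eval_ofNat]
    split_ifs
    · omega
    · rw [length_enc_cons]
      have := length_enc_option_bool_le (x.elim id fun _ => none)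
      omega

/-- The right part of a word over a sum of alphabets. -/
theorem rights {w : α → List (Option Bool)} {r : α → List Bool}
    (h : PTime e fun a => (w a).map (Sum.inl (β := Bool)) ++ (r a).map Sum.inr) : PTime e r := by
  have hx := elem (e := e) (σ := fun _ => List Bool) (β := fun _ => Option Bool ⊕ Bool)
  have hs := state (e := e) (σ := fun _ => List Bool) (β := fun _ => Option Bool ⊕ Bool)
  have h1 := foldr (e := e) (σ := fun _ => List Bool) (β := fun _ => Option Bool ⊕ Bool)
    (step := fun _ x s => if x.isRight then (x.elim (fun _ => false) id) :: s else s)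
    (i := fun _ => [])
    (hx.isRight.ite ((hx.getRightD (const false)).cons hs) hs) nil h ⟨5, fun a s x _ => ?_⟩
  · refine h1.of_eq fun a => ?_
    rw [List.foldr_append]
    have h2 : ∀ l : List Bool, (l.map (Sum.inr (α := Option Bool))).foldr
        (fun x s => if x.isRight then (x.elim (fun _ => false) id) :: s else s) [] = l := by
      intro l
      induction l with
      | nil => rfl
      | cons b l ih => rw [List.map_cons, List.foldr_cons, ih]; rfl
    rw [h2]
    induction w a with
    | nil => rfl
    | cons b l ih => rw [List.map_cons, List.foldr_cons, ih]; rfl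
  · simp only [Polynomial.eval_ofNat]
    split_ifs
    · rw [length_enc_cons]
      have : (enc (x.elim (fun _ => false) id)).length = 1 := rfl
      omega
    · omega

end PTime

/-! ### Spherical equations over `GL₂(p)` -/

theorem decidableInPolyTime_satisfiable :
    DecidableInPolyTime encodingMatrixTuple MatrixTuple.Satisfiable := by
  classical
  have h1 : PTime (fun I => enc (encodeMatrixTuple I)) encodeMatrixTuple := PolyW.refl _
  have h2 := h1.decideTuple.cons PTime.nil
  refine PolyW.nonempty_computable _ _ _ enc enc enc_bool_injective ?_
  refine PolyW.congr h2 fun I => ?_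
  simp only [decideTuple_iff]
  rfl

/-- The result of the search as a tuple of matrices. -/
def searchSolution (x : MatrixTuple × List Bool) : Option MatrixTuple :=
  (searchTuple x.1 x.2).map fun z => ⟨x.1.p, x.1.prime, z⟩

theorem nonempty_computable_searchSolution :
    Nonempty (TM2ComputableInPolyTime
      (encodingProd encodingMatrixTuple (encodingList Bool)).encode
      (encodingOption encodingMatrixTuple).encode searchSolution) := by
  have h0 : PTime (fun x : MatrixTuple × List Bool =>
      enc ((encodeMatrixTuple x.1).map Sum.inl ++ x.2.map Sum.inr))
      (fun x => (encodeMatrixTuple x.1).map Sum.inl ++ x.2.map Sum.inr) := PolyW.refl _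
  have h1 := h0.lefts
  have h2 := h1.searchTuple h0.rights
  have h3 := PTime.encodeMatrixTuple (I := fun x : MatrixTuple × List Bool =>
    ⟨x.1.p, x.1.prime, (searchTuple x.1 x.2).getD []⟩) h1.modulus (h2.getD PTime.nil)
  have h4 := h2.isSome.ite ((PTime.const (none : Option (Option Bool))).cons
    (PTime.map (β := fun _ => Option Bool) (τ := fun _ => Option (Option Bool))
      (g := fun _ o => some o) PTime.elem.some' h3 ⟨3, fun x o _ => ?_⟩)) PTime.nil
  · refine PolyW.nonempty_computable _ _ _ enc enc
      (enc_option_injective (enc_option_injective enc_bool_injective)) ?_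
    refine PolyW.congr h4 fun x => ?_
    change _ = enc ((encodingOption encodingMatrixTuple).encode (searchSolution x))
    beta_reduce
    congr 1
    cases h : searchTuple x.1 x.2 with
    | none => simp [searchSolution, h, encodingOption]
    | some z => simp [searchSolution, h, encodingOption, encodingMatrixTuple]
  · have := length_enc_option_bool_le o
    have h5 : (enc (some o)).length = (enc o).length + 1 := rfl
    simp only [Polynomial.eval_ofNat]
    omega

theorem searchableInRandPolyTime_isSolvedBy :
    SearchableInRandPolyTime encodingMatrixTuple encodingMatrixTuple MatrixTuple.IsSolvedBy := by
  -- two residues in each of `30` pairs, each one from as many bits as the input is long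
  refine ⟨60 * Polynomial.X, searchSolution, nonempty_computable_searchSolution, ?_, ?_⟩
  · intro I r J h
    obtain ⟨z, hz, rfl⟩ := Option.map_eq_some_iff.1 h
    exact ⟨z, rfl, solvesTo_of_searchTuple hz⟩
  · rintro I ⟨J, z, -, hz⟩
    have h1 := bitCount_searchTuple (I := I) ⟨z, hz⟩
    have h2 : ∀ k, k = 60 * (encodeMatrixTuple I).length → (2 / 3 : ℝ) ≤
        (Nat.card {r : Fin k → Bool // (searchSolution (I, List.ofFn r)).isSome} : ℝ) / 2 ^ k := by
      rintro k rfl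
      rw [div_le_div_iff₀ (by norm_num) (by positivity)]
      have h3 : Nat.card {r : Fin (60 * (encodeMatrixTuple I).length) → Bool //
          (searchSolution (I, List.ofFn r)).isSome} =
          bitCount (60 * (encodeMatrixTuple I).length)
            fun r => (searchTuple I r).isSome = true := by
        simp only [bitCount, searchSolution, Option.isSome_map]
      rw [h3, mul_comm _ (3 : ℝ)]
      exact_mod_cast h1
    exact h2 _ (by
      rw [Polynomial.eval_mul, Polynomial.eval_X, Polynomial.eval_ofNat]
      rfl)

theorem mem_sphEq_iff_det {p : ℕ} (hp : p.Prime) (h5 : 5 ≤ p)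
    {C : List (GL (Fin 2) (ZMod p))} (hlen : 4 ≤ C.length)
    (hC : ∀ M ∈ C, ¬ ∃ a : ZMod p, M.val = Matrix.scalar (Fin 2) a) :
    C ∈ SphEq (GL (Fin 2) (ZMod p)) ↔ (C.map Matrix.GeneralLinearGroup.det).prod = 1 := by
  have : Fact p.Prime := ⟨hp⟩
  have h1 : (C.map Matrix.GeneralLinearGroup.det).prod = 1 ↔
      (C.map fun M => M.val.det).prod = 1 := by
    rw [← Units.val_eq_one, ← Units.coeHom_apply, map_list_prod, List.map_map]
    rfl
  rw [h1]
  constructor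
  · rintro ⟨z, hz⟩
    rw [det_eq_of_solvesTo (h := 1) hz, Units.val_one, Matrix.det_one]
  · intro h
    exact isSolvable_of_four_le h5 (fun M hM hs => hC M hM (isScalar_iff.1 hs)) hlen h

theorem mainTheorem1 :
    DecidableInPolyTime encodingMatrixTuple MatrixTuple.Satisfiable ∧
    SearchableInRandPolyTime encodingMatrixTuple encodingMatrixTuple MatrixTuple.IsSolvedBy ∧
    ∀ (p : ℕ), p.Prime → 5 ≤ p →
      ∀ C : List (Matrix.GeneralLinearGroup (Fin 2) (ZMod p)), 4 ≤ C.length →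
        (∀ M ∈ C, ¬ ∃ a : ZMod p, M.val = Matrix.scalar (Fin 2) a) →
        (C ∈ SphEq (Matrix.GeneralLinearGroup (Fin 2) (ZMod p)) ↔
          (C.map Matrix.GeneralLinearGroup.det).prod = 1) :=
  ⟨decidableInPolyTime_satisfiable, searchableInRandPolyTime_isSolvedBy,
    fun _ hp h5 _ hlen hC => mem_sphEq_iff_det hp h5 hlen hC⟩
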